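/- All Lie algebras are over $\mathbb{C}$. A Lie algebra $\mathfrak g$ is *complete* if its center is zero and all its derivations are inner. A *torus* of a finite-dimensional nilpotent Lie algebra $\mathfrak n$ is an abelian subalgebra $\mathfrak t\subset \mathrm{Der}(\mathfrak n)$ consisting of semisimple endomorphisms of $\mathfrak n$; the *rank* of $\mathfrak n$ is the dimension of a maximal torus, and $\mathfrak n$ is *completable* if the semidirect product $\mathfrak n\oplus\mathfrak t$ is complete for a (equivalently, every) maximal torus $\mathfrak t$. A nilpotent Lie algebra $\mathfrak n$ of finite dimension $n$ is *filiform* if its characteristic sequence (the lexicographically largest sequence of Jordan block sizes of $\mathrm{ad}\,Y$, $Y\in\mathfrak n\setminus[\mathfrak n,\mathfrak n]$) is $(n-1,1)$. For parameters $\lambda_1,\lambda_2,\dots$ let $a_{i,j}$ ($2\le i\le j$) be the constants determined by $a_{i,i}=0$, $a_{i,i+1}=\lambda_{i-1}$ and $a_{i,j}=a_{i,j+1}+a_{i+1,j}$ for $i<j$. Consider the following Lie algebras with basis $Y_1,\dots,Y_n$; brackets not determined by those listed and skew symmetry are zero. * $A_n^k(\lambda_1,\dots,\lambda_{t-1})$,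 where $2\le k\le n-3$, $t=\lfloor\frac{n-k+1}{2}\rfloor$: $[Y_1,Y_i]=Y_{i+1}$ for $2\le i\le n-1$; $[Y_i,Y_j]=a_{i,j}Y_{i+j+k-2}$ for $2\le i<j$, $i+j+k-2\le n$. * $B_n^k(\lambda_1,\dots,\lambda_{t-1})$, where $n$ is even, $2\le k\le n-3$, $t=\lfloor\frac{n-k}{2}\rfloor$: $[Y_1,Y_i]=Y_{i+1}$ for $2\le i\le n-2$; $[Y_i,Y_{n-i+1}]=(-1)^{i+1}Y_n$ for $2\le i\le n-1$; $[Y_i,Y_j]=a_{i,j}Y_{i+j+k-2}$ for $2\le i<j$, $i+j+k-2\le n-1$. * $C_n(\lambda_1,\dots,\lambda_{m-1})$, where $n=2m+2$, $m\ge 2$: $[Y_1,Y_i]=Y_{i+1}$ for $2\le i\le n-2$; $[Y_i,Y_{n-i+1}]=(-1)^{i+1}Y_n$ for $2\le i\le n-1$; $[Y_i,Y_{n-i-2k+1}]=(-1)^{i+1}\lambda_kY_n$ for $1\le k\le m-1$, $2\le i\le n-1-2k$. In the families $A$ and $B$ the parameters do not all vanish and are such that the Jacobi identity holds; $C_n(\lambda)$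 is a Lie algebra for all values of the parameters. **Theorem.** (1) Let $\mathfrak n$ be a filiform Lie algebra of rank one. Then $\mathfrak n$ is completable if and only if $\mathfrak n$ is isomorphic to some $A_n^k(\lambda_1,\dots,\lambda_{t-1})$ or to some $B_n^k(\lambda_1,\dots,\lambda_{t-1})$. (2) Let $m\ge2$, $n=2m+2$ and let $\lambda_1,\dots,\lambda_{m-1}\in\mathbb C$ be arbitrary. The linear map $f$ with $f(Y_1)=0$, $f(Y_j)=Y_j$ for $2\le j\le n-1$, $f(Y_n)=2Y_n$ is a derivation of $C_n(\lambda)$; it spans a torus $\mathbb{C}f$ for which zero is a weight, and $C_n(\lambda)\oplus\mathbb{C}f$ is not complete. The linear map $h$ with $h(Y_2)=Y_{n-1}$ and $h(Y_j)=0$ for $j\ne2$ is a derivation of $C_n(\lambda)$ that is not inner. -/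

import Mathlib

noncomputable section

namespace FiliformLie

/-! ### Complete Lie algebras, tori, rank, completable Lie algebras -/

/-- A complex Lie algebra `g` is complete if `H⁰(g, g) = 0` (the center vanishes) and
`H¹(g, g) = 0` (every derivation is inner). -/
def IsCompleteLie (g : Type*) [LieRing g] [LieAlgebra ℂ g] : Prop :=
  LieAlgebra.center ℂ g = ⊥ ∧
    ∀ D : LieDerivation ℂ g g, ∃ x : g, ∀ y : g, D y = ⁅x, y⁆

section Torus

variable {L : Type*} [LieRing L] [LieAlgebra ℂ L]

/-- A torus of derivations: an abelian subalgebra of `Der L` all of whose elements are semisimple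
endomorphisms of `L`. -/
def IsTorus (t : LieSubalgebra ℂ (LieDerivation ℂ L L)) : Prop :=
  IsLieAbelian t ∧ ∀ D ∈ t, Module.End.IsSemisimple (D : L →ₗ[ℂ] L)

/-- A torus of derivations that is maximal for inclusion. -/
def IsMaximalTorus (t : LieSubalgebra ℂ (LieDerivation ℂ L L)) : Prop :=
  Maximal IsTorus t

/-- The weight space `{X | h X = α(h) X for all h ∈ t}`; the form `α` is a weight of `L` (with
respect to `t`) if this space is nonzero. -/
def weightSpace (t : LieSubalgebra ℂ (LieDerivation ℂ L L)) (α : Module.Dual ℂ t) :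
    Submodule ℂ L where
  carrier := {X | ∀ h : t, (h : LieDerivation ℂ L L) X = α h • X}
  add_mem' hX hY h := by rw [map_add, hX h, hY h, smul_add]
  zero_mem' h := by rw [map_zero, smul_zero]
  smul_mem' c X hX h := by rw [map_smul, hX h, smul_comm]

end Torus

/-- `L` has rank `r`: some maximal torus of derivations of `L` has dimension `r`. -/
def HasRank (L : Type*) [LieRing L] [LieAlgebra ℂ L] (r : ℕ) : Prop :=
  ∃ t : LieSubalgebra ℂ (LieDerivation ℂ L L), IsMaximalTorus t ∧ Module.finrank ℂ t = r

/-- The semidirect product `L ⊕ t` for a subalgebra `t` of `Der L`, with `[h, X] = h X`. -/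
abbrev TorusExtension {L : Type*} [LieRing L] [LieAlgebra ℂ L]
    (t : LieSubalgebra ℂ (LieDerivation ℂ L L)) : Type _ :=
  LieAlgebra.SemiDirectSum L t t.incl

/-- `L` is completable: `L ⊕ t` is complete for every maximal torus `t` of derivations. (Maximal
tori exist in finite dimension, and any two of them are conjugate under `Aut L`.) -/
def IsCompletable (L : Type*) [LieRing L] [LieAlgebra ℂ L] : Prop :=
  ∀ t : LieSubalgebra ℂ (LieDerivation ℂ L L), IsMaximalTorus t → IsCompleteLie (TorusExtension t)

/-! ### Characteristic sequence and filiform Lie algebras -/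

/-- `h = (h₁ ≥ h₂ ≥ … ≥ h_p)` is the sequence of sizes of the Jordan blocks of the nilpotent
endomorphism `T`: there is a basis made of chains `b_{i,0} ↦ b_{i,1} ↦ … ↦ b_{i,h_i - 1} ↦ 0`. -/
def IsJordanSequence {V : Type*} [AddCommGroup V] [Module ℂ V] (T : Module.End ℂ V)
    (h : List ℕ) : Prop :=
  h.Pairwise (fun a b => b ≤ a) ∧ (∀ a ∈ h, 0 < a) ∧
    ∃ b : Module.Basis ((i : Fin h.length) × Fin (h.get i)) ℂ V,
      ∀ (i : Fin h.length) (j : Fin (h.get i)),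
        T (b ⟨i, j⟩) = if hj : (j : ℕ) + 1 < h.get i then b ⟨i, ⟨j + 1, hj⟩⟩ else 0

/-- `s` is the characteristic sequence of `L`: the lexicographically largest of the sequences
`c(Y)` of Jordan block sizes of `ad Y`, for `Y ∈ L - [L, L]`. -/
def IsCharacteristicSequence (L : Type*) [LieRing L] [LieAlgebra ℂ L] (s : List ℕ) : Prop :=
  (∃ Y : L, Y ∉ ⁅(⊤ : LieIdeal ℂ L), (⊤ : LieIdeal ℂ L)⁆ ∧
    IsJordanSequence (LieAlgebra.ad ℂ L Y) s) ∧
  ∀ Y : L, Y ∉ ⁅(⊤ : LieIdeal ℂ L), (⊤ : LieIdeal ℂ L)⁆ →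
    ∀ s' : List ℕ, IsJordanSequence (LieAlgebra.ad ℂ L Y) s' →
      s' = s ∨ List.Lex (fun a b : ℕ => a < b) s' s

/-- A filiform Lie algebra: nilpotent, of finite dimension `n`, with characteristic sequence
`(n - 1, 1)`. -/
def IsFiliform (L : Type*) [LieRing L] [LieAlgebra ℂ L] : Prop :=
  FiniteDimensional ℂ L ∧ LieRing.IsNilpotent L ∧
    IsCharacteristicSequence L [Module.finrank ℂ L - 1, 1]

/-! ### Lie algebras given by structure constants -/

/-- The family `c i j l` is a system of structure constants of a Lie algebra with basis
`Y₁, …, Yₙ` and brackets `[Y_i, Y_j] = ∑ l, c i j l Y_l`: skew symmetry and the Jacobi identity. -/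
structure IsLieTable {n : ℕ} (c : Fin n → Fin n → Fin n → ℂ) : Prop where
  skew : ∀ i j l, c i j l = -c j i l
  jacobi : ∀ i j k l,
    ∑ s, c i j s * c s k l + ∑ s, c j k s * c s i l + ∑ s, c k i s * c s j l = 0

/-- The Lie algebra with underlying space `ℂⁿ` and structure constants `c`. -/
def TableAlgebra {n : ℕ} (c : Fin n → Fin n → Fin n → ℂ) (_ : IsLieTable c) : Type :=
  Fin n → ℂ

namespace TableAlgebra

variable {n : ℕ} {c : Fin n → Fin n → Fin n → ℂ} (hc : IsLieTable c)

instance : AddCommGroup (TableAlgebra c hc) := inferInstanceAs (AddCommGroup (Fin n → ℂ))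

instance : Module ℂ (TableAlgebra c hc) := inferInstanceAs (Module ℂ (Fin n → ℂ))

/-- The bilinear extension of `[Y_i, Y_j] = ∑ l, c i j l Y_l`. -/
instance : Bracket (TableAlgebra c hc) (TableAlgebra c hc) where
  bracket x y := fun l : Fin n => ∑ i, ∑ j, x i * y j * c i j l

theorem lie_apply (x y : TableAlgebra c hc) (l : Fin n) :
    ⁅x, y⁆ l = ∑ i, ∑ j, x i * y j * c i j l := rfl

theorem lie_lie_apply (x y z : TableAlgebra c hc) (l : Fin n) :
    ⁅⁅x, y⁆, z⁆ l = ∑ i, ∑ j, ∑ k, x i * y j * z k * ∑ s, c i j s * c s k l := by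
  simp only [lie_apply, Finset.sum_mul, Finset.mul_sum]
  calc
    _ = ∑ s, ∑ i, ∑ j, ∑ k, x i * y j * c i j s * z k * c s k l := by
      refine Finset.sum_congr rfl fun s _ => ?_
      rw [Finset.sum_comm]
      refine Finset.sum_congr rfl fun i _ => ?_
      rw [Finset.sum_comm]
    _ = _ := by
      rw [Finset.sum_comm]
      refine Finset.sum_congr rfl fun i _ => ?_
      rw [Finset.sum_comm]
      refine Finset.sum_congr rfl fun j _ => ?_
      rw [Finset.sum_comm]
      refine Finset.sum_congr rfl fun k _ => Finset.sum_congr rfl fun s _ => ?_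
      ring

theorem lie_skew_aux (x y : TableAlgebra c hc) : ⁅x, y⁆ = -⁅y, x⁆ := by
  funext l
  change ⁅x, y⁆ l = -(⁅y, x⁆ l)
  rw [lie_apply, lie_apply, Finset.sum_comm, ← Finset.sum_neg_distrib]
  refine Finset.sum_congr rfl fun i _ => ?_
  rw [← Finset.sum_neg_distrib]
  refine Finset.sum_congr rfl fun j _ => ?_
  rw [hc.skew j i l]
  ring

theorem jacobi_aux (x y z : TableAlgebra c hc) : ⁅⁅x, y⁆, z⁆ + ⁅⁅y, z⁆, x⁆ + ⁅⁅z, x⁆, y⁆ = 0 := by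
  funext l
  change ⁅⁅x, y⁆, z⁆ l + ⁅⁅y, z⁆, x⁆ l + ⁅⁅z, x⁆, y⁆ l = 0
  have e1 : ⁅⁅y, z⁆, x⁆ l = ∑ i, ∑ j, ∑ k, x i * y j * z k * ∑ s, c j k s * c s i l := by
    rw [lie_lie_apply]
    calc
      _ = ∑ j, ∑ i, ∑ k, x i * y j * z k * ∑ s, c j k s * c s i l := by
        refine Finset.sum_congr rfl fun j _ => ?_
        rw [Finset.sum_comm]
        refine Finset.sum_congr rfl fun i _ => Finset.sum_congr rfl fun k _ => ?_
        ring
      _ = _ := Finset.sum_comm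
  have e2 : ⁅⁅z, x⁆, y⁆ l = ∑ i, ∑ j, ∑ k, x i * y j * z k * ∑ s, c k i s * c s j l := by
    rw [lie_lie_apply, Finset.sum_comm]
    refine Finset.sum_congr rfl fun i _ => ?_
    rw [Finset.sum_comm]
    refine Finset.sum_congr rfl fun j _ => Finset.sum_congr rfl fun k _ => ?_
    ring
  rw [e1, e2, lie_lie_apply]
  simp only [← Finset.sum_add_distrib, ← mul_add]
  refine Finset.sum_eq_zero fun i _ => Finset.sum_eq_zero fun j _ => Finset.sum_eq_zero fun k _ => ?_
  rw [Finset.sum_add_distrib, Finset.sum_add_distrib, hc.jacobi, mul_zero]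

theorem add_lie_aux (x y z : TableAlgebra c hc) : ⁅x + y, z⁆ = ⁅x, z⁆ + ⁅y, z⁆ := by
  funext l
  change ⁅x + y, z⁆ l = ⁅x, z⁆ l + ⁅y, z⁆ l
  simp only [lie_apply, ← Finset.sum_add_distrib]
  refine Finset.sum_congr rfl fun i _ => Finset.sum_congr rfl fun j _ => ?_
  change (x i + y i) * z j * c i j l = _
  ring

theorem lie_smul_aux (a : ℂ) (x y : TableAlgebra c hc) : ⁅x, a • y⁆ = a • ⁅x, y⁆ := by
  funext l
  change ⁅x, a • y⁆ l = a * (⁅x, y⁆ l)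
  simp only [lie_apply, Finset.mul_sum]
  refine Finset.sum_congr rfl fun i _ => Finset.sum_congr rfl fun j _ => ?_
  change x i * (a * y j) * c i j l = _
  ring

theorem lie_add_aux (x y z : TableAlgebra c hc) : ⁅x, y + z⁆ = ⁅x, y⁆ + ⁅x, z⁆ := by
  rw [lie_skew_aux hc, add_lie_aux hc, lie_skew_aux hc x y, lie_skew_aux hc x z]
  abel

instance : LieRing (TableAlgebra c hc) where
  add_lie := add_lie_aux hc
  lie_add := lie_add_aux hc
  lie_self x := by
    funext l
    exact self_eq_neg.mp (congrFun (lie_skew_aux hc x x) l)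
  leibniz_lie x y z := by
    have h := jacobi_aux hc x y z
    rw [lie_skew_aux hc x ⁅y, z⁆, lie_skew_aux hc y ⁅x, z⁆, lie_skew_aux hc x z]
    have h2 : ⁅-⁅z, x⁆, y⁆ = -⁅⁅z, x⁆, y⁆ := by
      have := add_lie_aux hc (-⁅z, x⁆) ⁅z, x⁆ y
      rw [neg_add_cancel] at this
      have h0 : ⁅(0 : TableAlgebra c hc), y⁆ = 0 := by
        have := add_lie_aux hc 0 0 y
        rw [add_zero] at this
        exact left_eq_add.mp this
      rw [h0] at this
      exact eq_neg_of_add_eq_zero_left this.symm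
    rw [h2, neg_neg, neg_eq_iff_add_eq_zero, ← h]
    abel

instance : LieAlgebra ℂ (TableAlgebra c hc) where
  lie_smul := lie_smul_aux hc

/-- The basis vector `Y_j` of the algebra with structure constants `c`, for `1 ≤ j ≤ n`. -/
def vec (j : ℕ) : TableAlgebra c hc := fun i : Fin n => if (i : ℕ) + 1 = j then 1 else 0

end TableAlgebra

/-- From coefficients `u i j l` of `Y_l` in `[Y_i, Y_j]` for `1 ≤ i < j ≤ n` and `1 ≤ l ≤ n`
(indices starting at `1`), the skew-symmetric table of structure constants. Values `u i j l` with
`l > n` are not used. -/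
def skewTable (n : ℕ) (u : ℕ → ℕ → ℕ → ℂ) (i j l : Fin n) : ℂ :=
  if i < j then u (i + 1) (j + 1) (l + 1)
  else if j < i then -u (j + 1) (i + 1) (l + 1)
  else 0

/-! ### The families `A`, `B`, `C` -/

/-- `coeffAux lam d i` is the constant `a_{i,i+d}`, determined by `a_{i,i} = 0`,
`a_{i,i+1} = λ_{i-1}` and `a_{i,j} = a_{i,j+1} + a_{i+1,j}`. -/
def coeffAux (lam : ℕ → ℂ) : ℕ → ℕ → ℂ
  | 0, _ => 0
  | 1, i => lam (i - 1)
  | d + 2, i => coeffAux lam (d + 1) i - coeffAux lam d (i + 1)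

/-- The constant `a_{i,j}` for `2 ≤ i ≤ j`. -/
def coeff (lam : ℕ → ℂ) (i j : ℕ) : ℂ := coeffAux lam (j - i) i

/-- Brackets of `A_n^k(λ₁, …, λ_{t-1})`:
`[Y₁, Y_j] = Y_{j+1}` for `2 ≤ j ≤ n - 1`, and `[Y_i, Y_j] = a_{i,j} Y_{i+j+k-2}` for `2 ≤ i < j`,
`i + j + k - 2 ≤ n`. -/
def tableA (n k : ℕ) (lam : ℕ → ℂ) : Fin n → Fin n → Fin n → ℂ :=
  skewTable n fun i j l =>
    if i = 1 then (if l = j + 1 then 1 else 0)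
    else if l + 2 = i + j + k then coeff lam i j else 0

/-- Brackets of `B_n^k(λ₁, …, λ_{t-1})`:
`[Y₁, Y_j] = Y_{j+1}` for `2 ≤ j ≤ n - 2`, `[Y_i, Y_{n-i+1}] = (-1)^{i+1} Y_n` for
`2 ≤ i ≤ n - 1`, and `[Y_i, Y_j] = a_{i,j} Y_{i+j+k-2}` for `2 ≤ i < j`, `i + j + k - 2 ≤ n - 1`. -/
def tableB (n k : ℕ) (lam : ℕ → ℂ) : Fin n → Fin n → Fin n → ℂ :=
  skewTable n fun i j l =>
    if i = 1 then (if l = j + 1 ∧ l < n then 1 else 0)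
    else if i + j = n + 1 ∧ l = n then (-1) ^ (i + 1)
    else if l + 2 = i + j + k ∧ l < n then coeff lam i j else 0

/-- Brackets of `C_n(λ₁, …, λ_{m-1})`, `n = 2m + 2`:
`[Y₁, Y_j] = Y_{j+1}` for `2 ≤ j ≤ n - 2`, `[Y_i, Y_{n-i+1}] = (-1)^{i+1} Y_n` and
`[Y_i, Y_{n-i-2k+1}] = (-1)^{i+1} λ_k Y_n` for `1 ≤ k ≤ m - 1`. -/
def tableC (m : ℕ) (lam : ℕ → ℂ) :
    Fin (2 * m + 2) → Fin (2 * m + 2) → Fin (2 * m + 2) → ℂ :=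
  skewTable (2 * m + 2) fun i j l =>
    if i = 1 then (if l = j + 1 ∧ l < 2 * m + 2 then 1 else 0)
    else if l = 2 * m + 2 then
      (if i + j = 2 * m + 3 then (-1) ^ (i + 1) else 0) +
        ∑ k ∈ Finset.Icc 1 (m - 1),
          if i + j + 2 * k = 2 * m + 3 then (-1) ^ (i + 1) * lam k else 0
    else 0

/-- `L` is isomorphic to some `A_n^k(λ₁, …, λ_{t-1})`, where `2 ≤ k ≤ n - 3`,
`t = ⌊(n - k + 1) / 2⌋`, and the parameters `λ` do not all vanish and satisfy the Jacobi
conditions. -/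
def IsIsoToA (L : Type*) [LieRing L] [LieAlgebra ℂ L] : Prop :=
  ∃ (n k : ℕ) (lam : ℕ → ℂ) (h : IsLieTable (tableA n k lam)),
    2 ≤ k ∧ k + 3 ≤ n ∧ (∃ s, 1 ≤ s ∧ s + 1 ≤ (n - k + 1) / 2 ∧ lam s ≠ 0) ∧
    Nonempty (L ≃ₗ⁅ℂ⁆ TableAlgebra (tableA n k lam) h)

/-- `L` is isomorphic to some `B_n^k(λ₁, …, λ_{t-1})`, where `n` is even, `2 ≤ k ≤ n - 3`,
`t = ⌊(n - k) / 2⌋`, and the parameters `λ` do not all vanish and satisfy the Jacobi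
conditions. -/
def IsIsoToB (L : Type*) [LieRing L] [LieAlgebra ℂ L] : Prop :=
  ∃ (n k : ℕ) (lam : ℕ → ℂ) (h : IsLieTable (tableB n k lam)),
    Even n ∧ 2 ≤ k ∧ k + 3 ≤ n ∧ (∃ s, 1 ≤ s ∧ s + 1 ≤ (n - k) / 2 ∧ lam s ≠ 0) ∧
    Nonempty (L ≃ₗ⁅ℂ⁆ TableAlgebra (tableB n k lam) h)

/-! ### The Jacobi identity for the family `C` -/

theorem skewTable_skew {n : ℕ} (u : ℕ → ℕ → ℕ → ℂ) (i j l : Fin n) :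
    skewTable n u i j l = -skewTable n u j i l := by
  unfold skewTable
  rcases lt_trichotomy i j with h | h | h
  · simp [h, h.not_gt]
  · simp [h]
  · simp [h, h.not_gt]

/-- The coefficient of `Y_n` in `[Y_i, Y_j]`, `i, j ≥ 2`, in the algebra `C_n(λ)`. -/
def formC (m : ℕ) (lam : ℕ → ℂ) (i j : ℕ) : ℂ :=
  (if i + j = 2 * m + 3 then (-1) ^ (i + 1) else 0) +
    ∑ k ∈ Finset.Icc 1 (m - 1), if i + j + 2 * k = 2 * m + 3 then (-1) ^ (i + 1) * lam k else 0

theorem formC_shift (m : ℕ) (lam : ℕ → ℂ) (i j : ℕ) :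
    formC m lam (i + 1) j = -formC m lam i (j + 1) := by
  unfold formC
  rw [neg_add, ← Finset.sum_neg_distrib]
  congr 1
  · rw [show i + 1 + j = i + (j + 1) by ring]
    split_ifs
    · ring
    · simp
  · refine Finset.sum_congr rfl fun k _ => ?_
    rw [show i + 1 + j = i + (j + 1) by ring]
    split_ifs
    · ring
    · simp

theorem formC_skew (m : ℕ) (lam : ℕ → ℂ) (i j : ℕ) : formC m lam i j = -formC m lam j i := by
  have key : ∀ s : ℕ, i + j + 2 * s = 2 * m + 3 → ((-1 : ℂ)) ^ (i + 1) = -(-1) ^ (j + 1) := by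
    intro s hs
    rcases Nat.even_or_odd i with hi | hi
    · have hj : Odd j := by rcases hi with ⟨a, rfl⟩; exact ⟨m + 1 - a - s, by omega⟩
      rw [hi.add_one.neg_one_pow, hj.add_one.neg_one_pow]
    · have hj : Even j := by rcases hi with ⟨a, rfl⟩; exact ⟨m + 1 - a - s, by omega⟩
      rw [hi.add_one.neg_one_pow, hj.add_one.neg_one_pow, neg_neg]
  unfold formC
  rw [neg_add, ← Finset.sum_neg_distrib, add_comm j i]
  congr 1
  · split_ifs with h
    · exact key 0 (by omega)
    · simp
  · refine Finset.sum_congr rfl fun k _ => ?_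
    split_ifs with h
    · rw [key k h]; ring
    · simp

theorem formC_eq_zero (m : ℕ) (lam : ℕ → ℂ) (i j : ℕ) (h : 2 * m + 3 < i + j) :
    formC m lam i j = 0 := by
  unfold formC
  rw [if_neg (by omega), zero_add]
  exact Finset.sum_eq_zero fun k _ => if_neg (by omega)

theorem tableC_zero_left (m : ℕ) (lam : ℕ → ℂ) (i j l : Fin (2 * m + 2)) (hi : (i : ℕ) = 0)
    (hj : (j : ℕ) ≠ 0) :
    tableC m lam i j l = if (l : ℕ) = j + 1 ∧ (l : ℕ) < 2 * m + 1 then 1 else 0 := by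
  have hij : i < j := Fin.lt_def.mpr (by omega)
  simp only [tableC, skewTable, if_pos hij, hi]
  simp

theorem tableC_of_ne (m : ℕ) (lam : ℕ → ℂ) (i j l : Fin (2 * m + 2)) (hi : (i : ℕ) ≠ 0)
    (hj : (j : ℕ) ≠ 0) :
    tableC m lam i j l =
      if (l : ℕ) = 2 * m + 1 then formC m lam (i + 1) (j + 1) else 0 := by
  have hl : (l : ℕ) + 1 = 2 * m + 2 ↔ (l : ℕ) = 2 * m + 1 := by omega
  simp only [tableC, skewTable, Nat.add_eq_right, hi, hj, if_false, hl]
  rcases lt_trichotomy i j with h | h | h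
  · rw [if_pos h]; rfl
  · subst h
    have h0 := self_eq_neg.mp (formC_skew m lam (i + 1) (i + 1))
    simp [h0]
  · rw [if_neg h.not_gt, if_pos h, formC_skew m lam (i + 1) (j + 1)]
    by_cases hs : (l : ℕ) = 2 * m + 1
    · rw [if_pos hs, if_pos hs]; rfl
    · rw [if_neg hs, if_neg hs, neg_zero]

theorem isLieTable_tableC (m : ℕ) (lam : ℕ → ℂ) : IsLieTable (tableC m lam) := by
  have skew : ∀ i j l, tableC m lam i j l = -tableC m lam j i l := skewTable_skew _
  have hself : ∀ i l, tableC m lam i i l = 0 := fun i l => self_eq_neg.mp (skew i i l)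
  -- `[[Y_i, Y_j], Y_k] = 0` for `i, j ≥ 2`
  have h1 : ∀ i j k l : Fin (2 * m + 2), (i : ℕ) ≠ 0 → (j : ℕ) ≠ 0 →
      ∑ s, tableC m lam i j s * tableC m lam s k l = 0 := by
    intro i j k l hi hj
    refine Finset.sum_eq_zero fun s _ => ?_
    rw [tableC_of_ne m lam i j s hi hj]
    split_ifs with hs
    · have : tableC m lam s k l = 0 := by
        by_cases hk : (k : ℕ) = 0
        · rw [skew, tableC_zero_left m lam k s l hk (by omega), if_neg (by omega), neg_zero]
        · rw [tableC_of_ne m lam s k l (by omega) hk, formC_eq_zero _ _ _ _ (by omega)]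
          simp
      rw [this, mul_zero]
    · rw [zero_mul]
  -- `[[Y_1, Y_j], Y_k]` for `j, k ≥ 2`
  have h2 : ∀ i j k l : Fin (2 * m + 2), (i : ℕ) = 0 → (j : ℕ) ≠ 0 → (k : ℕ) ≠ 0 →
      ∑ s, tableC m lam i j s * tableC m lam s k l =
        if (l : ℕ) = 2 * m + 1 then formC m lam (j + 2) (k + 1) else 0 := by
    intro i j k l hi hj hk
    by_cases hj2 : (j : ℕ) + 1 < 2 * m + 1
    · rw [Finset.sum_eq_single (⟨j + 1, by omega⟩ : Fin (2 * m + 2))]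
      · rw [tableC_zero_left m lam i j _ hi hj, if_pos ⟨rfl, hj2⟩, one_mul,
          tableC_of_ne m lam _ k l (by simp) hk]
      · intro s _ hs
        rw [tableC_zero_left m lam i j _ hi hj, if_neg, zero_mul]
        rintro ⟨h, -⟩
        exact hs (Fin.ext h)
      · simp
    · rw [formC_eq_zero _ _ _ _ (by omega), ite_self]
      refine Finset.sum_eq_zero fun s _ => ?_
      rw [tableC_zero_left m lam i j _ hi hj, if_neg (by omega), zero_mul]
  have hneg : ∀ i j k l, ∑ s, tableC m lam i j s * tableC m lam s k l =
      -∑ s, tableC m lam j i s * tableC m lam s k l := by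
    intro i j k l
    rw [← Finset.sum_neg_distrib]
    exact Finset.sum_congr rfl fun s _ => by rw [skew i j s, neg_mul]
  have hii : ∀ i k l, ∑ s, tableC m lam i i s * tableC m lam s k l = 0 := fun i k l =>
    Finset.sum_eq_zero fun s _ => by rw [hself, zero_mul]
  -- one index equal to `1`
  have h3 : ∀ i j k l : Fin (2 * m + 2), (i : ℕ) = 0 →
      ∑ s, tableC m lam i j s * tableC m lam s k l + ∑ s, tableC m lam j k s * tableC m lam s i l +
        ∑ s, tableC m lam k i s * tableC m lam s j l = 0 := by
    intro i j k l hi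
    by_cases hj : (j : ℕ) = 0
    · obtain rfl : i = j := Fin.ext (hi.trans hj.symm)
      rw [hii, hneg k i i l]; ring
    by_cases hk : (k : ℕ) = 0
    · obtain rfl : i = k := Fin.ext (hi.trans hk.symm)
      rw [hii, hneg j i i l]; ring
    rw [h1 j k i l hj hk, hneg k i j l, h2 i j k l hi hj hk, h2 i k j l hi hk hj]
    split_ifs
    · rw [formC_shift m lam (j + 1) (k + 1), formC_skew m lam (j + 1) (k + 1 + 1)]
      ring
    · simp
  refine ⟨skew, fun i j k l => ?_⟩
  by_cases hi : (i : ℕ) = 0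
  · exact h3 i j k l hi
  by_cases hj : (j : ℕ) = 0
  · rw [← h3 j k i l hj]; ring
  by_cases hk : (k : ℕ) = 0
  · rw [← h3 k i j l hk]; ring
  rw [h1 i j k l hi hj, h1 j k i l hj hk, h1 k i j l hk hi]; ring

/-- The Lie algebra `C_n(λ₁, …, λ_{m-1})`, `n = 2m + 2`. -/
abbrev AlgebraC (m : ℕ) (lam : ℕ → ℂ) : Type :=
  TableAlgebra (tableC m lam) (isLieTable_tableC m lam)

/-- The basis vector `Y_j` of `C_n(λ)`, `1 ≤ j ≤ n = 2m + 2`. -/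
abbrev vecC (m : ℕ) (lam : ℕ → ℂ) (j : ℕ) : AlgebraC m lam :=
  TableAlgebra.vec (isLieTable_tableC m lam) j

end FiliformLie

end

noncomputable section

namespace FiliformLie

open Module

/-! ### Coordinates and flags with respect to an ordered basis -/

section Coordinates

variable {V : Type*} [AddCommGroup V] [Module ℂ V] {n : ℕ} (b : Basis (Fin n) ℂ V)

/-! A rank-one torus is a line, so the argument compares the weights of a single semisimple
derivation `D` with the brackets of a well-chosen basis.

A filiform algebra has a basis in which Y_2, …, Y_n is a chain for ad Y_1. Nilpotency identifies its
flag, from the third term on, with the lower central series (`IsChainBasis.isCentralFlag`). After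
subtracting a multiple of Y_1 from Y_2, Vergne's argument (`graded_constants_eq_zero`,
`lie_mem_flag_add`) shows that [Y_i, Y_j] starts at Y_{i+j} or later for i, j ≥ 2 and i + j ≤ n. The
only possible exception to this bound is a Y_n component when i + j = n + 1, and that requires n
even. A semisimple `D` preserves the flag, so Y_1 and Y_2 can be corrected to eigenvectors of
weights α and β and the chain regenerated from them. This gives `IsFiliform.exists_isEigenFiliform`:
Y_i has weight β + (i-2)α along the chain. In the exceptional case the chain stops at N = n - 1, and
Y_n = -[Y_2, Y_N] has weight 2β + (N-2)α.

Weights add along brackets. If some [Y_i, Y_j] with i, j ≥ 2 has a component on a chain vector Y_l,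
then β = kα with k = l - i - j + 2 ≥ 2. As α ≠ 0, the weights now prescribe the index of every other
chain component, and Jacobi with Y_1 gives the recursion for the a_{i,j}. The algebra is then in `A`
(N = n) or `B` (N = n - 1). If no such component exists, there are two cases. Either α and β can be
varied independently, which contradicts rank one, or N < n and α = 0. In the second case the algebra
has the shape of `C`: Y_2 and Y_{n-1} have equal weights, so the outer derivation Y_2 ↦ Y_{n-1}
commutes with the torus and obstructs completeness. The same obstruction proves the statement about
C_n(λ).

Conversely, in `A` and `B` all derivations are triangular, and their diagonal entries add along
leading brackets (`diagonal_add`). A nonzero parameter forces the second entry to be k times the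
first, so the diagonal is a multiple of a list of distinct positive integers. A nonzero element of a
maximal torus is not nilpotent, hence it has simple spectrum without zero.
`IsMaximalTorus.isCompleteLie` then corrects any derivation of the semidirect product by inner ones
until nothing is left. This handles every maximal torus directly, without conjugacy of tori. -/

/-- The `j`-th vector of the basis `b`, counted from `1`, and `0` for `j` out of range. -/
def bvec (j : ℕ) : V := if h : 1 ≤ j ∧ j ≤ n then b ⟨j - 1, by omega⟩ else 0

/-- The `j`-th coordinate with respect to `b`, counted from `1`, and `0` for `j` out of range. -/
def bco (j : ℕ) : V →ₗ[ℂ] ℂ := if h : 1 ≤ j ∧ j ≤ n then b.coord ⟨j - 1, by omega⟩ else 0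

/-- The space of vectors whose coordinates of index less than `i` vanish. -/
def flag (i : ℕ) : Submodule ℂ V where
  carrier := {x | ∀ j < i, bco b j x = 0}
  add_mem' hx hy j hj := by rw [map_add, hx j hj, hy j hj, add_zero]
  zero_mem' j _ := map_zero _
  smul_mem' c x hx j hj := by rw [map_smul, hx j hj, smul_zero]

theorem bvec_fin (i : Fin n) : bvec b (i + 1) = b i := by
  have := i.isLt
  rw [bvec, dif_pos (by omega)]
  rfl

theorem bco_fin (i : Fin n) : bco b (i + 1) = b.coord i := by
  have := i.isLt
  rw [bco, dif_pos (by omega)]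
  rfl

theorem bvec_of_lt {j : ℕ} (h : n < j) : bvec b j = 0 := dif_neg (by omega)

theorem bco_of_lt {j : ℕ} (h : n < j) : bco b j = 0 := dif_neg (by omega)

theorem bco_zero : bco b 0 = 0 := dif_neg (by omega)

theorem bco_bvec_self {j : ℕ} (h1 : 1 ≤ j) (h2 : j ≤ n) : bco b j (bvec b j) = 1 := by
  rw [bco, bvec, dif_pos ⟨h1, h2⟩, dif_pos ⟨h1, h2⟩]
  simp

theorem bco_bvec_of_ne {i j : ℕ} (h : i ≠ j) : bco b i (bvec b j) = 0 := by
  unfold bco bvec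
  split_ifs with h1 h2
  · rw [Basis.coord_apply, Basis.repr_self, Finsupp.single_eq_of_ne]
    simp only [ne_eq, Fin.mk.injEq]
    omega
  · simp
  · rfl
  · rfl

theorem bvec_ne_zero {j : ℕ} (h1 : 1 ≤ j) (h2 : j ≤ n) : bvec b j ≠ 0 := fun h => by
  have := bco_bvec_self b h1 h2
  rw [h, map_zero] at this
  exact zero_ne_one this

theorem bco_ext {x y : V} (h : ∀ j, 1 ≤ j → j ≤ n → bco b j x = bco b j y) : x = y := by
  refine b.ext_elem fun i => ?_
  have := h (i + 1) (by omega) (by have := i.isLt; omega)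
  rwa [bco_fin] at this

theorem bvec_mem_flag {i j : ℕ} (h : i ≤ j) : bvec b j ∈ flag b i :=
  fun l hl => bco_bvec_of_ne b (by omega)

theorem flag_anti {i j : ℕ} (h : i ≤ j) : flag b j ≤ flag b i :=
  fun _ hx l hl => hx l (by omega)

theorem mem_flag_one (x : V) : x ∈ flag b 1 := fun j hj => by
  obtain rfl : j = 0 := by omega
  rw [bco_zero]; rfl

theorem eq_zero_of_mem_flag {i : ℕ} (hi : n < i) {x : V} (hx : x ∈ flag b i) : x = 0 :=
  bco_ext b fun j _ hj => by rw [hx j (by omega), map_zero]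

theorem bvec_notMem_flag {i j : ℕ} (h1 : 1 ≤ j) (h2 : j ≤ n) (h : j < i) : bvec b j ∉ flag b i :=
  fun hj => by
    have := hj j h
    rw [bco_bvec_self b h1 h2] at this
    exact one_ne_zero this

theorem sub_mem_flag {i : ℕ} {x : V} (hx : x ∈ flag b i) :
    x - bco b i x • bvec b i ∈ flag b (i + 1) := fun j hj => by
  rw [map_sub, map_smul]
  rcases Nat.lt_succ_iff_lt_or_eq.mp hj with h | rfl
  · rw [hx j h, bco_bvec_of_ne b h.ne, smul_zero, sub_zero]
  · by_cases hr : 1 ≤ j ∧ j ≤ n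
    · rw [bco_bvec_self b hr.1 hr.2, smul_eq_mul, mul_one, sub_self]
    · rw [bco, dif_neg hr]; simp

theorem mem_flag_succ {i : ℕ} {x : V} (hx : x ∈ flag b i) (h : bco b i x = 0) :
    x ∈ flag b (i + 1) := by
  have := sub_mem_flag b hx
  rwa [h, zero_smul, sub_zero] at this

/-- Peel off leading coordinates one at a time. The induction descends along the flag, with `d`
bounding n + 1 - i. -/
theorem flag_le {i : ℕ} {P : Submodule ℂ V} (h : ∀ j, i ≤ j → 1 ≤ j → j ≤ n → bvec b j ∈ P) :
    flag b i ≤ P := by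
  have key : ∀ d i, n + 1 ≤ i + d → (∀ j, i ≤ j → 1 ≤ j → j ≤ n → bvec b j ∈ P) →
      flag b i ≤ P := by
    intro d
    induction d with
    | zero =>
      intro i hi _ x hx
      rw [eq_zero_of_mem_flag b (by omega) hx]
      exact P.zero_mem
    | succ d ih =>
      intro i hi h x hx
      have h1 := ih (i + 1) (by omega) (fun j hj => h j (by omega)) (sub_mem_flag b hx)
      have h2 : bco b i x • bvec b i ∈ P := by
        by_cases hr : 1 ≤ i ∧ i ≤ n
        · exact P.smul_mem _ (h i le_rfl hr.1 hr.2)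
        · rw [bco, dif_neg hr]; simp
      simpa using P.add_mem h1 h2
  exact key (n + 1) i (by omega) h

theorem eq_top_of_bvec_mem {P : Submodule ℂ V} (h : ∀ j, 1 ≤ j → j ≤ n → bvec b j ∈ P) (x : V) :
    x ∈ P :=
  flag_le b (i := 1) (fun j _ => h j) (mem_flag_one b x)

theorem eq_smul_bvec_last {x : V} (hx : x ∈ flag b n) : x = bco b n x • bvec b n := by
  rw [← sub_eq_zero]
  exact eq_zero_of_mem_flag b (Nat.lt_succ_self n) (sub_mem_flag b hx)

theorem linearMap_ext_bvec {W : Type*} [AddCommGroup W] [Module ℂ W] {f g : V →ₗ[ℂ] W}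
    (h : ∀ j, 1 ≤ j → j ≤ n → f (bvec b j) = g (bvec b j)) : f = g := by
  refine b.ext fun i => ?_
  rw [← bvec_fin]
  exact h _ (by omega) (by have := i.isLt; omega)

theorem exists_linearMap_bvec {W : Type*} [AddCommGroup W] [Module ℂ W] (w : ℕ → W) :
    ∃ f : V →ₗ[ℂ] W, ∀ j, 1 ≤ j → j ≤ n → f (bvec b j) = w j := by
  refine ⟨b.constr ℂ fun i : Fin n => w (i + 1), fun j h1 h2 => ?_⟩
  obtain ⟨j, rfl⟩ := Nat.exists_eq_add_of_le' h1
  rw [bvec_fin b ⟨j, by omega⟩, Basis.constr_basis]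

/-- A family which is triangular with respect to `b` is a basis with the same flag. -/
theorem exists_basis_of_triangular (X : ℕ → V) (hX : ∀ i, 1 ≤ i → i ≤ n → X i ∈ flag b i)
    (h0 : ∀ i, 1 ≤ i → i ≤ n → bco b i (X i) ≠ 0) :
    ∃ b' : Basis (Fin n) ℂ V, (∀ i, 1 ≤ i → i ≤ n → bvec b' i = X i) ∧
      ∀ i, flag b' i = flag b i := by
  -- The tail of `X` from index `i` on spans the `i`-th term of the flag: modulo the next term, `X
  -- i` is a nonzero multiple of the basis vector.
  have key : ∀ d i, n + 1 ≤ i + d → ∀ P : Submodule ℂ V,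
      (∀ j, i ≤ j → 1 ≤ j → j ≤ n → X j ∈ P) → flag b i ≤ P := by
    intro d
    induction d with
    | zero =>
      intro i hi P _ x hx
      rw [eq_zero_of_mem_flag b (by omega) hx]
      exact P.zero_mem
    | succ d ih =>
      intro i hi P h
      refine flag_le b fun j hj h1 h2 => ?_
      rcases hj.eq_or_lt with rfl | hj
      · have h3 := ih (i + 1) (by omega) P (fun j hj => h j (by omega))
          (sub_mem_flag b (hX i h1 h2))
        have h4 := P.sub_mem (h i le_rfl h1 h2) h3
        rw [sub_sub_cancel] at h4
        exact (P.smul_mem_iff (h0 i h1 h2)).mp h4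
      · exact ih (i + 1) (by omega) P (fun j hj => h j (by omega)) (bvec_mem_flag b hj)
  have hspan : ⊤ ≤ Submodule.span ℂ (Set.range fun i : Fin n => X (i + 1)) := by
    intro x _
    refine key (n + 1) 1 (by omega) _ (fun j _ h1 h2 => ?_) (mem_flag_one b x)
    exact Submodule.subset_span ⟨⟨j - 1, by omega⟩, by simp [Nat.sub_add_cancel h1]⟩
  have hcard : Fintype.card (Fin n) = finrank ℂ V := by
    rw [finrank_eq_card_basis b]
  let b' := basisOfTopLeSpanOfCardEqFinrank _ hspan hcard
  have hb' : ∀ i, 1 ≤ i → i ≤ n → bvec b' i = X i := by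
    intro i h1 h2
    obtain ⟨i, rfl⟩ := Nat.exists_eq_add_of_le' h1
    rw [bvec_fin b' ⟨i, by omega⟩, coe_basisOfTopLeSpanOfCardEqFinrank]
  refine ⟨b', hb', fun i => le_antisymm (flag_le b' fun j hj h1 h2 => ?_) ?_⟩
  · rw [hb' j h1 h2]
    exact flag_anti b hj (hX j h1 h2)
  · exact key (n + 1) i (by omega) _ fun j hj h1 h2 => hb' j h1 h2 ▸ bvec_mem_flag b' hj

end Coordinates

/-! ### Lie algebras with an ordered basis -/

section LieBasis

variable {L : Type*} [LieRing L] [LieAlgebra ℂ L] {n : ℕ} (b : Basis (Fin n) ℂ L)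

theorem lie_mem_of_flag {i : ℕ} {x : L} {P : Submodule ℂ L}
    (h : ∀ j, i ≤ j → 1 ≤ j → j ≤ n → ⁅x, bvec b j⁆ ∈ P) {y : L} (hy : y ∈ flag b i) :
    ⁅x, y⁆ ∈ P := by
  have : flag b i ≤ P.comap (LieAlgebra.ad ℂ L x : L →ₗ[ℂ] L) := flag_le b h
  exact this hy

theorem lie_mem_comm {P : Submodule ℂ L} {x y : L} (h : ⁅x, y⁆ ∈ P) : ⁅y, x⁆ ∈ P := by
  rw [← lie_skew]; exact P.neg_mem h

/-- If the brackets of basis vectors of indices at least `i` and at least `j` lie in `P`, so do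
the brackets of the corresponding members of the flag. -/
theorem lie_mem_of_flag_flag {i j : ℕ} {P : Submodule ℂ L}
    (h : ∀ p q, i ≤ p → 1 ≤ p → p ≤ n → j ≤ q → 1 ≤ q → q ≤ n → ⁅bvec b p, bvec b q⁆ ∈ P)
    {x y : L} (hx : x ∈ flag b i) (hy : y ∈ flag b j) : ⁅x, y⁆ ∈ P := by
  refine lie_mem_of_flag b (fun q h1 h2 h3 => lie_mem_comm ?_) hy
  refine lie_mem_of_flag b (fun p h4 h5 h6 => lie_mem_comm ?_) hx
  exact h p q h4 h5 h6 h1 h2 h3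

/-- A linear map satisfying the Leibniz rule on a basis is a derivation. -/
theorem exists_derivation_of_basis (f : L →ₗ[ℂ] L)
    (h : ∀ i j, 1 ≤ i → i < j → j ≤ n → f ⁅bvec b i, bvec b j⁆ =
      ⁅f (bvec b i), bvec b j⁆ + ⁅bvec b i, f (bvec b j)⁆) :
    ∃ D : LieDerivation ℂ L L, ∀ x, D x = f x := by
  have symm : ∀ x y : L, f ⁅x, y⁆ = ⁅f x, y⁆ + ⁅x, f y⁆ → f ⁅y, x⁆ = ⁅f y, x⁆ + ⁅y, f x⁆ := by
    intro x y hxy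
    rw [← lie_skew, map_neg, hxy, neg_add, lie_skew, lie_skew, add_comm]
  have ext : ∀ x : L, (∀ j, 1 ≤ j → j ≤ n → f ⁅x, bvec b j⁆ =
      ⁅f x, bvec b j⁆ + ⁅x, f (bvec b j)⁆) → ∀ y, f ⁅x, y⁆ = ⁅f x, y⁆ + ⁅x, f y⁆ := by
    intro x hx y
    have : f ∘ₗ (LieAlgebra.ad ℂ L x : L →ₗ[ℂ] L) =
        (LieAlgebra.ad ℂ L (f x) : L →ₗ[ℂ] L) + (LieAlgebra.ad ℂ L x : L →ₗ[ℂ] L) ∘ₗ f :=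
      linearMap_ext_bvec b hx
    exact LinearMap.congr_fun this y
  -- Linearity in the second argument is used twice, with the two arguments exchanged in between by
  -- `symm`.
  have key : ∀ x y : L, f ⁅x, y⁆ = ⁅f x, y⁆ + ⁅x, f y⁆ := by
    refine fun x => ext x fun j hj1 hj2 => symm _ _ (ext _ (fun i hi1 hi2 => ?_) x)
    rcases lt_trichotomy j i with hij | rfl | hij
    · exact h j i hj1 hij hi2
    · rw [lie_self, map_zero, ← lie_skew, neg_add_cancel]
    · exact symm _ _ (h i j hi1 hij hj2)
  refine ⟨⟨f, fun x y => ?_⟩, fun x => rfl⟩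
  rw [key, ← lie_skew y, sub_neg_eq_add, add_comm]

/-- A diagonal map whose weights are compatible with the brackets of basis vectors is a
derivation. -/
theorem exists_diagonal_derivation (u : ℕ → ℂ)
    (h : ∀ i j l, 1 ≤ i → i < j → j ≤ n → 1 ≤ l → l ≤ n → bco b l ⁅bvec b i, bvec b j⁆ ≠ 0 →
      u l = u i + u j) :
    ∃ D : LieDerivation ℂ L L, ∀ i, 1 ≤ i → i ≤ n → D (bvec b i) = u i • bvec b i := by
  obtain ⟨f, hf⟩ := exists_linearMap_bvec b fun i => u i • bvec b i
  have hco : ∀ l x, 1 ≤ l → l ≤ n → bco b l (f x) = u l * bco b l x := by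
    intro l x h1 h2
    have : bco b l ∘ₗ f = u l • bco b l := by
      refine linearMap_ext_bvec b fun j h3 h4 => ?_
      rw [LinearMap.comp_apply, hf j h3 h4, LinearMap.smul_apply, map_smul]
      rcases eq_or_ne l j with rfl | hlj
      · rfl
      · rw [bco_bvec_of_ne b hlj, smul_zero, smul_zero]
    exact LinearMap.congr_fun this x
  obtain ⟨D, hD⟩ := exists_derivation_of_basis b f fun i j h1 h2 h3 => by
    refine bco_ext b fun l h4 h5 => ?_
    rw [hf i h1 (by omega), hf j (by omega) h3, smul_lie, lie_smul, ← add_smul, map_smul,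
      hco l _ h4 h5, smul_eq_mul]
    by_cases h0 : bco b l ⁅bvec b i, bvec b j⁆ = 0
    · rw [h0, mul_zero, mul_zero]
    · rw [h i j l h1 h2 h3 h4 h5 h0]
  exact ⟨D, fun i h1 h2 => by rw [hD, hf i h1 h2]⟩

/-- The structure constants of a Lie algebra with respect to a basis form a Lie table, and the
algebra is isomorphic to the algebra given by that table. -/
theorem exists_equiv_tableAlgebra (c : Fin n → Fin n → Fin n → ℂ)
    (h : ∀ i j l, b.repr ⁅b i, b j⁆ l = c i j l) :
    ∃ hc : IsLieTable c, Nonempty (L ≃ₗ⁅ℂ⁆ TableAlgebra c hc) := by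
  have hb : ∀ i j, ⁅b i, b j⁆ = ∑ l, c i j l • b l := fun i j => by
    rw [← b.sum_repr ⁅b i, b j⁆]
    simp only [h]
  have hlie : ∀ x y l, b.repr ⁅x, y⁆ l = ∑ i, ∑ j, b.repr x i * b.repr y j * c i j l := by
    intro x y l
    conv_lhs => rw [← b.sum_repr x, ← b.sum_repr y]
    simp only [sum_lie, lie_sum, smul_lie, lie_smul, map_sum, map_smul,
      Finsupp.coe_finsetSum, Finset.sum_apply, Finsupp.coe_smul, Pi.smul_apply, smul_eq_mul, h]
    simp only [Finset.mul_sum]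
    rw [Finset.sum_comm]
    exact Finset.sum_congr rfl fun i _ => Finset.sum_congr rfl fun j _ => by ring
  have hll : ∀ i j k l, b.repr ⁅⁅b i, b j⁆, b k⁆ l = ∑ s, c i j s * c s k l := by
    intro i j k l
    rw [hb i j]
    simp only [sum_lie, smul_lie, map_sum, map_smul, Finsupp.coe_finsetSum,
      Finset.sum_apply, Finsupp.coe_smul, Pi.smul_apply, smul_eq_mul, h]
  have hc : IsLieTable c := by
    refine ⟨fun i j l => ?_, fun i j k l => ?_⟩
    · rw [← h, ← h, ← lie_skew, map_neg]; rfl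
    · rw [← hll, ← hll, ← hll, ← Finsupp.add_apply, ← Finsupp.add_apply, ← map_add, ← map_add]
      have : ⁅⁅b i, b j⁆, b k⁆ + ⁅⁅b j, b k⁆, b i⁆ + ⁅⁅b k, b i⁆, b j⁆ = 0 := by
        rw [← lie_skew, ← lie_skew ⁅b j, b k⁆, ← lie_skew ⁅b k, b i⁆, ← neg_add, ← neg_add,
          neg_eq_zero, ← lie_jacobi (b k) (b i) (b j)]
      rw [this, map_zero]; rfl
  refine ⟨hc, ⟨{ (b.equivFun : L ≃ₗ[ℂ] (Fin n → ℂ)) with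
    toFun := fun x => (b.equivFun x : Fin n → ℂ)
    invFun := fun x => b.equivFun.symm x
    map_lie' := ?_ }⟩⟩
  intro x y
  funext l
  exact hlie x y l

theorem exists_equiv_skewTable (u : ℕ → ℕ → ℕ → ℂ)
    (h : ∀ i j l, 1 ≤ i → i < j → j ≤ n → 1 ≤ l → l ≤ n →
      bco b l ⁅bvec b i, bvec b j⁆ = u i j l) :
    ∃ hc : IsLieTable (skewTable n u), Nonempty (L ≃ₗ⁅ℂ⁆ TableAlgebra (skewTable n u) hc) := by
  refine exists_equiv_tableAlgebra b _ fun i j l => ?_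
  have hi := i.isLt
  have hj := j.isLt
  have hl := l.isLt
  have e : ∀ i j l : Fin n, i < j → b.repr ⁅b i, b j⁆ l = u (i + 1) (j + 1) (l + 1) := by
    intro i j l hij
    have hij' := Fin.lt_def.mp hij
    have hj := j.isLt
    have hl := l.isLt
    rw [← h (i + 1) (j + 1) (l + 1) (by omega) (by omega) (by omega) (by omega) (by omega),
      bvec_fin, bvec_fin, bco_fin]
    rfl
  unfold skewTable
  split_ifs with h1 h2
  · exact e i j l h1
  · rw [← lie_skew, map_neg, Finsupp.neg_apply, e j i l h2]
  · obtain rfl : i = j := le_antisymm (not_lt.mp h2) (not_lt.mp h1)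
    rw [lie_self, map_zero]; rfl

/-- The coordinates on the algebra given by a table. -/
def tableEquiv {c : Fin n → Fin n → Fin n → ℂ} (hc : IsLieTable c) :
    TableAlgebra c hc ≃ₗ[ℂ] (Fin n → ℂ) where
  toFun x := x
  invFun x := x
  map_add' _ _ := rfl
  map_smul' _ _ := rfl

/-- The standard basis of the algebra given by a table. -/
def tableBasis {c : Fin n → Fin n → Fin n → ℂ} (hc : IsLieTable c) :
    Basis (Fin n) ℂ (TableAlgebra c hc) :=
  Basis.ofEquivFun (tableEquiv hc)

theorem tableBasis_apply {c : Fin n → Fin n → Fin n → ℂ} (hc : IsLieTable c) (i : Fin n) :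
    tableBasis hc i = (Pi.single i 1 : Fin n → ℂ) := by
  unfold tableBasis
  rw [Basis.coe_ofEquivFun]
  rfl

theorem tableBasis_repr {c : Fin n → Fin n → Fin n → ℂ} (hc : IsLieTable c) (i : Fin n)
    (x : TableAlgebra c hc) : (tableBasis hc).repr x i = x i := rfl

theorem repr_lie_tableBasis {c : Fin n → Fin n → Fin n → ℂ} (hc : IsLieTable c) (i j l : Fin n) :
    (tableBasis hc).repr ⁅tableBasis hc i, tableBasis hc j⁆ l = c i j l := by
  rw [tableBasis_repr, TableAlgebra.lie_apply, Finset.sum_eq_single i, Finset.sum_eq_single j]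
  · rw [tableBasis_apply, tableBasis_apply]
    simp
  · intro k _ hk
    rw [tableBasis_apply hc j, Pi.single_eq_of_ne hk]
    simp
  · simp
  · intro k _ hk
    refine Finset.sum_eq_zero fun k' _ => ?_
    rw [tableBasis_apply hc i, Pi.single_eq_of_ne hk]
    simp
  · simp

theorem bvec_tableBasis {c : Fin n → Fin n → Fin n → ℂ} (hc : IsLieTable c) {j : ℕ} (h1 : 1 ≤ j)
    (h2 : j ≤ n) : bvec (tableBasis hc) j = TableAlgebra.vec hc j := by
  obtain ⟨j, rfl⟩ := Nat.exists_eq_add_of_le' h1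
  rw [bvec_fin _ ⟨j, by omega⟩, tableBasis_apply]
  funext i
  simp only [TableAlgebra.vec, Pi.single_apply, Fin.ext_iff, Nat.add_right_cancel_iff]

/-- A Lie algebra isomorphic to the one given by the table of `u` has a basis with structure
constants `u`. -/
theorem exists_basis_of_equiv_skewTable {u : ℕ → ℕ → ℕ → ℂ} {hc : IsLieTable (skewTable n u)}
    (e : L ≃ₗ⁅ℂ⁆ TableAlgebra (skewTable n u) hc) :
    ∃ b : Basis (Fin n) ℂ L, ∀ i j l, 1 ≤ i → i < j → j ≤ n → 1 ≤ l → l ≤ n →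
      bco b l ⁅bvec b i, bvec b j⁆ = u i j l := by
  refine ⟨(tableBasis hc).map e.symm.toLinearEquiv, fun i j l h1 h2 h3 h4 h5 => ?_⟩
  obtain ⟨i, rfl⟩ := Nat.exists_eq_add_of_le' h1
  obtain ⟨j, rfl⟩ := Nat.exists_eq_add_of_le' (h1.trans h2.le)
  obtain ⟨l, rfl⟩ := Nat.exists_eq_add_of_le' h4
  have hu : skewTable n u ⟨i, by omega⟩ ⟨j, by omega⟩ ⟨l, by omega⟩ = u (i + 1) (j + 1) (l + 1) := by
    unfold skewTable
    rw [if_pos (Fin.lt_def.mpr (by simpa using h2))]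
  rw [bvec_fin _ ⟨i, by omega⟩, bvec_fin _ ⟨j, by omega⟩, bco_fin _ ⟨l, by omega⟩, ← hu,
    ← repr_lie_tableBasis hc, Basis.coord_apply, Basis.map_repr, Basis.map_apply, Basis.map_apply]
  change (tableBasis hc).repr (e ⁅e.symm _, e.symm _⁆) _ = _
  rw [LieEquiv.map_lie, LieEquiv.apply_symm_apply, LieEquiv.apply_symm_apply]

end LieBasis

/-! ### Tori and completeness of the semidirect product -/

section Complete

variable {L : Type*} [LieRing L] [LieAlgebra ℂ L]

theorem IsTorus.comm {t : LieSubalgebra ℂ (LieDerivation ℂ L L)} (ht : IsTorus t)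
    {D E : LieDerivation ℂ L L} (hD : D ∈ t) (hE : E ∈ t) (x : L) : D (E x) = E (D x) := by
  have h := ht.1.trivial (⟨D, hD⟩ : t) (⟨E, hE⟩ : t)
  have h2 : ⁅D, E⁆ = 0 := congrArg Subtype.val h
  rw [← sub_eq_zero, ← LieDerivation.commutator_apply, h2]
  rfl

/-- A derivation commuting with a torus `t` and differing from every `ad x + s` with `s ∈ t`
prevents `L ⊕ t` from being complete. -/
theorem not_isCompleteLie_torusExtension {t : LieSubalgebra ℂ (LieDerivation ℂ L L)}
    (ht : IsTorus t) (h : LieDerivation ℂ L L) (hcomm : ∀ s ∈ t, ∀ x, h (s x) = s (h x))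
    (hin : ∀ x : L, ∀ s ∈ t, ¬ ∀ y, h y = ⁅x, y⁆ + s y) :
    ¬ IsCompleteLie (TorusExtension t) := by
  rintro ⟨-, hD⟩
  have hab : ∀ s r : t, ⁅s, r⁆ = 0 := fun s r => ht.1.trivial s r
  have hcomm' : ∀ (s : t) (x : L), h (t.incl s x) = t.incl s (h x) := fun s => hcomm s s.2
  -- Extension of `h` by zero on `t`; the Leibniz rule for mixed brackets is exactly commutation of
  -- `h` with `t`.
  let D : LieDerivation ℂ (TorusExtension t) (TorusExtension t) :=
    { toFun := fun z => ⟨h z.left, 0⟩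
      map_add' := fun z w => by simp
      map_smul' := fun c z => by simp
      leibniz' := fun z w => by
        obtain ⟨x, s⟩ := z
        obtain ⟨y, r⟩ := w
        simp only [LieAlgebra.SemiDirectSum.lie_eq_mk, LieAlgebra.SemiDirectSum.sub_eq_mk,
          LinearMap.coe_mk, AddHom.coe_mk, map_zero, LieDerivation.zero_apply, lie_zero, sub_zero,
          map_sub, map_add, LieDerivation.apply_lie_eq_sub, hcomm']
        congr 1
        abel }
  obtain ⟨z, hz⟩ := hD D
  refine hin z.left z.right z.right.2 fun y => ?_
  have := congrArg LieAlgebra.SemiDirectSum.left (hz ⟨y, 0⟩)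
  simpa [D] using this

/-- An endomorphism with a basis of eigenvectors is semisimple. -/
theorem isSemisimple_of_basis {V ι : Type*} [AddCommGroup V] [Module ℂ V] [Fintype ι]
    (v : Basis ι ℂ V) (w : ι → ℂ) (f : Module.End ℂ V) (h : ∀ i, f (v i) = w i • v i) :
    f.IsSemisimple := by
  classical
  have : FiniteDimensional ℂ V := v.finiteDimensional_of_finite
  -- Taking the set of values of `w` removes repetitions, so the product below is squarefree while
  -- still annihilating `f`.
  let s := Finset.univ.image w
  refine Module.End.isSemisimple_of_squarefree_aeval_eq_zero
    (p := ∏ μ ∈ s, (Polynomial.X - Polynomial.C μ)) ?_ ?_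
  · refine Polynomial.Separable.squarefree ?_
    rw [Polynomial.separable_prod_X_sub_C_iff'] 
    exact fun x _ y _ h => h
  · refine v.ext fun i => ?_
    have hi : w i ∈ s := Finset.mem_image_of_mem _ (Finset.mem_univ i)
    rw [← Finset.prod_erase_mul _ _ hi, map_mul, Module.End.mul_apply]
    simp [h]

variable {ι : Type*} [Fintype ι]

/-- A derivation that is diagonal in a basis in which a maximal torus is diagonal belongs to that
torus. -/
theorem IsMaximalTorus.mem_of_diagonal {t : LieSubalgebra ℂ (LieDerivation ℂ L L)}
    (ht : IsMaximalTorus t) (v : Basis ι ℂ L) (hv : ∀ s ∈ t, ∀ i, ∃ μ : ℂ, s (v i) = μ • v i)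
    {D : LieDerivation ℂ L L} (hD : ∀ i, ∃ μ : ℂ, D (v i) = μ • v i) : D ∈ t := by
  -- All derivations diagonal in `v` form a torus; it contains `t`, and maximality makes the two
  -- equal.
  let T : LieSubalgebra ℂ (LieDerivation ℂ L L) :=
    { carrier := {E | ∀ i, ∃ μ : ℂ, E (v i) = μ • v i}
      add_mem' := fun {E F} hE hF i => by
        obtain ⟨μ, hμ⟩ := hE i
        obtain ⟨ν, hν⟩ := hF i
        exact ⟨μ + ν, by rw [LieDerivation.add_apply, hμ, hν, add_smul]⟩
      zero_mem' := fun i => ⟨0, by simp⟩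
      smul_mem' := fun c E hE i => by
        obtain ⟨μ, hμ⟩ := hE i
        exact ⟨c * μ, by rw [LieDerivation.smul_apply, hμ, smul_smul]⟩
      lie_mem' := fun {E F} hE hF i => by
        obtain ⟨μ, hμ⟩ := hE i
        obtain ⟨ν, hν⟩ := hF i
        exact ⟨0, by
          rw [LieDerivation.commutator_apply, hμ, hν, map_smul, map_smul, hμ, hν, smul_comm,
            sub_self, zero_smul]⟩ }
  have hT : IsTorus T := by
    refine ⟨⟨fun E F => Subtype.ext ?_⟩, fun E hE => ?_⟩
    · refine LieDerivation.ext fun x => ?_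
      have : ((⁅(E : LieDerivation ℂ L L), (F : LieDerivation ℂ L L)⁆ : LieDerivation ℂ L L) :
          L →ₗ[ℂ] L) = 0 := by
        refine v.ext fun i => ?_
        obtain ⟨μ, hμ⟩ := E.2 i
        obtain ⟨ν, hν⟩ := F.2 i
        rw [LieDerivation.coeFn_coe, LieDerivation.commutator_apply, hμ, hν, map_smul, map_smul,
          hμ, hν, smul_comm, sub_self]
        rfl
      exact LinearMap.congr_fun this x
    · choose w hw using hE
      exact isSemisimple_of_basis v w _ hw
  exact ht.2 hT (fun s hs i => hv s hs i) hD

/-- A maximal torus containing a derivation with distinct nonzero eigenvalues yields a complete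
semidirect product. -/
theorem IsMaximalTorus.isCompleteLie {t : LieSubalgebra ℂ (LieDerivation ℂ L L)}
    (ht : IsMaximalTorus t) {d : LieDerivation ℂ L L} (hd : d ∈ t) (v : Basis ι ℂ L) (w : ι → ℂ)
    (hw : Function.Injective w) (hw0 : ∀ i, w i ≠ 0) (hv : ∀ i, d (v i) = w i • v i) :
    IsCompleteLie (TorusExtension t) := by
  classical
  have hrepr : ∀ x i, v.repr (d x) i = w i * v.repr x i := by
    intro x i
    have : v.coord i ∘ₗ (d : L →ₗ[ℂ] L) = w i • v.coord i := by
      refine v.ext fun j => ?_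
      simp only [LinearMap.comp_apply, LieDerivation.coeFn_coe, hv, map_smul, LinearMap.smul_apply,
        Basis.coord_apply, Basis.repr_self, smul_eq_mul]
      rcases eq_or_ne j i with rfl | h
      · rfl
      · rw [Finsupp.single_eq_of_ne h.symm, mul_zero, mul_zero]
    exact LinearMap.congr_fun this x
  -- an eigenvector of eigenvalue `w i` is proportional to `v i`
  have heig : ∀ x i, d x = w i • x → x = v.repr x i • v i := by
    intro x i hx
    refine v.ext_elem fun j => ?_
    rw [map_smul, Basis.repr_self, Finsupp.smul_apply, smul_eq_mul]
    rcases eq_or_ne j i with rfl | h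
    · simp
    · rw [Finsupp.single_eq_of_ne h, mul_zero]
      have := hrepr x j
      rw [hx, map_smul, Finsupp.smul_apply, smul_eq_mul] at this
      have h2 : (w j - w i) * v.repr x j = 0 := by rw [sub_mul, this, sub_self]
      exact (mul_eq_zero.mp h2).resolve_left (sub_ne_zero.mpr (hw.ne h))
  -- Simple spectrum: whatever commutes with `d` preserves each eigenline.
  have hdiag : ∀ E : LieDerivation ℂ L L, (∀ x, E (d x) = d (E x)) →
      ∀ i, ∃ μ : ℂ, E (v i) = μ • v i := by
    intro E hE i
    exact ⟨_, heig _ i (by rw [← hE, hv, map_smul])⟩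
  have htdiag : ∀ s ∈ t, ∀ i, ∃ μ : ℂ, s (v i) = μ • v i :=
    fun s hs => hdiag s fun x => ht.1.comm hs hd x
  have hinj : ∀ x, d x = 0 → x = 0 := by
    intro x hx
    refine v.ext_elem fun i => ?_
    have := hrepr x i
    rw [hx, map_zero, Finsupp.zero_apply, eq_comm, mul_eq_zero] at this
    rw [this.resolve_left (hw0 i), map_zero]; rfl
  have hsurj : ∀ x, ∃ y, d y = x := by
    intro x
    refine ⟨∑ i, ((w i)⁻¹ * v.repr x i) • v i, ?_⟩
    conv_rhs => rw [← v.sum_repr x]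
    rw [map_sum]
    refine Finset.sum_congr rfl fun i _ => ?_
    rw [map_smul, hv, smul_smul, mul_right_comm, inv_mul_cancel₀ (hw0 i), one_mul]
  have hab : ∀ s r : t, ⁅s, r⁆ = 0 := fun s r => ht.1.1.trivial s r
  -- The element `d` of the semidirect product: ad `H` is the invertible map `d` on `L` and zero on
  -- `t`.
  let H : TorusExtension t := ⟨0, ⟨d, hd⟩⟩
  have hH : ∀ x s, ⁅H, (⟨x, s⟩ : TorusExtension t)⁆ = ⟨d x, 0⟩ := by
    intro x s
    simp [H, hab]
  refine ⟨?_, fun D => ?_⟩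
  · rw [eq_bot_iff]
    rintro ⟨x, s⟩ hz
    have hz' := (LieModule.mem_maxTrivSubmodule ..).mp hz
    have h1 := hH x s
    rw [hz' H] at h1
    have hx : x = 0 := hinj x (congrArg LieAlgebra.SemiDirectSum.left h1).symm
    have hs : s = 0 := by
      refine Subtype.ext (LieDerivation.ext fun y => ?_)
      have h2 := congrArg LieAlgebra.SemiDirectSum.left (hz' ⟨y, 0⟩)
      rw [hx] at h2
      simpa using h2
    rw [hx, hs]
    exact Submodule.zero_mem _
  -- With this `y`, adding the inner term z ↦ [z, y] cancels the `L`-component of the image of `H`.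
  obtain ⟨y, hy⟩ := hsurj (-(D H).left)
  let D₁ : LieDerivation ℂ (TorusExtension t) (TorusExtension t) :=
    D + LieDerivation.inner ℂ _ _ (⟨y, 0⟩ : TorusExtension t)
  have hD₁ : ∀ z, D₁ z = D z + ⁅z, (⟨y, 0⟩ : TorusExtension t)⁆ := fun z => rfl
  have hlie : ∀ z w, D₁ ⁅z, w⁆ = ⁅z, D₁ w⁆ + ⁅D₁ z, w⁆ := D₁.apply_lie_eq_add
  have hl : ∀ (x : L) (s : t) (x' : L) (s' : t),
      ⁅(⟨x, s⟩ : TorusExtension t), (⟨x', s'⟩ : TorusExtension t)⁆ =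
        ⟨⁅x, x'⁆ + (s : LieDerivation ℂ L L) x' - (s' : LieDerivation ℂ L L) x, 0⟩ :=
    fun x s x' s' => by rw [← hab s s']; rfl
  obtain ⟨τ, hτ⟩ : ∃ τ : t, D₁ H = ⟨0, τ⟩ := by
    refine ⟨(D H).right, ?_⟩
    rw [hD₁, hH, hy]
    ext <;> simp
  -- Expand `D₁` on [H, v i] = w i • v i. In the `v i` coordinate the two terms with factor `w i`
  -- cancel, leaving the eigenvalue of τ, which is therefore zero. In the `t`-component `w i` times
  -- the unknown is zero.
  have hv₁ : ∀ i, (τ : LieDerivation ℂ L L) (v i) = 0 ∧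
      (D₁ ⟨v i, 0⟩).right = 0 := by
    intro i
    have h1 := hlie H ⟨v i, 0⟩
    obtain ⟨u, s, hz⟩ : ∃ u s, D₁ ⟨v i, 0⟩ = ⟨u, s⟩ := ⟨_, _, rfl⟩
    rw [hH, hv, hz, hH, hτ, hl] at h1
    have h2 : (⟨w i • v i, 0⟩ : TorusExtension t) = w i • ⟨v i, 0⟩ := by
      ext <;> simp
    rw [h2, map_smul, hz] at h1
    have h3 : w i • u = d u + (τ : LieDerivation ℂ L L) (v i) := by
      have := congrArg LieAlgebra.SemiDirectSum.left h1
      simpa using this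
    have h4 : w i • s = 0 := by
      have := congrArg LieAlgebra.SemiDirectSum.right h1
      simpa using this
    obtain ⟨μ, hμ⟩ := htdiag τ τ.2 i
    have h5 := congrArg (fun x => v.repr x i) h3
    simp only [map_smul, map_add, Finsupp.smul_apply, Finsupp.add_apply, hrepr, hμ, smul_eq_mul,
      Basis.repr_self, Finsupp.single_eq_same, left_eq_add, mul_one] at h5
    exact ⟨by rw [hμ, h5, zero_smul], by rw [hz]; exact (smul_eq_zero.mp h4).resolve_left (hw0 i)⟩
  have hτ0 : τ = 0 := by
    refine Subtype.ext (LieDerivation.ext fun x => ?_)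
    have : ((τ : LieDerivation ℂ L L) : L →ₗ[ℂ] L) = 0 := v.ext fun i => (hv₁ i).1
    exact LinearMap.congr_fun this x
  have hDH : D₁ H = 0 := by rw [hτ, hτ0]; rfl
  have hadd : ∀ x x' : L, (⟨x + x', 0⟩ : TorusExtension t) = ⟨x, 0⟩ + ⟨x', 0⟩ := fun x x' => by
    ext <;> simp
  have hsmul : ∀ (c : ℂ) (x : L), (⟨c • x, 0⟩ : TorusExtension t) = c • ⟨x, 0⟩ := fun c x => by
    ext <;> simp
  have hright : ∀ x, (D₁ ⟨x, 0⟩).right = 0 := by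
    let f : L →ₗ[ℂ] t :=
      { toFun := fun x => (D₁ ⟨x, 0⟩).right
        map_add' := fun x x' => by rw [hadd, map_add]; rfl
        map_smul' := fun c x => by rw [hsmul, map_smul]; rfl }
    have : f = 0 := v.ext fun i => (hv₁ i).2
    exact LinearMap.congr_fun this
  -- `D₁` now preserves `L` and kills `H`, so its restriction commutes with `d` and belongs to `t`
  -- by maximality.
  let δ : LieDerivation ℂ L L :=
    { toFun := fun x => (D₁ ⟨x, 0⟩).left
      map_add' := fun x x' => by rw [hadd, map_add]; rfl
      map_smul' := fun c x => by rw [hsmul, map_smul]; rfl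
      leibniz' := fun x x' => by
        have h1 := hlie ⟨x, 0⟩ ⟨x', 0⟩
        obtain ⟨p, hp⟩ : ∃ p, D₁ ⟨x, 0⟩ = ⟨p, 0⟩ :=
          ⟨_, LieAlgebra.SemiDirectSum.ext rfl (hright x)⟩
        obtain ⟨q, hq⟩ : ∃ q, D₁ ⟨x', 0⟩ = ⟨q, 0⟩ :=
          ⟨_, LieAlgebra.SemiDirectSum.ext rfl (hright x')⟩
        rw [hp, hq, hl, hl, hl] at h1
        simp only [ZeroMemClass.coe_zero, LieDerivation.zero_apply, sub_zero, add_zero] at h1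
        simp only [LinearMap.coe_mk, AddHom.coe_mk, h1, hp, hq, LieAlgebra.SemiDirectSum.add_eq_mk]
        rw [← lie_skew x', sub_neg_eq_add] }
  have hδ : ∀ x, D₁ ⟨x, 0⟩ = ⟨δ x, 0⟩ := fun x => LieAlgebra.SemiDirectSum.ext rfl (hright x)
  have hδd : ∀ x, δ (d x) = d (δ x) := by
    intro x
    have h1 := hlie H ⟨x, 0⟩
    rw [hDH, zero_lie, add_zero, hδ, hH, hH, hδ] at h1
    exact congrArg LieAlgebra.SemiDirectSum.left h1
  have hδt : δ ∈ t := ht.mem_of_diagonal v htdiag (hdiag δ hδd)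
  -- The `L`-component is killed by `d`, since `s` commutes with `H`. The `t`-component acts on `L`
  -- as the commutator of δ and `s`, which vanishes in a torus.
  have hs : ∀ s : t, D₁ ⟨0, s⟩ = 0 := by
    intro s
    have h1 := hlie H ⟨0, s⟩
    obtain ⟨u, r, hz⟩ : ∃ u r, D₁ ⟨0, s⟩ = ⟨u, r⟩ := ⟨_, _, rfl⟩
    have hu : u = 0 := by
      rw [hDH, zero_lie, add_zero, hz, hH, hH, map_zero] at h1
      have h2 : (⟨d u, 0⟩ : TorusExtension t) = 0 := h1.symm.trans (map_zero D₁)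
      exact hinj u (congrArg LieAlgebra.SemiDirectSum.left h2)
    have hr : r = 0 := by
      refine Subtype.ext (LieDerivation.ext fun x => ?_)
      have h2 := congrArg LieAlgebra.SemiDirectSum.left (hlie ⟨0, s⟩ ⟨x, 0⟩)
      rw [hδ, hz, hu, hl, hl, hl] at h2
      simp only [zero_lie, zero_add, ZeroMemClass.coe_zero, LieDerivation.zero_apply, sub_zero, hδ,
        LieAlgebra.SemiDirectSum.add_eq_mk, ht.1.comm hδt s.2] at h2
      simpa using h2
    rw [hz, hu, hr]; rfl
  refine ⟨⟨y, ⟨δ, hδt⟩⟩, fun z => ?_⟩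
  obtain ⟨x, s⟩ := z
  have h1 : (⟨x, s⟩ : TorusExtension t) = ⟨x, 0⟩ + ⟨0, s⟩ := by ext <;> simp
  have h2 : D₁ ⟨x, s⟩ = ⟨δ x, 0⟩ := by rw [h1, map_add, hδ, hs, add_zero]
  have h3 : D ⟨x, s⟩ = D₁ ⟨x, s⟩ - ⁅(⟨x, s⟩ : TorusExtension t), (⟨y, 0⟩ : TorusExtension t)⁆ := by
    rw [hD₁, add_sub_cancel_right]
  rw [h3, h2, hl, hl]
  simp only [LieAlgebra.SemiDirectSum.sub_eq_mk, sub_zero, ZeroMemClass.coe_zero,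
    LieDerivation.zero_apply]
  congr 1
  rw [← lie_skew]
  abel

end Complete

/-! ### Derivations that are triangular with respect to a flag -/

section Triangular

variable {L : Type*} [LieRing L] [LieAlgebra ℂ L] {n : ℕ} (b : Basis (Fin n) ℂ L)

/-- The flag of `b` is stable under the adjoint representation from its third term on, and the
basis vectors of index at least `3` are, up to scalars, brackets `[Y_a, Y_i]`, `a ∈ {1, 2}`. -/
structure IsCentralFlag : Prop where
  lie_mem : ∀ i j, 1 ≤ i → i < j → j ≤ n → ⁅bvec b i, bvec b j⁆ ∈ flag b 3
  lie_mem_succ : ∀ i j, 1 ≤ i → i ≤ n → 3 ≤ j → j ≤ n → ⁅bvec b i, bvec b j⁆ ∈ flag b (j + 1)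
  exists_lie : ∀ i, 2 ≤ i → i < n → ∃ (a : ℕ) (κ : ℂ), κ ≠ 0 ∧ ⁅bvec b a, bvec b i⁆ = κ • bvec b (i + 1)

variable {b}

theorem IsCentralFlag.lie_mem_three (hb : IsCentralFlag b) (x y : L) : ⁅x, y⁆ ∈ flag b 3 := by
  refine lie_mem_of_flag_flag b (fun p q _ h1 h2 _ h3 h4 => ?_) (mem_flag_one b x)
    (mem_flag_one b y)
  rcases lt_trichotomy p q with h | rfl | h
  · exact hb.lie_mem p q h1 h h4
  · rw [lie_self]; exact Submodule.zero_mem _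
  · exact lie_mem_comm (hb.lie_mem q p h3 h h2)

theorem IsCentralFlag.lie_mem_flag_succ (hb : IsCentralFlag b) (x : L) {j : ℕ} (hj : 3 ≤ j) {y : L}
    (hy : y ∈ flag b j) : ⁅x, y⁆ ∈ flag b (j + 1) :=
  lie_mem_of_flag_flag b (fun p q _ h1 h2 h3 _ h4 =>
    flag_anti b (by omega) (hb.lie_mem_succ p q h1 h2 (by omega) h4)) (mem_flag_one b x) hy

/-- Basis vectors of index at least 3 are brackets up to scalars. By the Leibniz rule the image of
such a bracket stays in the term of the flag to which all brackets of that depth belong. -/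
theorem IsCentralFlag.derivation_mem_of_three_le (hb : IsCentralFlag b) (D : LieDerivation ℂ L L)
    {i : ℕ} (hi : 3 ≤ i) {x : L} (hx : x ∈ flag b i) : D x ∈ flag b i := by
  have key : ∀ j, 3 ≤ j → j ≤ n → D (bvec b j) ∈ flag b j := by
    intro j hj
    induction j, hj using Nat.le_induction with
    | base =>
      intro hn
      obtain ⟨a, κ, hκ, h⟩ := hb.exists_lie 2 le_rfl hn
      rw [← Submodule.smul_mem_iff _ hκ, ← map_smul, ← h, D.apply_lie_eq_add]
      exact Submodule.add_mem _ (hb.lie_mem_three _ _) (hb.lie_mem_three _ _)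
    | succ j hj ih =>
      intro hn
      obtain ⟨a, κ, hκ, h⟩ := hb.exists_lie j (by omega) hn
      rw [← Submodule.smul_mem_iff _ hκ, ← map_smul, ← h, D.apply_lie_eq_add]
      exact Submodule.add_mem _ (hb.lie_mem_flag_succ _ hj (ih (by omega)))
        (hb.lie_mem_flag_succ _ hj (bvec_mem_flag b le_rfl))
  have : flag b i ≤ (flag b i).comap (D : L →ₗ[ℂ] L) :=
    flag_le b fun j h1 _ h2 => flag_anti b h1 (key j (by omega) h2)
  exact this hx

/-- A Y_1 component of D Y_2 would be visible as a Y_4 component of [D Y_2, Y_3], because [Y_1, Y_3]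
= Y_4. Applying `D` to [Y_2, Y_3], which lies in the fifth term of the flag, shows that there is
none. -/
theorem IsCentralFlag.derivation_mem_two (hb : IsCentralFlag b) (hn : 4 ≤ n)
    (h13 : ⁅bvec b 1, bvec b 3⁆ = bvec b 4) (h23 : ⁅bvec b 2, bvec b 3⁆ ∈ flag b 5)
    (D : LieDerivation ℂ L L) : D (bvec b 2) ∈ flag b 2 := by
  refine mem_flag_succ b (mem_flag_one b _) ?_
  set p := bco b 1 (D (bvec b 2))
  have h1 := sub_mem_flag b (mem_flag_one b (D (bvec b 2)))
  have h2 := sub_mem_flag b h1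
  have h3 : ∀ x ∈ flag b 3, ⁅x, bvec b 3⁆ ∈ flag b 5 := by
    intro x hx
    have h4 := hb.lie_mem_flag_succ (bvec b 3) (by omega) (sub_mem_flag b hx)
    rw [lie_sub, lie_smul, lie_self, smul_zero, sub_zero] at h4
    exact lie_mem_comm h4
  have h4 : ⁅D (bvec b 2), bvec b 3⁆ ∈ flag b 5 := by
    have e1 := hb.derivation_mem_of_three_le D (by omega) h23
    rw [D.apply_lie_eq_add] at e1
    have e2 := hb.derivation_mem_of_three_le D (le_refl 3) (bvec_mem_flag b le_rfl)
    have e3 := hb.lie_mem_flag_succ (bvec b 2) (by omega) (sub_mem_flag b e2)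
    rw [lie_sub, lie_smul] at e3
    have e4 := Submodule.add_mem _ e3 (Submodule.smul_mem _ (bco b 3 (D (bvec b 3))) h23)
    rw [sub_add_cancel] at e4
    exact (Submodule.add_mem_iff_right _ e4).mp e1
  have h5 := h3 _ h2
  rw [sub_lie, sub_lie, smul_lie, smul_lie, h13] at h5
  have h6 := h5 4 (by omega)
  rw [map_sub, map_sub, map_smul, map_smul, h4 4 (by omega), h23 4 (by omega),
    bco_bvec_self b (by omega) hn, smul_zero, sub_zero, zero_sub, neg_eq_zero, smul_eq_mul,
    mul_one] at h6
  exact h6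

theorem IsCentralFlag.derivation_mem (hb : IsCentralFlag b) {D : LieDerivation ℂ L L}
    (h2 : D (bvec b 2) ∈ flag b 2) {i : ℕ} {x : L} (hx : x ∈ flag b i) : D x ∈ flag b i := by
  have : flag b i ≤ (flag b i).comap (D : L →ₗ[ℂ] L) := by
    refine flag_le b fun j h1 h3 h4 => flag_anti b h1 ?_
    change D (bvec b j) ∈ _
    obtain rfl | rfl | h : j = 1 ∨ j = 2 ∨ 3 ≤ j := by omega
    · exact mem_flag_one b _
    · exact h2
    · exact hb.derivation_mem_of_three_le D h (bvec_mem_flag b le_rfl)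
  exact this hx

/-- The diagonal entries of a triangular derivation are additive along brackets. -/
theorem diagonal_add {D : LieDerivation ℂ L L} (hD : ∀ i, ∀ x ∈ flag b i, D x ∈ flag b i)
    {i j l : ℕ} {c : ℂ} (hc : c ≠ 0) (hl1 : 1 ≤ l) (hl2 : l ≤ n)
    (h : ⁅bvec b i, bvec b j⁆ - c • bvec b l ∈ flag b (l + 1))
    (hi : ∀ x ∈ flag b (i + 1), ⁅x, bvec b j⁆ ∈ flag b (l + 1))
    (hj : ∀ x ∈ flag b (j + 1), ⁅bvec b i, x⁆ ∈ flag b (l + 1)) :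
    bco b l (D (bvec b l)) = bco b i (D (bvec b i)) + bco b j (D (bvec b j)) := by
  have h1 := hi _ (sub_mem_flag b (hD i _ (bvec_mem_flag b le_rfl)))
  have h2 := hj _ (sub_mem_flag b (hD j _ (bvec_mem_flag b le_rfl)))
  have h3 := hD _ _ h
  rw [map_sub, D.apply_lie_eq_add, map_smul] at h3
  rw [sub_lie, smul_lie] at h1
  rw [lie_sub, lie_smul] at h2
  have e := h l (Nat.lt_succ_self l)
  have e1 := h1 l (Nat.lt_succ_self l)
  have e2 := h2 l (Nat.lt_succ_self l)
  have e3 := h3 l (Nat.lt_succ_self l)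
  simp only [map_sub, map_add, map_smul, smul_eq_mul, bco_bvec_self b hl1 hl2] at e e1 e2 e3
  refine mul_left_cancel₀ hc ?_
  linear_combination (-1 : ℂ) * e3 + e2 + e1 +
    (bco b i (D (bvec b i)) + bco b j (D (bvec b j))) * e

/-- A triangular endomorphism with distinct diagonal entries has a basis of eigenvectors. -/
theorem exists_eigenbasis {f : Module.End ℂ L} (hf : ∀ i, ∀ x ∈ flag b i, f x ∈ flag b i)
    (hinj : ∀ i j, 1 ≤ i → i < j → j ≤ n →
      bco b i (f (bvec b i)) ≠ bco b j (f (bvec b j))) :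
    ∃ v : Basis (Fin n) ℂ L, ∀ i : Fin n,
      f (v i) = bco b (i + 1) (f (bvec b (i + 1))) • v i := by
  have : FiniteDimensional ℂ L := b.finiteDimensional_of_finite
  set w : ℕ → ℂ := fun i => bco b i (f (bvec b i))
  have key : ∀ i, 1 ≤ i → i ≤ n → ∃ x : L, x ≠ 0 ∧ f x = w i • x := by
    intro i h1 h2
    -- Subtracting the diagonal entry pushes the `i`-th term into a space of smaller dimension, so
    -- there is a kernel vector.
    have hmap : ∀ x ∈ flag b i, (f - algebraMap ℂ _ (w i)) x ∈ flag b (i + 1) := by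
      intro x hx
      have e1 := hf _ _ (sub_mem_flag b hx)
      have e2 := sub_mem_flag b (hf i _ (bvec_mem_flag b le_rfl))
      have e3 := Submodule.smul_mem _ (w i) (sub_mem_flag b hx)
      have e4 := Submodule.add_mem _ (Submodule.sub_mem _ e1 e3)
        (Submodule.smul_mem _ (bco b i x) e2)
      convert e4 using 1
      simp only [LinearMap.sub_apply, Module.algebraMap_end_apply, map_sub, map_smul, smul_sub, w]
      rw [smul_comm (bco b i x)]
      abel
    let g : flag b i →ₗ[ℂ] flag b (i + 1) := (f - algebraMap ℂ _ (w i)).restrict hmap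
    have hlt : flag b (i + 1) < flag b i := by
      refine lt_of_le_of_ne (flag_anti b (Nat.le_succ i)) fun h => ?_
      exact bvec_notMem_flag b h1 h2 (Nat.lt_succ_self i) (h ▸ bvec_mem_flag b le_rfl)
    have hker := LinearMap.ker_ne_bot_of_finrank_lt (f := g) (Submodule.finrank_lt_finrank_of_lt hlt)
    obtain ⟨x, hx, hx0⟩ := (Submodule.ne_bot_iff _).mp hker
    refine ⟨x, fun h => hx0 (Subtype.ext h), ?_⟩
    have h3 : (f - algebraMap ℂ _ (w i)) (x : L) = 0 := congrArg Subtype.val (LinearMap.mem_ker.mp hx)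
    rwa [LinearMap.sub_apply, Module.algebraMap_end_apply, sub_eq_zero] at h3
  choose! x hx0 hx using key
  have hli : LinearIndependent ℂ fun i : Fin n => x (i + 1) := by
    refine Module.End.eigenvectors_linearIndependent' f (fun i : Fin n => w (i + 1)) ?_ _ ?_
    · intro i j hij
      have hi := i.isLt
      have hj := j.isLt
      rcases lt_trichotomy i j with h | h | h
      · exact absurd hij (hinj _ _ (by omega) (by simpa using h) (by omega))
      · exact h
      · exact absurd hij.symm (hinj _ _ (by omega) (by simpa using h) (by omega))
    · intro i
      have hi := i.isLt
      exact ⟨Module.End.mem_eigenspace_iff.mpr (hx _ (by omega) (by omega)),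
        hx0 _ (by omega) (by omega)⟩
  refine ⟨basisOfLinearIndependentOfCardEqFinrank' _ hli (finrank_eq_card_basis b).symm, fun i => ?_⟩
  have hi := i.isLt
  rw [coe_basisOfLinearIndependentOfCardEqFinrank']
  exact hx _ (by omega) (by omega)

/-- A strictly triangular semisimple derivation vanishes. -/
theorem eq_zero_of_strictly_triangular {f : Module.End ℂ L} (hss : f.IsSemisimple)
    (hf : ∀ i, ∀ x ∈ flag b i, f x ∈ flag b i)
    (h0 : ∀ i, 1 ≤ i → i ≤ n → bco b i (f (bvec b i)) = 0) : f = 0 := by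
  -- With zero diagonal, `f` moves one step down the flag each time, hence is nilpotent.
  have hsucc : ∀ i, 1 ≤ i → flag b i ≤ (flag b (i + 1)).comap f := fun i hi =>
    flag_le b fun j h1 h2 h3 => flag_anti b (by omega)
      (mem_flag_succ b (hf j _ (bvec_mem_flag b le_rfl)) (h0 j h2 h3))
  have hpow : ∀ k x, (f ^ k) x ∈ flag b (k + 1) := by
    intro k
    induction k with
    | zero => exact fun x => mem_flag_one b x
    | succ k ih =>
      intro x
      rw [pow_succ', Module.End.mul_apply]
      exact hsucc _ (by omega) (ih x)
  refine Module.End.eq_zero_of_isNilpotent_isSemisimple ⟨n, ?_⟩ hss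
  exact LinearMap.ext fun x => eq_zero_of_mem_flag b (Nat.lt_succ_self n) (hpow n x)

/-- A zero torus lies in the torus that realises the rank. If it were maximal, that one would vanish
too. -/
theorem HasRank.ne_bot_of_isMaximalTorus {r : ℕ} (hr : 0 < r) (h : HasRank L r)
    {t : LieSubalgebra ℂ (LieDerivation ℂ L L)} (ht : IsMaximalTorus t) :
    ∃ d ∈ t, d ≠ 0 := by
  by_contra! h0
  obtain ⟨t₁, ht₁, hr₁⟩ := h
  have hle : t ≤ t₁ := fun x hx => by rw [h0 x hx]; exact t₁.zero_mem
  have hle' := ht.2 ht₁.1 hle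
  have : Subsingleton t₁ := ⟨fun x y => Subtype.ext ((h0 x (hle' x.2)).trans (h0 y (hle' y.2)).symm)⟩
  rw [Module.finrank_zero_of_subsingleton] at hr₁
  omega

/-- If the diagonal entries of all derivations are proportional to a system of distinct positive
integers, then `L` is completable. -/
theorem isCompletable_of_diagonal_proportional (m : ℕ → ℕ) (hm0 : ∀ i, 1 ≤ i → i ≤ n → m i ≠ 0)
    (hm : ∀ i j, 1 ≤ i → i < j → j ≤ n → m i ≠ m j)
    (hD : ∀ (D : LieDerivation ℂ L L) (i : ℕ), ∀ x ∈ flag b i, D x ∈ flag b i)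
    (hDm : ∀ D : LieDerivation ℂ L L, ∃ α : ℂ, ∀ i, 1 ≤ i → i ≤ n →
      bco b i (D (bvec b i)) = α * m i)
    (hrank : HasRank L 1) : IsCompletable L := by
  intro t ht
  obtain ⟨d, hd, hd0⟩ := hrank.ne_bot_of_isMaximalTorus one_pos ht
  obtain ⟨α, hα⟩ := hDm d
  -- With α = 0 the derivation `d` would be strictly triangular and semisimple, hence zero.
  have hα0 : α ≠ 0 := by
    rintro rfl
    refine hd0 (LieDerivation.ext fun x => ?_)
    have := eq_zero_of_strictly_triangular (ht.1.2 d hd) (hD d)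
      (fun i h1 h2 => by rw [LieDerivation.coeFn_coe, hα i h1 h2, zero_mul])
    exact LinearMap.congr_fun this x
  have hw : ∀ i j, 1 ≤ i → i < j → j ≤ n →
      bco b i (d (bvec b i)) ≠ bco b j (d (bvec b j)) := by
    intro i j h1 h2 h3 h
    rw [hα i h1 (by omega), hα j (by omega) h3] at h
    exact hm i j h1 h2 h3 (by exact_mod_cast mul_left_cancel₀ hα0 h)
  obtain ⟨v, hv⟩ := exists_eigenbasis (f := (d : L →ₗ[ℂ] L)) (hD d) hw
  refine ht.isCompleteLie hd v _ ?_ (fun i => ?_) hv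
  · intro i j hij
    have hi := i.isLt
    have hj := j.isLt
    rcases lt_trichotomy i j with h | h | h
    · exact absurd hij (hw _ _ (by omega) (by simpa using h) (by omega))
    · exact h
    · exact absurd hij.symm (hw _ _ (by omega) (by simpa using h) (by omega))
  · have hi := i.isLt
    rw [LieDerivation.coeFn_coe, hα _ (by omega) (by omega)]
    exact mul_ne_zero hα0 (by exact_mod_cast hm0 _ (by omega) (by omega))

end Triangular

/-! ### Completability of the families `A` and `B` -/

section Families

variable {L : Type*} [LieRing L] [LieAlgebra ℂ L] {n : ℕ} {b : Basis (Fin n) ℂ L}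

/-- Brackets common to the families `A` (`N = n`) and `B` (`N = n - 1`): `Y₂, …, Y_N` is a chain
for `ad Y₁`, and `[Y_i, Y_j]` only involves `Y_{i+j+k-2}` and, if `N < n` and `i + j = n + 1`,
also `Y_n`. -/
structure IsGradedFiliform (b : Basis (Fin n) ℂ L) (N k : ℕ) : Prop where
  le : N ≤ n
  le_succ : n ≤ N + 1
  five_le : 5 ≤ N
  two_le : 2 ≤ k
  lie_one : ∀ j, 2 ≤ j → j < N → ⁅bvec b 1, bvec b j⁆ = bvec b (j + 1)
  lie_one_last : ∀ j, N ≤ j → j ≤ n → ⁅bvec b 1, bvec b j⁆ = 0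
  support : ∀ i j l, 2 ≤ i → i ≤ n → 2 ≤ j → j ≤ n → bco b l ⁅bvec b i, bvec b j⁆ ≠ 0 →
    (l + 2 = i + j + k ∧ l ≤ N) ∨ (l = n ∧ N < n ∧ i + j = n + 1)
  lie_two : N < n → ⁅bvec b 2, bvec b N⁆ = -bvec b n

variable {N k : ℕ}

theorem IsGradedFiliform.lie_mem_flag (hb : IsGradedFiliform b N k) {i j r : ℕ} (hi : 2 ≤ i)
    (hi' : i ≤ n) (hj : 2 ≤ j) (hj' : j ≤ n)
    (h : ∀ l, (l + 2 = i + j + k ∧ l ≤ N) ∨ (l = n ∧ N < n ∧ i + j = n + 1) → r ≤ l) :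
    ⁅bvec b i, bvec b j⁆ ∈ flag b r := by
  intro l hl
  by_contra h0
  have := h l (hb.support i j l hi hi' hj hj' h0)
  omega

theorem IsGradedFiliform.lie_one_mem (hb : IsGradedFiliform b N k) {j : ℕ} (hj : 2 ≤ j)
    (hj' : j ≤ n) : ⁅bvec b 1, bvec b j⁆ ∈ flag b (j + 1) := by
  rcases lt_or_ge j N with h | h
  · rw [hb.lie_one j hj h]; exact bvec_mem_flag b le_rfl
  · rw [hb.lie_one_last j h hj']; exact Submodule.zero_mem _

theorem IsGradedFiliform.isCentralFlag (hb : IsGradedFiliform b N k) : IsCentralFlag b := by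
  have h1 := hb.le
  have h2 := hb.le_succ
  have h3 := hb.five_le
  have h4 := hb.two_le
  refine ⟨fun i j hi hij hj => ?_, fun i j hi hi' hj hj' => ?_, fun i hi hi' => ?_⟩
  · rcases hi.eq_or_lt with rfl | hi
    · exact flag_anti b (by omega) (hb.lie_one_mem hij hj)
    · exact hb.lie_mem_flag (by omega) (by omega) (by omega) (by omega) (by omega)
  · rcases hi.eq_or_lt with rfl | hi
    · exact hb.lie_one_mem (by omega) hj'
    · exact hb.lie_mem_flag (by omega) (by omega) (by omega) (by omega) (by omega)
  · rcases lt_or_ge i N with h | h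
    · exact ⟨1, 1, one_ne_zero, by rw [one_smul, hb.lie_one i hi h]⟩
    -- When N = n - 1 the last vector is not in the chain of Y_1; it is reached through Y_2 instead.
    · obtain rfl : i = N := by omega
      obtain rfl : n = i + 1 := by omega
      exact ⟨2, -1, by norm_num, by rw [hb.lie_two hi', neg_one_smul]⟩

/-- If moreover some `[Y_i, Y_{i+1}]` has a nonzero component along `Y_{2i+k-1}`, the algebra is
completable as soon as it has rank one. -/
theorem IsGradedFiliform.isCompletable (hb : IsGradedFiliform b N k) {i : ℕ} (hi : 2 ≤ i)
    (hiN : 2 * i + k ≤ N + 1) (hc : bco b (2 * i + k - 1) ⁅bvec b i, bvec b (i + 1)⁆ ≠ 0)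
    (hrank : HasRank L 1) : IsCompletable L := by
  have hN1 := hb.le
  have hN2 := hb.le_succ
  have hN3 := hb.five_le
  have hk := hb.two_le
  have hD : ∀ (D : LieDerivation ℂ L L) (i : ℕ), ∀ x ∈ flag b i, D x ∈ flag b i := fun D i x hx =>
    hb.isCentralFlag.derivation_mem (hb.isCentralFlag.derivation_mem_two (by omega)
      (hb.lie_one 3 (by omega) (by omega))
      (hb.lie_mem_flag (by omega) (by omega) (by omega) (by omega) (by omega)) D) hx
  -- The weights obtained from weight 1 on Y_1 and k on Y_2. The last value is k + (N + k - 2), as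
  -- Y_n = -[Y_2, Y_N].
  let m : ℕ → ℕ := fun i => if i = 1 then 1 else if i ≤ N then i + k - 2 else 2 * k + N - 2
  have hm : ∀ i, i = 1 ∧ m i = 1 ∨ i ≠ 1 ∧ i ≤ N ∧ m i = i + k - 2 ∨ i ≠ 1 ∧ N < i ∧
      m i = 2 * k + N - 2 := by
    intro i
    simp only [m]
    split_ifs <;> omega
  refine isCompletable_of_diagonal_proportional (b := b) m (fun i h1 h2 => ?_)
    (fun i j h1 h2 h3 => ?_) hD (fun D => ?_) hrank
  · have := hm i
    omega
  · have := hm i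
    have := hm j
    omega
  set w : ℕ → ℂ := fun i => bco b i (D (bvec b i)) with hw
  have hstep : ∀ j, 2 ≤ j → j < N → w (j + 1) = w 1 + w j := by
    intro j h1 h2
    refine diagonal_add (hD D) one_ne_zero (by omega) (by omega) ?_ (fun x hx => ?_)
      (fun x hx => ?_)
    · rw [hb.lie_one j h1 h2, one_smul, sub_self]; exact Submodule.zero_mem _
    · refine lie_mem_comm (lie_mem_of_flag b (fun p hp1 _ hp2 => ?_) hx)
      exact hb.lie_mem_flag (by omega) (by omega) (by omega) (by omega) (by omega)
    · refine lie_mem_of_flag b (fun p hp1 _ hp2 => ?_) hx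
      exact flag_anti b (by omega) (hb.lie_one_mem (by omega) hp2)
  have hchain : ∀ j, j + 2 ≤ N → w (j + 2) = w 2 + j * w 1 := by
    intro j
    induction j with
    | zero => intro _; simp
    | succ j ih =>
      intro hj
      rw [show j + 1 + 2 = j + 2 + 1 by ring, hstep (j + 2) (by omega) (by omega), ih (by omega)]
      push_cast
      ring
  have hlast : N < n → w n = w 2 + w N := by
    intro hNn
    refine diagonal_add (hD D) (c := -1) (by norm_num) (by omega) (by omega) ?_ (fun x hx => ?_)
      (fun x hx => ?_)
    · rw [hb.lie_two hNn, neg_one_smul, sub_self]; exact Submodule.zero_mem _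
    · refine lie_mem_comm (lie_mem_of_flag b (fun p hp1 _ hp2 => ?_) hx)
      exact hb.lie_mem_flag (by omega) (by omega) (by omega) (by omega) (by omega)
    · refine lie_mem_of_flag b (fun p hp1 _ hp2 => ?_) hx
      exact hb.lie_mem_flag (by omega) (by omega) (by omega) (by omega) (by omega)
  have hrel : w (2 * i + k - 1) = w i + w (i + 1) := by
    refine diagonal_add (hD D) hc (by omega) (by omega) ?_ (fun x hx => ?_) (fun x hx => ?_)
    · exact sub_mem_flag b
        (hb.lie_mem_flag (by omega) (by omega) (by omega) (by omega) (by omega))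
    · refine lie_mem_comm (lie_mem_of_flag b (fun p hp1 _ hp2 => ?_) hx)
      exact hb.lie_mem_flag (by omega) (by omega) (by omega) (by omega) (by omega)
    · refine lie_mem_of_flag b (fun p hp1 _ hp2 => ?_) hx
      exact hb.lie_mem_flag (by omega) (by omega) (by omega) (by omega) (by omega)
  obtain ⟨i, rfl⟩ := Nat.exists_eq_add_of_le' hi
  obtain ⟨k, rfl⟩ := Nat.exists_eq_add_of_le' hk
  -- Substitute the arithmetic progression `hchain` into `hrel`. Here `k + 2` is the original `k`,
  -- and `i + 2` the original `i`.
  have hw2 : w 2 = (k + 2) * w 1 := by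
    rw [show 2 * (i + 2) + (k + 2) - 1 = 2 * i + k + 3 + 2 by omega,
      hchain (2 * i + k + 3) (by omega), hchain i (by omega), show i + 2 + 1 = i + 1 + 2 by ring,
      hchain (i + 1) (by omega)] at hrel
    push_cast at hrel
    linear_combination -hrel
  have hgen : ∀ j, 2 ≤ j → j ≤ N → w j = w 1 * (j + k : ℕ) := by
    intro j h1 h2
    obtain ⟨j, rfl⟩ := Nat.exists_eq_add_of_le' h1
    rw [hchain j h2, hw2]
    push_cast
    ring
  refine ⟨w 1, fun j h1 h2 => ?_⟩
  change w j = _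
  rcases hm j with ⟨rfl, h⟩ | ⟨h3, h4, h⟩ | ⟨h3, h4, h⟩
  · rw [h, Nat.cast_one, mul_one]
  · rw [h, hgen j (by omega) h4]
    congr 2
  · obtain rfl : j = n := by omega
    rw [hlast h4, hgen N (by omega) le_rfl, hgen 2 le_rfl (by omega), h, ← mul_add, ← Nat.cast_add]
    congr 2
    omega

theorem coeff_succ (lam : ℕ → ℂ) (s : ℕ) : coeff lam (s + 1) (s + 2) = lam s := by
  rw [coeff, show s + 2 - (s + 1) = 1 by omega, coeffAux, Nat.add_sub_cancel]

/-- Extends a statement on brackets of basis vectors of increasing indices. -/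
theorem bco_lie_ne_zero_of_lt {P : ℕ → ℕ → ℕ → Prop} (hP : ∀ i j l, P i j l → P j i l)
    (h : ∀ i j l, 2 ≤ i → i < j → j ≤ n → 1 ≤ l → l ≤ n → bco b l ⁅bvec b i, bvec b j⁆ ≠ 0 →
      P i j l) (i j l : ℕ) (hi : 2 ≤ i) (hi' : i ≤ n) (hj : 2 ≤ j) (hj' : j ≤ n)
    (h0 : bco b l ⁅bvec b i, bvec b j⁆ ≠ 0) : P i j l := by
  have hl : 1 ≤ l ∧ l ≤ n := by
    by_contra hl
    rw [bco, dif_neg hl] at h0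
    exact h0 rfl
  rcases lt_trichotomy i j with hij | rfl | hij
  · exact h i j l hi hij hj' hl.1 hl.2 h0
  · rw [lie_self, map_zero] at h0
    exact absurd rfl h0
  · rw [← lie_skew, map_neg, neg_ne_zero] at h0
    exact hP _ _ _ (h j i l hj hij hi' hl.1 hl.2 h0)

/-- A nonzero λ_s is the coefficient of Y_{2s+k+1} in [Y_{s+1}, Y_{s+2}], which is the component
required by `IsGradedFiliform.isCompletable`. The bound s ≤ t - 1 keeps 2s + k + 1 ≤ n. -/
theorem IsIsoToA.isCompletable (h : IsIsoToA L) (hrank : HasRank L 1) : IsCompletable L := by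
  obtain ⟨n, k, lam, hc, hk, hn, ⟨s, hs1, hs2, hs⟩, ⟨e⟩⟩ := h
  obtain ⟨b, hb⟩ := exists_basis_of_equiv_skewTable e
  have hlie1 : ∀ j, 2 ≤ j → j ≤ n → ⁅bvec b 1, bvec b j⁆ = bvec b (j + 1) := by
    intro j h1 h2
    refine bco_ext b fun l h3 h4 => ?_
    rw [hb 1 j l le_rfl h1 h2 h3 h4, if_pos rfl]
    split_ifs with h
    · rw [← h, bco_bvec_self b h3 h4]
    · rw [bco_bvec_of_ne b h]
  have hgr : IsGradedFiliform b n k := by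
    refine ⟨le_rfl, by omega, by omega, hk, fun j h1 h2 => hlie1 j h1 h2.le, fun j h1 h2 => ?_,
      bco_lie_ne_zero_of_lt (by omega) fun i j l h1 h2 h3 h4 h5 h0 => ?_,
      fun h => absurd h (lt_irrefl n)⟩
    · rw [hlie1 j (by omega) h2, bvec_of_lt b (by omega)]
    · rw [hb i j l (by omega) h2 h3 h4 h5, if_neg (by omega)] at h0
      split_ifs at h0 with h6
      · exact Or.inl ⟨h6, h5⟩
      · exact absurd rfl h0
  refine hgr.isCompletable (i := s + 1) (by omega) (by omega) ?_ hrank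
  rw [hb _ _ _ (by omega) (by omega) (by omega) (by omega) (by omega), if_neg (by omega),
    if_pos (by omega), coeff_succ]
  exact hs

theorem IsIsoToB.isCompletable (h : IsIsoToB L) (hrank : HasRank L 1) : IsCompletable L := by
  obtain ⟨n, k, lam, hc, hn2, hk, hn, ⟨s, hs1, hs2, hs⟩, ⟨e⟩⟩ := h
  obtain ⟨b, hb⟩ := exists_basis_of_equiv_skewTable e
  -- Parity excludes n = 5, so that the chain length n - 1 is at least 5.
  have hn6 : 6 ≤ n := by
    obtain ⟨r, rfl⟩ := hn2
    omega
  have hlie1 : ∀ j, 2 ≤ j → j < n - 1 → ⁅bvec b 1, bvec b j⁆ = bvec b (j + 1) := by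
    intro j h1 h2
    refine bco_ext b fun l h3 h4 => ?_
    rw [hb 1 j l le_rfl h1 (by omega) h3 h4, if_pos rfl]
    split_ifs with h
    · rw [← h.1, bco_bvec_self b h3 h4]
    · rw [bco_bvec_of_ne b (by omega)]
  have hgr : IsGradedFiliform b (n - 1) k := by
    refine ⟨by omega, by omega, by omega, hk, hlie1, fun j h1 h2 => ?_,
      bco_lie_ne_zero_of_lt (by omega) fun i j l h1 h2 h3 h4 h5 h0 => ?_, fun h => ?_⟩
    · refine bco_ext b fun l h3 h4 => ?_
      rw [hb 1 j l le_rfl (by omega) (by omega) h3 h4, if_pos rfl, if_neg (by omega), map_zero]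
    · rw [hb i j l (by omega) h2 h3 h4 h5, if_neg (by omega)] at h0
      split_ifs at h0 with h6 h7
      · exact Or.inr ⟨h6.2, by omega, h6.1⟩
      · exact Or.inl ⟨h7.1, by omega⟩
      · exact absurd rfl h0
    · refine bco_ext b fun l h3 h4 => ?_
      rw [hb 2 (n - 1) l (by omega) (by omega) (by omega) h3 h4, if_neg (by omega), map_neg]
      rcases eq_or_ne l n with rfl | hl
      · rw [if_pos ⟨by omega, rfl⟩, bco_bvec_self b h3 h4]; norm_num
      · rw [if_neg (by omega), if_neg (by omega), bco_bvec_of_ne b hl, neg_zero]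
  refine hgr.isCompletable (i := s + 1) (by omega) (by omega) ?_ hrank
  rw [hb _ _ _ (by omega) (by omega) (by omega) (by omega) (by omega), if_neg (by omega),
    if_neg (by omega), if_pos (by omega), coeff_succ]
  exact hs

end Families

/-! ### The family `C` -/

section FamilyC

variable {L : Type*} [LieRing L] [LieAlgebra ℂ L] {n : ℕ} {b : Basis (Fin n) ℂ L}

/-- Brackets of the shape occurring in the family `C`: `Y₂, …, Y_{n-1}` is a chain for `ad Y₁`
and the other brackets are multiples of the central vector `Y_n`. -/
structure IsHeisenbergExtension (b : Basis (Fin n) ℂ L) : Prop where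
  six_le : 6 ≤ n
  lie_one : ∀ j, 2 ≤ j → j + 1 < n → ⁅bvec b 1, bvec b j⁆ = bvec b (j + 1)
  lie_one_last : ∀ j, n ≤ j + 1 → j ≤ n → ⁅bvec b 1, bvec b j⁆ = 0
  lie_mem : ∀ i j, 2 ≤ i → i ≤ n → 2 ≤ j → j ≤ n → ⁅bvec b i, bvec b j⁆ ∈ flag b n
  lie_eq_zero : ∀ i j, 2 ≤ i → i ≤ n → 2 ≤ j → j ≤ n → n + 2 ≤ i + j →
    ⁅bvec b i, bvec b j⁆ = 0

/-- Both sides of the Leibniz rule vanish on basis brackets. The derived algebra lies in the third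
term of the flag, which the map kills, and Y_{n-1} commutes with Y_1 and with all Y_j, j ≥ 3. -/
theorem IsHeisenbergExtension.exists_derivation (hb : IsHeisenbergExtension b) :
    ∃ h : LieDerivation ℂ L L, h (bvec b 2) = bvec b (n - 1) ∧
      ∀ j, 1 ≤ j → j ≤ n → j ≠ 2 → h (bvec b j) = 0 := by
  have hn := hb.six_le
  obtain ⟨f, hf⟩ := exists_linearMap_bvec b fun j => if j = 2 then bvec b (n - 1) else 0
  have hf0 : ∀ j, 1 ≤ j → j ≤ n → j ≠ 2 → f (bvec b j) = 0 := fun j h1 h2 h3 => by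
    rw [hf j h1 h2, if_neg h3]
  have hf2 : f (bvec b 2) = bvec b (n - 1) := by rw [hf 2 (by omega) (by omega), if_pos rfl]
  have hf3 : ∀ x ∈ flag b 3, f x = 0 := by
    have : flag b 3 ≤ LinearMap.ker f := flag_le b fun j h1 h2 h3 => hf0 j h2 h3 (by omega)
    exact this
  obtain ⟨h, hh⟩ := exists_derivation_of_basis b f fun i j h1 h2 h3 => by
    have hz : f ⁅bvec b i, bvec b j⁆ = 0 := by
      refine hf3 _ ?_
      rcases h1.eq_or_lt with rfl | h1
      · rcases lt_or_ge (j + 1) n with h | h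
        · rw [hb.lie_one j h2 h]; exact bvec_mem_flag b (by omega)
        · rw [hb.lie_one_last j h h3]; exact Submodule.zero_mem _
      · exact flag_anti b (by omega) (hb.lie_mem i j h1 (by omega) (by omega) h3)
    rw [hz]
    obtain hi | hi | hi : i = 1 ∨ i = 2 ∨ 2 < i := by omega
    · subst hi
      rw [hf0 1 le_rfl (by omega) (by omega), zero_lie, zero_add]
      rcases eq_or_ne j 2 with rfl | hj
      · rw [hf2, hb.lie_one_last _ (by omega) (by omega)]
      · rw [hf0 j (by omega) h3 hj, lie_zero]
    · subst hi
      rw [hf2, hf0 j (by omega) h3 (by omega), lie_zero, add_zero,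
        hb.lie_eq_zero _ _ (by omega) (by omega) (by omega) (by omega) (by omega)]
    · rw [hf0 i h1 (by omega) (by omega), hf0 j (by omega) h3 (by omega), lie_zero, zero_lie,
        add_zero]
  exact ⟨h, by rw [hh, hf2], fun j h1 h2 h3 => by rw [hh, hf0 j h1 h2 h3]⟩

/-- Brackets with Y_2 only involve Y_3 and Y_n, and n - 1 is neither 3 nor n. The multiple of Y_2
stands for the action of a torus element; with `c = 0` the statement says that Y_2 ↦ Y_{n-1} is not
inner. -/
theorem IsHeisenbergExtension.lie_two_add_smul_ne (hb : IsHeisenbergExtension b) (x : L) (c : ℂ) :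
    bvec b (n - 1) ≠ ⁅x, bvec b 2⁆ + c • bvec b 2 := by
  have hn := hb.six_le
  intro h
  have h0 : bco b (n - 1) ⁅bvec b 2, x⁆ = 0 := by
    have : (⊤ : Submodule ℂ L) ≤
        (LinearMap.ker (bco b (n - 1))).comap (LieAlgebra.ad ℂ L (bvec b 2) : L →ₗ[ℂ] L) := by
      intro x _
      refine eq_top_of_bvec_mem b (fun j h1 h2 => ?_) x
      change bco b (n - 1) ⁅bvec b 2, bvec b j⁆ = 0
      rcases h1.eq_or_lt with rfl | h1
      · rw [← lie_skew, hb.lie_one 2 le_rfl (by omega), map_neg, bco_bvec_of_ne b (by omega),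
          neg_zero]
      · exact hb.lie_mem 2 j le_rfl (by omega) h1 h2 _ (by omega)
    exact this (Submodule.mem_top (x := x))
  have h1 := congrArg (bco b (n - 1)) h
  rw [map_add, map_smul, ← lie_skew, map_neg, h0, bco_bvec_self b (by omega) (by omega),
    bco_bvec_of_ne b (by omega), neg_zero, smul_zero, add_zero] at h1
  exact one_ne_zero h1

/-- Equal weights on Y_2 and Y_{n-1} are what makes the outer derivation Y_2 ↦ Y_{n-1} commute with
the torus. -/
theorem IsHeisenbergExtension.not_isCompleteLie (hb : IsHeisenbergExtension b)
    {t : LieSubalgebra ℂ (LieDerivation ℂ L L)} (ht : IsTorus t)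
    (hdiag : ∀ s ∈ t, ∃ u : ℕ → ℂ, u 2 = u (n - 1) ∧
      ∀ j, 1 ≤ j → j ≤ n → s (bvec b j) = u j • bvec b j) :
    ¬ IsCompleteLie (TorusExtension t) := by
  have hn := hb.six_le
  obtain ⟨h, h2, h0⟩ := hb.exists_derivation
  refine not_isCompleteLie_torusExtension ht h (fun s hs => ?_) (fun x s hs hx => ?_)
  · obtain ⟨u, hu, hsu⟩ := hdiag s hs
    have : (h : L →ₗ[ℂ] L) ∘ₗ (s : L →ₗ[ℂ] L) = (s : L →ₗ[ℂ] L) ∘ₗ (h : L →ₗ[ℂ] L) := by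
      refine linearMap_ext_bvec b fun j h3 h4 => ?_
      simp only [LinearMap.comp_apply, LieDerivation.coeFn_coe]
      rw [hsu j h3 h4, map_smul]
      rcases eq_or_ne j 2 with rfl | hj
      · rw [h2, hsu (n - 1) (by omega) (by omega), hu]
      · rw [h0 j h3 h4 hj, smul_zero, map_zero]
    exact LinearMap.congr_fun this
  · obtain ⟨u, -, hsu⟩ := hdiag s hs
    have := hx (bvec b 2)
    rw [h2, hsu 2 (by omega) (by omega)] at this
    exact hb.lie_two_add_smul_ne x _ this

/-- The line spanned by a semisimple derivation, as a subalgebra. -/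
def lineSubalgebra (D : LieDerivation ℂ L L) : LieSubalgebra ℂ (LieDerivation ℂ L L) where
  toSubmodule := Submodule.span ℂ {D}
  lie_mem' := by
    intro E F hE hF
    obtain ⟨x, rfl⟩ := Submodule.mem_span_singleton.mp hE
    obtain ⟨y, rfl⟩ := Submodule.mem_span_singleton.mp hF
    rw [smul_lie, lie_smul, lie_self, smul_zero, smul_zero]
    exact Submodule.zero_mem _

theorem mem_lineSubalgebra {D E : LieDerivation ℂ L L} :
    E ∈ lineSubalgebra D ↔ ∃ c : ℂ, c • D = E := Submodule.mem_span_singleton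

theorem isTorus_lineSubalgebra {D : LieDerivation ℂ L L}
    (hD : Module.End.IsSemisimple (D : L →ₗ[ℂ] L)) : IsTorus (lineSubalgebra D) := by
  refine ⟨⟨fun E F => Subtype.ext ?_⟩, fun E hE => ?_⟩
  · obtain ⟨x, hx⟩ := mem_lineSubalgebra.mp E.2
    obtain ⟨y, hy⟩ := mem_lineSubalgebra.mp F.2
    rw [LieSubalgebra.coe_bracket, ← hx, ← hy, smul_lie, lie_smul, lie_self, smul_zero, smul_zero]
    rfl
  · obtain ⟨x, rfl⟩ := mem_lineSubalgebra.mp hE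
    exact Module.End.IsSemisimple_smul x hD

theorem bco_lie_tableC (m : ℕ) (lam : ℕ → ℂ) (i j l : ℕ) (h1 : 1 ≤ i) (h2 : i < j)
    (h3 : j ≤ 2 * m + 2) (h4 : 1 ≤ l) (h5 : l ≤ 2 * m + 2) :
    bco (tableBasis (isLieTable_tableC m lam)) l ⁅bvec (tableBasis (isLieTable_tableC m lam)) i,
        bvec (tableBasis (isLieTable_tableC m lam)) j⁆ =
      if i = 1 then (if l = j + 1 ∧ l < 2 * m + 2 then 1 else 0)
      else if l = 2 * m + 2 then formC m lam i j else 0 := by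
  obtain ⟨i, rfl⟩ := Nat.exists_eq_add_of_le' h1
  obtain ⟨j, rfl⟩ := Nat.exists_eq_add_of_le' (h1.trans h2.le)
  obtain ⟨l, rfl⟩ := Nat.exists_eq_add_of_le' h4
  rw [bvec_fin _ ⟨i, by omega⟩, bvec_fin _ ⟨j, by omega⟩, bco_fin _ ⟨l, by omega⟩,
    Basis.coord_apply, repr_lie_tableBasis]
  by_cases hi : i = 0
  · subst hi
    rw [tableC_zero_left _ _ _ _ _ rfl (by simp; omega)]
    simp
  · rw [tableC_of_ne _ _ _ _ _ hi (by simp; omega)]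
    simp [hi]

theorem isHeisenbergExtension_tableC (m : ℕ) (hm : 2 ≤ m) (lam : ℕ → ℂ) :
    IsHeisenbergExtension (tableBasis (isLieTable_tableC m lam)) := by
  set b := tableBasis (isLieTable_tableC m lam)
  have hlie := bco_lie_tableC m lam
  have hself : ∀ i j, 2 ≤ i → i < j → j ≤ 2 * m + 2 → ⁅bvec b i, bvec b j⁆ ∈ flag b (2 * m + 2) := by
    intro i j h1 h2 h3 l hl
    rcases Nat.eq_zero_or_pos l with rfl | hl0
    · rw [bco_zero]; rfl
    · rw [hlie i j l (by omega) h2 h3 hl0 (by omega), if_neg (by omega), if_neg (by omega)]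
  have hzero : ∀ i j, 2 ≤ i → i < j → j ≤ 2 * m + 2 → 2 * m + 2 + 2 ≤ i + j →
      ⁅bvec b i, bvec b j⁆ = 0 := by
    intro i j h1 h2 h3 h4
    rw [eq_smul_bvec_last b (hself i j h1 h2 h3),
      hlie i j _ (by omega) h2 h3 (by omega) (by omega), if_neg (by omega), if_pos rfl,
      formC_eq_zero _ _ _ _ (by omega), zero_smul]
  refine ⟨by omega, fun j h1 h2 => ?_, fun j h1 h2 => ?_, fun i j h1 h2 h3 h4 => ?_,
    fun i j h1 h2 h3 h4 h5 => ?_⟩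
  · refine bco_ext b fun l h3 h4 => ?_
    rw [hlie 1 j l le_rfl h1 (by omega) h3 h4, if_pos rfl]
    split_ifs with h
    · rw [← h.1, bco_bvec_self b h3 h4]
    · rw [bco_bvec_of_ne b (by omega)]
  · refine bco_ext b fun l h3 h4 => ?_
    rw [hlie 1 j l le_rfl (by omega) (by omega) h3 h4, if_pos rfl, if_neg (by omega), map_zero]
  · rcases lt_trichotomy i j with h | rfl | h
    · exact hself i j h1 h h4
    · rw [lie_self]; exact Submodule.zero_mem _
    · exact lie_mem_comm (hself j i h3 h h2)
  · rcases lt_trichotomy i j with h | rfl | h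
    · exact hzero i j h1 h h4 h5
    · exact lie_self _
    · rw [← lie_skew, hzero j i h3 h h2 (by omega), neg_zero]

/-- The weights `(0, 1, …, 1, 2)`. -/
def weightC (m j : ℕ) : ℂ := if j = 1 then 0 else if j = 2 * m + 2 then 2 else 1

theorem exists_weight_derivation_tableC (m : ℕ) (lam : ℕ → ℂ) :
    ∃ f : LieDerivation ℂ (AlgebraC m lam) (AlgebraC m lam), ∀ j, 1 ≤ j → j ≤ 2 * m + 2 →
      f (bvec (tableBasis (isLieTable_tableC m lam)) j) =
        weightC m j • bvec (tableBasis (isLieTable_tableC m lam)) j := by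
  refine exists_diagonal_derivation _ (weightC m) fun i j l h1 h2 h3 h4 h5 h0 => ?_
  rw [bco_lie_tableC m lam i j l h1 h2 h3 h4 h5] at h0
  split_ifs at h0 with h6 h7 h7
  · unfold weightC
    rw [if_pos h6, if_neg (by omega), if_neg (by omega), if_neg (by omega), if_neg (by omega),
      zero_add]
  · exact absurd rfl h0
  -- With i ≥ 2 this excludes index n for both vectors, so both have weight 1 and the weights sum to
  -- 2.
  · have h8 : i + j ≤ 2 * m + 3 := by
      by_contra h
      exact h0 (formC_eq_zero _ _ _ _ (by omega))
    unfold weightC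
    rw [if_neg (by omega), if_pos h7, if_neg h6, if_neg (by omega), if_neg (by omega),
      if_neg (by omega)]
    norm_num
  · exact absurd rfl h0

theorem familyC_weight_derivation (m : ℕ) (lam : ℕ → ℂ) (hm : 2 ≤ m) :
    ∃ (f : LieDerivation ℂ (AlgebraC m lam) (AlgebraC m lam))
      (t : LieSubalgebra ℂ (LieDerivation ℂ (AlgebraC m lam) (AlgebraC m lam))),
      f (vecC m lam 1) = 0 ∧
      (∀ j, 2 ≤ j → j ≤ 2 * m + 1 → f (vecC m lam j) = vecC m lam j) ∧
      f (vecC m lam (2 * m + 2)) = (2 : ℂ) • vecC m lam (2 * m + 2) ∧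
      t.toSubmodule = Submodule.span ℂ {f} ∧ IsTorus t ∧ weightSpace t 0 ≠ ⊥ ∧
      ¬ IsCompleteLie (TorusExtension t) := by
  obtain ⟨f, hf⟩ := exists_weight_derivation_tableC m lam
  set b := tableBasis (isLieTable_tableC m lam) with hb
  have hvec : ∀ j, 1 ≤ j → j ≤ 2 * m + 2 → vecC m lam j = bvec b j := fun j h1 h2 =>
    (bvec_tableBasis _ h1 h2).symm
  have hf1 : f (bvec b 1) = 0 := by
    rw [hf 1 le_rfl (by omega), weightC, if_pos rfl, zero_smul]
  have ht : IsTorus (lineSubalgebra f) := by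
    refine isTorus_lineSubalgebra (isSemisimple_of_basis b (fun i => weightC m (i + 1)) _ fun i => ?_)
    have := i.isLt
    rw [← bvec_fin, LieDerivation.coeFn_coe, hf _ (by omega) (by omega)]
  refine ⟨f, lineSubalgebra f, ?_, fun j h1 h2 => ?_, ?_, rfl, ht, fun h => ?_, ?_⟩
  · rw [hvec 1 le_rfl (by omega), hf1]
  · rw [hvec j (by omega) (by omega), hf j (by omega) (by omega), weightC, if_neg (by omega),
      if_neg (by omega), one_smul]
  · rw [hvec _ (by omega) (by omega), hf _ (by omega) (by omega), weightC, if_neg (by omega),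
      if_pos rfl]
  · have h1 : bvec b 1 ∈ weightSpace (lineSubalgebra f) 0 := by
      intro s
      obtain ⟨c, hc⟩ := mem_lineSubalgebra.mp s.2
      rw [← hc, LieDerivation.smul_apply, hf1, smul_zero, LinearMap.zero_apply, zero_smul]
    rw [h] at h1
    exact bvec_ne_zero b le_rfl (by omega) ((Submodule.mem_bot ℂ).mp h1)
  · refine (isHeisenbergExtension_tableC m hm lam).not_isCompleteLie ht fun s hs => ?_
    obtain ⟨c, rfl⟩ := mem_lineSubalgebra.mp hs
    refine ⟨fun j => c * weightC m j, ?_, fun j h1 h2 => ?_⟩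
    · simp only [weightC]
      rw [if_neg (by omega), if_neg (by omega), if_neg (by omega), if_neg (by omega)]
    · rw [LieDerivation.smul_apply, hf j h1 h2, smul_smul]

theorem familyC_outer_derivation (m : ℕ) (lam : ℕ → ℂ) (hm : 2 ≤ m) :
    ∃ h : LieDerivation ℂ (AlgebraC m lam) (AlgebraC m lam),
      h (vecC m lam 2) = vecC m lam (2 * m + 1) ∧
      (∀ j, 1 ≤ j → j ≤ 2 * m + 2 → j ≠ 2 → h (vecC m lam j) = 0) ∧
      ¬ ∃ x : AlgebraC m lam, ∀ y : AlgebraC m lam, h y = ⁅x, y⁆ := by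
  have hb := isHeisenbergExtension_tableC m hm lam
  obtain ⟨h, h2, h0⟩ := hb.exists_derivation
  have hvec : ∀ j, 1 ≤ j → j ≤ 2 * m + 2 → vecC m lam j =
      bvec (tableBasis (isLieTable_tableC m lam)) j := fun j h1 h2 =>
    (bvec_tableBasis _ h1 h2).symm
  refine ⟨h, ?_, fun j h1 h2 h3 => ?_, ?_⟩
  · rw [hvec 2 (by omega) (by omega), hvec _ (by omega) (by omega), h2]; rfl
  · rw [hvec j h1 h2, h0 j h1 h2 h3]
  · rintro ⟨x, hx⟩
    refine hb.lie_two_add_smul_ne x 0 ?_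
    rw [zero_smul, add_zero, ← h2, hx]

end FamilyC

/-! ### Chain bases of filiform Lie algebras -/

section Chain

variable {L : Type*} [LieRing L] [LieAlgebra ℂ L]

/-- `Y₂, …, Y_n` is a chain for `ad Y₁`. -/
def IsChainBasis {n : ℕ} (b : Basis (Fin n) ℂ L) : Prop :=
  ∀ j, 2 ≤ j → j ≤ n → ⁅bvec b 1, bvec b j⁆ = bvec b (j + 1)

/-- Needed besides `exists_basis_of_triangular` for changes such as Y_2 - cY_1, which do not respect
the flag. -/
theorem exists_basis_of_span {V : Type*} [AddCommGroup V] [Module ℂ V] {n : ℕ}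
    (b : Basis (Fin n) ℂ V) (X : ℕ → V)
    (hX : ∀ P : Submodule ℂ V, (∀ j, 1 ≤ j → j ≤ n → X j ∈ P) → ∀ j, 1 ≤ j → j ≤ n →
      bvec b j ∈ P) :
    ∃ b' : Basis (Fin n) ℂ V, ∀ i, 1 ≤ i → i ≤ n → bvec b' i = X i := by
  have hspan : ⊤ ≤ Submodule.span ℂ (Set.range fun i : Fin n => X (i + 1)) := by
    intro x _
    refine eq_top_of_bvec_mem b (hX _ fun j h1 h2 => ?_) x
    exact Submodule.subset_span ⟨⟨j - 1, by omega⟩, by simp [Nat.sub_add_cancel h1]⟩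
  have hcard : Fintype.card (Fin n) = finrank ℂ V := by
    rw [finrank_eq_card_basis b]
  refine ⟨basisOfTopLeSpanOfCardEqFinrank _ hspan hcard, fun i h1 h2 => ?_⟩
  obtain ⟨i, rfl⟩ := Nat.exists_eq_add_of_le' h1
  rw [bvec_fin _ ⟨i, by omega⟩, coe_basisOfTopLeSpanOfCardEqFinrank]

/-- An endomorphism with Jordan sequence `(r, 1)` in an ordered basis. -/
theorem IsJordanSequence.exists_basis {V : Type*} [AddCommGroup V] [Module ℂ V]
    {T : Module.End ℂ V} {r : ℕ} (h : IsJordanSequence T [r, 1]) :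
    1 ≤ r ∧ ∃ b : Basis (Fin (r + 1)) ℂ V, T (bvec b 1) = 0 ∧
      ∀ j, 2 ≤ j → j ≤ r + 1 → T (bvec b j) = bvec b (j + 1) := by
  obtain ⟨-, hpos, bb, hb⟩ := h
  -- The block of size one is listed first and becomes Y_1; the block of size `r` follows as the
  -- chain.
  let f : Fin (r + 1) → ((i : Fin [r, 1].length) × Fin ([r, 1].get i)) :=
    Fin.cons ⟨⟨1, by simp⟩, ⟨0, by simp⟩⟩ fun j => ⟨⟨0, by simp⟩, ⟨j, by simp⟩⟩
  have hf : Function.Bijective f := by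
    constructor
    · intro i j hij
      induction i using Fin.cases with
      | zero =>
        induction j using Fin.cases with
        | zero => rfl
        | succ j => simp [f] at hij
      | succ i =>
        induction j using Fin.cases with
        | zero => simp [f] at hij
        | succ j =>
          simp only [f, Fin.cons_succ, Sigma.mk.injEq, heq_eq_eq, Fin.mk.injEq, true_and] at hij
          rw [Fin.ext hij]
    · rintro ⟨⟨i, hi⟩, ⟨j, hj⟩⟩
      obtain rfl | rfl : i = 0 ∨ i = 1 := by simp at hi; omega
      · exact ⟨Fin.succ ⟨j, by simpa using hj⟩, rfl⟩
      · obtain rfl : j = 0 := by simpa using hj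
        exact ⟨0, rfl⟩
  let b : Basis (Fin (r + 1)) ℂ V := bb.reindex (Equiv.ofBijective f hf).symm
  have hbf : ∀ i, b i = bb (f i) := fun i => by simp [b]
  refine ⟨hpos r (by simp), b, ?_, fun j h1 h2 => ?_⟩
  · have e : bvec b 1 = bb ⟨⟨1, by simp⟩, ⟨0, by simp⟩⟩ := (bvec_fin b 0).trans (hbf 0)
    rw [e, hb, dif_neg (by simp)]
  · obtain ⟨j, rfl⟩ := Nat.exists_eq_add_of_le' h1
    have e : ∀ j (hj : j < r), bvec b (j + 2) = bb ⟨⟨0, by simp⟩, ⟨j, by simpa using hj⟩⟩ := by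
      intro j hj
      rw [show j + 2 = ((Fin.succ ⟨j, hj⟩ : Fin (r + 1)) : ℕ) + 1 by simp, bvec_fin, hbf]
      rfl
    rw [e j (by omega), hb]
    split_ifs with h
    · rw [show j + 2 + 1 = j + 1 + 2 by ring, e (j + 1) (by simpa using h)]
    · rw [bvec_of_lt b (by simp at h; omega)]

/-- In a Jordan basis of ad Y the element Y itself should replace the vector of the block of size
one. This works if Y has a nonzero coordinate there. Otherwise [Y, Y] = 0 makes Y a multiple of the
end of the long block, which lies in the derived algebra unless that block has size one; in that
case the algebra is abelian of dimension two. -/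
theorem IsFiliform.exists_isChainBasis (h : IsFiliform L) :
    ∃ (n : ℕ) (b : Basis (Fin n) ℂ L), 2 ≤ n ∧ IsChainBasis b := by
  obtain ⟨-, -, ⟨Y, hY, hJ⟩, -⟩ := h
  generalize finrank ℂ L - 1 = r at hJ
  obtain ⟨hr, b, hb1, hb⟩ := hJ.exists_basis
  simp only [LieAlgebra.ad_apply] at hb1 hb
  by_cases h0 : bco b 1 Y = 0
  · -- then `Y` is a multiple of the last vector, whence `r = 1`
    have hY2 : Y ∈ flag b 2 := mem_flag_succ b (mem_flag_one b Y) h0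
    -- On the span of the chain, ad Y shifts coordinates. Applied to x = Y, this kills all
    -- coordinates of Y but the last.
    have hco : ∀ x ∈ flag b 2, ∀ j, 2 ≤ j → j ≤ r → bco b (j + 1) ⁅Y, x⁆ = bco b j x := by
      intro x hx j h1 h2
      have : flag b 2 ≤ LinearMap.ker (bco b (j + 1) ∘ₗ (LieAlgebra.ad ℂ L Y : L →ₗ[ℂ] L) -
          bco b j) := by
        refine flag_le b fun p h3 h4 h5 => ?_
        rw [LinearMap.mem_ker, LinearMap.sub_apply, LinearMap.comp_apply, LieAlgebra.ad_apply,
          hb p h3 h5, sub_eq_zero]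
        rcases eq_or_ne j p with rfl | hjp
        · rw [bco_bvec_self b (by omega) (by omega), bco_bvec_self b (by omega) (by omega)]
        · rw [bco_bvec_of_ne b hjp, bco_bvec_of_ne b (by omega)]
      exact sub_eq_zero.mp (this hx)
    have hYlast : Y ∈ flag b (r + 1) := by
      intro j hj
      rcases lt_or_ge j 2 with h | h
      · exact hY2 j h
      · rw [← hco Y hY2 j h (by omega), lie_self, map_zero]
    have hY' := eq_smul_bvec_last b hYlast
    have hr1 : r = 1 := by
      by_contra hr1
      refine hY ?_
      rw [hY', show bvec b (r + 1) = ⁅Y, bvec b r⁆ from (hb r (by omega) (by omega)).symm]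
      exact Submodule.smul_mem _ _
        (LieSubmodule.lie_mem_lie (LieSubmodule.mem_top Y) (LieSubmodule.mem_top _))
    have hY0 : bco b (r + 1) Y ≠ 0 := by
      intro h
      rw [h, zero_smul] at hY'
      exact hY (hY' ▸ Submodule.zero_mem _)
    refine ⟨r + 1, b, by omega, fun j h1 h2 => ?_⟩
    obtain rfl : j = r + 1 := by omega
    rw [hY', smul_lie, smul_eq_zero] at hb1
    rw [← lie_skew, hb1.resolve_left hY0, neg_zero, bvec_of_lt b (by omega)]
  · obtain ⟨b', hb', -⟩ := exists_basis_of_triangular b (fun i => if i = 1 then Y else bvec b i)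
      (fun i h1 h2 => by
        split_ifs with h
        · exact h ▸ mem_flag_one b Y
        · exact bvec_mem_flag b le_rfl)
      (fun i h1 h2 => by
        split_ifs with h
        · exact h ▸ h0
        · rw [bco_bvec_self b h1 h2]; exact one_ne_zero)
    refine ⟨r + 1, b', by omega, fun j h1 h2 => ?_⟩
    rw [hb' 1 le_rfl (by omega), hb' j (by omega) h2, if_pos rfl, if_neg (by omega), hb j h1 h2]
    rcases h2.eq_or_lt with rfl | h2
    · rw [bvec_of_lt b (by omega), bvec_of_lt b' (by omega)]
    · rw [hb' (j + 1) (by omega) (by omega), if_neg (by omega)]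

variable {n : ℕ} {b : Basis (Fin n) ℂ L}

/-- A repetition in the lower central series makes it constant from there on, and nilpotency makes
the constant zero. -/
theorem lowerCentralSeries_eq_bot_of_le [LieRing.IsNilpotent L] {k : ℕ}
    (h : LieModule.lowerCentralSeries ℂ L L k ≤ LieModule.lowerCentralSeries ℂ L L (k + 1)) :
    LieModule.lowerCentralSeries ℂ L L k = ⊥ := by
  have key : ∀ m, LieModule.lowerCentralSeries ℂ L L k ≤
      LieModule.lowerCentralSeries ℂ L L (k + m) := by
    intro m
    induction m with
    | zero => exact le_rfl
    | succ m ih =>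
      refine h.trans ?_
      rw [← add_assoc, LieModule.lowerCentralSeries_succ, LieModule.lowerCentralSeries_succ]
      exact LieSubmodule.mono_lie_right _ ih
  obtain ⟨m, hm⟩ := LieModule.IsNilpotent.nilpotent ℂ L L
  rw [eq_bot_iff, ← hm]
  exact (key m).trans (LieModule.antitone_lowerCentralSeries ℂ L L (Nat.le_add_left m k))

/-- In a nilpotent algebra the flag of a chain basis is given by the lower central series. -/
theorem IsChainBasis.isCentralFlag (hb : IsChainBasis b) (hL : LieRing.IsNilpotent L) :
    IsCentralFlag b := by
  set C : ℕ → Submodule ℂ L := fun k => (LieModule.lowerCentralSeries ℂ L L k).toSubmodule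
    with hC
  have hsucc : ∀ k (x y : L), y ∈ C k → ⁅x, y⁆ ∈ C (k + 1) := by
    intro k x y hy
    change _ ∈ LieModule.lowerCentralSeries ℂ L L (k + 1)
    rw [LieModule.lowerCentralSeries_succ]
    exact LieSubmodule.lie_mem_lie (LieSubmodule.mem_top x) hy
  have hsucc_le : ∀ k (P : Submodule ℂ L), (∀ x y : L, y ∈ C k → ⁅x, y⁆ ∈ P) → C (k + 1) ≤ P := by
    intro k P hP
    change (LieModule.lowerCentralSeries ℂ L L (k + 1)).toSubmodule ≤ P
    rw [LieModule.lowerCentralSeries_succ, LieSubmodule.lieIdeal_oper_eq_linear_span',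
      Submodule.span_le]
    rintro _ ⟨x, -, y, hy, rfl⟩
    exact hP x y hy
  have hbot : ∀ k, C k ≤ C (k + 1) → ∀ x ∈ C k, x = 0 := by
    intro k hk x hx
    have := lowerCentralSeries_eq_bot_of_le (L := L) (k := k) hk
    have hx' : x ∈ LieModule.lowerCentralSeries ℂ L L k := hx
    rwa [this, LieSubmodule.mem_bot] at hx'
  have hanti : ∀ k m, k ≤ m → C m ≤ C k := fun k m h =>
    LieModule.antitone_lowerCentralSeries ℂ L L h
  have htop : ∀ x, x ∈ C 0 := fun x => by
    change x ∈ LieModule.lowerCentralSeries ℂ L L 0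
    rw [LieModule.lowerCentralSeries_zero]
    exact LieSubmodule.mem_top x
  have hvec : ∀ k, k + 2 ≤ n → bvec b (k + 2) ∈ C k := by
    intro k
    induction k with
    | zero => exact fun _ => htop _
    | succ k ih =>
      intro hk
      have := hsucc k (bvec b 1) _ (ih (by omega))
      rwa [hb (k + 2) (by omega) (by omega)] at this
  have hflag : ∀ k, flag b (k + 2) ≤ C k := fun k => flag_le b fun j h1 h2 h3 => by
    obtain ⟨j, rfl⟩ := Nat.exists_eq_add_of_le' (show 2 ≤ j by omega)
    exact hanti k j (by omega) (hvec j h3)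
  -- An element of `C k` outside this term would put the next chain vector one step deeper in the
  -- series than its index. Then `C k ≤ C (k + 1)`, so `C k = 0` by nilpotency, a contradiction.
  have hle : ∀ k, 1 ≤ k → C k ≤ flag b (k + 2) := by
    intro k hk
    induction k, hk using Nat.le_induction with
    | base =>
      intro z hz
      by_contra hz3
      have h1 := sub_mem_flag b (mem_flag_one b z)
      have h2 := hflag 1 (sub_mem_flag b h1)
      set p := bco b 1 z
      set q := bco b (1 + 1) (z - p • bvec b 1)
      -- Modulo the third term of the flag the offending element is pY_1 + qY_2 ≠ 0; bracketing it
      -- with Y_1 or Y_2 yields a nonzero multiple of Y_3.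
      have h3 : ⁅bvec b 1, bvec b 2⁆ ∈ C 2 := by
        by_cases hq : q = 0
        · have hp : p ≠ 0 := by
            intro hp
            refine hz3 (mem_flag_succ b (mem_flag_succ b (mem_flag_one b z) hp) ?_)
            rw [← hq]
            simp only [q, hp, zero_smul, sub_zero]
          rw [hq, zero_smul, sub_zero] at h2
          have h4 := Submodule.sub_mem _ hz h2
          rw [sub_sub_cancel] at h4
          have h5 := lie_mem_comm (hsucc 1 (bvec b 2) _ ((C 1).smul_mem_iff hp |>.mp h4))
          exact h5
        · have h4 := Submodule.sub_mem _ hz h2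
          rw [sub_sub, sub_sub_cancel] at h4
          have h5 := hsucc 1 (bvec b 1) _ h4
          rw [lie_add, lie_smul, lie_self, smul_zero, zero_add, lie_smul] at h5
          exact ((C 2).smul_mem_iff hq).mp h5
      have h4 : C 1 ≤ C 2 := by
        refine hsucc_le 0 _ fun x y _ => ?_
        have h5 : ∀ p q, 1 ≤ p → p < q → q ≤ n → ⁅bvec b p, bvec b q⁆ ∈ C 2 := by
          intro p q h6 h7 h8
          obtain rfl | hq : q = 2 ∨ 3 ≤ q := by omega
          · obtain rfl : p = 1 := by omega
            exact h3
          · exact hsucc 1 _ _ (hflag 1 (bvec_mem_flag b hq))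
        refine lie_mem_of_flag_flag b (fun p q _ h1 h2 _ h3 h4 => ?_) (mem_flag_one b x)
          (mem_flag_one b y)
        rcases lt_trichotomy p q with h | rfl | h
        · exact h5 p q h1 h h4
        · rw [lie_self]; exact Submodule.zero_mem _
        · exact lie_mem_comm (h5 q p h3 h h2)
      exact hz3 (hbot 1 h4 z hz ▸ Submodule.zero_mem _)
    | succ k hk ih =>
      intro z hz
      have hz2 := ih (hanti k (k + 1) (Nat.le_succ k) hz)
      by_cases h0 : bco b (k + 2) z = 0
      · exact mem_flag_succ b hz2 h0
      · have h1 := Submodule.sub_mem _ hz (hflag (k + 1) (sub_mem_flag b hz2))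
        rw [sub_sub_cancel] at h1
        have h2 := ((C (k + 1)).smul_mem_iff h0).mp h1
        have h3 : C k ≤ C (k + 1) := by
          refine ih.trans (flag_le b fun j h4 h5 h6 => ?_)
          rcases h4.eq_or_lt with rfl | h4
          · exact h2
          · exact hflag (k + 1) (bvec_mem_flag b (by omega))
        rw [hbot k h3 z (hanti k (k + 1) (Nat.le_succ k) hz)]
        exact Submodule.zero_mem _
  refine ⟨fun i j _ _ _ => hle 1 le_rfl (hsucc 0 _ _ (htop _)), fun i j _ _ h1 h2 => ?_,
    fun i h1 h2 => ⟨1, 1, one_ne_zero, by rw [hb i h1 h2.le, one_smul]⟩⟩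
  obtain ⟨j, rfl⟩ := Nat.exists_eq_add_of_le' (show 2 ≤ j by omega)
  have := hle (j + 1) (by omega) (hsucc j (bvec b i) _ (hvec j h2))
  exact this

end Chain

/-! ### Vergne's normal form -/

/-- The structure constants of the graded algebra of a filiform algebra vanish off the chain,
except possibly in the last degree. -/
theorem graded_constants_eq_zero (n : ℕ) (c : ℕ → ℕ → ℂ) (hskew : ∀ i j, c i j = -c j i)
    (h1 : ∀ i j, 2 ≤ i → 2 ≤ j → i + j ≤ n → c i j = c (i + 1) j + c i (j + 1))
    (h2 : ∀ i j, 2 ≤ i → 2 ≤ j → i + j ≤ n →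
      c i j * c 2 (i + j - 1) = c 2 i * c (i + 1) j + c 2 j * c i (j + 1))
    (h23 : c 2 3 = 0) (i j : ℕ) (hi : 2 ≤ i) (hj : 2 ≤ j) (hij : i + j ≤ n) : c i j = 0 := by
  have hself : ∀ i, c i i = 0 := fun i => self_eq_neg.mp (hskew i i)
  induction hs : i + j using Nat.strong_induction_on generalizing i j with
  | _ s ih =>
  -- Since the constants with index sum s - 1 vanish, `h1` makes those with sum s alternate in sign.
  have hg : ∀ a, a + 4 ≤ s → c (2 + a) (s - 2 - a) = (-1) ^ a * c 2 (s - 2) := by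
    intro a
    induction a with
    | zero => intro _; simp
    | succ a iha =>
      intro ha
      have e1 := h1 (2 + a) (s - 3 - a) (by omega) (by omega) (by omega)
      rw [ih (s - 1) (by omega) (2 + a) (s - 3 - a) (by omega) (by omega) (by omega) (by omega),
        show s - 3 - a + 1 = s - 2 - a by omega, iha (by omega),
        show s - 3 - a = s - 2 - (a + 1) by omega] at e1
      rw [show 2 + (a + 1) = 2 + a + 1 by ring, pow_succ]
      linear_combination -e1
  suffices h0 : c 2 (s - 2) = 0 by
    have := hg (i - 2) (by omega)
    rwa [h0, mul_zero, show 2 + (i - 2) = i by omega, show s - 2 - (i - 2) = j by omega] at this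
  rcases Nat.even_or_odd' s with ⟨r, rfl | rfl⟩
  -- For even s the alternation passes through the diagonal entry c r r = 0.
  · have := hg (r - 2) (by omega)
    rw [show 2 + (r - 2) = r by omega, show 2 * r - 2 - (r - 2) = r by omega, hself] at this
    exact (mul_eq_zero.mp this.symm).resolve_left (pow_ne_zero _ (by norm_num))
  · obtain rfl | hr : r = 2 ∨ 3 ≤ r := by omega
    · exact h23
    have hr' : 2 * r + 1 - 2 = 2 * r - 1 := by omega
    simp only [hr'] at hg ⊢
    -- For odd s = 2r + 1 look at index sum s + 1, where `h1` gives an arithmetic progression. Its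
    -- diagonal entry vanishes, so c 2 (2r) = (r - 1) c 2 (2r - 1).
    have hh : ∀ a, a + 2 ≤ 2 * r → (-1) ^ a * c (2 + a) (2 * r - a) =
        c 2 (2 * r) - a * c 2 (2 * r - 1) := by
      intro a
      induction a with
      | zero => intro _; simp
      | succ a iha =>
        intro ha
        have e1 := h1 (2 + a) (2 * r - 1 - a) (by omega) (by omega) (by omega)
        have e2 := hg a (by omega)
        rw [show 2 * r - 1 - a + 1 = 2 * r - a by omega, e2] at e1
        have e3 := iha (by omega)
        have e4 : ((-1 : ℂ)) ^ a * (-1) ^ a = 1 := by rw [← mul_pow]; norm_num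
        rw [show 2 * r - (a + 1) = 2 * r - 1 - a by omega, show 2 + (a + 1) = 2 + a + 1 by ring,
          pow_succ]
        push_cast
        linear_combination e3 + (-1) ^ a * e1 - c 2 (2 * r - 1) * e4
    have e1 := hh (r - 1) (by omega)
    rw [show 2 + (r - 1) = r + 1 by omega, show 2 * r - (r - 1) = r + 1 by omega, hself,
      mul_zero] at e1
    -- Jacobi with Y_2: the right-hand side vanishes by `h23` and induction, and since c 3 (2r - 2)
    -- = -c 2 (2r - 1) the left-hand side is -(r - 1) times the square of the wanted constant.
    have e2 := h2 3 (2 * r - 2) (by omega) (by omega) (by omega)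
    rw [h23, ih (2 * r) (by omega) 2 (2 * r - 2) (by omega) (by omega) (by omega) (by omega),
      zero_mul, zero_mul, add_zero, show 3 + (2 * r - 2) - 1 = 2 * r by omega] at e2
    have e3 := hg 1 (by omega)
    rw [show 2 * r - 1 - 1 = 2 * r - 2 by omega] at e3
    norm_num at e3
    have hr1 : ((r - 1 : ℕ) : ℂ) ≠ 0 := by exact_mod_cast (by omega : r - 1 ≠ 0)
    have e4 : ((r - 1 : ℕ) : ℂ) * (c 2 (2 * r - 1) * c 2 (2 * r - 1)) = 0 := by
      rw [e3] at e2
      have e5 : c 2 (2 * r) = ((r - 1 : ℕ) : ℂ) * c 2 (2 * r - 1) := by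
        linear_combination -e1
      rw [e5] at e2
      linear_combination -e2
    exact mul_self_eq_zero.mp ((mul_eq_zero.mp e4).resolve_left hr1)

section Normal

variable {L : Type*} [LieRing L] [LieAlgebra ℂ L] {n : ℕ} {b : Basis (Fin n) ℂ L}

/-- Induction on `i` through Y_{i+1} = [Y_1, Y_i] and the Jacobi identity. The index i + j - 1
expresses that Y_i has degree i - 1 in the filtration. -/
theorem lie_mem_flag_add_sub_one (hc : IsChainBasis b) (hb : IsCentralFlag b) (i j : ℕ)
    (hi : 2 ≤ i) (hi' : i ≤ n) (hj : 2 ≤ j) (hj' : j ≤ n) :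
    ⁅bvec b i, bvec b j⁆ ∈ flag b (i + j - 1) := by
  induction i, hi using Nat.le_induction generalizing j with
  | base =>
    rcases hj.eq_or_lt with rfl | hj
    · rw [lie_self]; exact Submodule.zero_mem _
    · exact flag_anti b (by omega) (hb.lie_mem_succ 2 j (by omega) hi' hj hj')
  | succ i hi ih =>
    have e : ⁅bvec b (i + 1), bvec b j⁆ =
        ⁅bvec b 1, ⁅bvec b i, bvec b j⁆⁆ - ⁅bvec b i, bvec b (j + 1)⁆ := by
      rw [← hc i hi (by omega), ← hc j hj hj', lie_lie]
    rw [e]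
    refine Submodule.sub_mem _ ?_ ?_
    · exact flag_anti b (by omega)
        (hb.lie_mem_flag_succ (bvec b 1) (by omega) (ih j (by omega) hj hj'))
    · rcases hj'.eq_or_lt with rfl | hj'
      · rw [bvec_of_lt b (Nat.lt_succ_self _), lie_zero]; exact Submodule.zero_mem _
      · exact flag_anti b (by omega) (ih (j + 1) (by omega) (by omega) hj')

theorem lie_flag_mem_flag (hc : IsChainBasis b) (hb : IsCentralFlag b) {i j : ℕ} (hi : 2 ≤ i)
    (hj : 2 ≤ j) {x y : L} (hx : x ∈ flag b i) (hy : y ∈ flag b j) :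
    ⁅x, y⁆ ∈ flag b (i + j - 1) :=
  lie_mem_of_flag_flag b (fun p q h1 _ h2 h3 _ h4 =>
    flag_anti b (by omega) (lie_mem_flag_add_sub_one hc hb p q (by omega) h2 (by omega) h4)) hx hy

/-- Replacing x and y by their leading terms changes the bracket only from index i + j on. This
makes the leading coefficients usable as constants of the associated graded algebra. -/
theorem bco_lie_of_mem_flag (hc : IsChainBasis b) (hb : IsCentralFlag b) {i j : ℕ} (hi : 2 ≤ i)
    (hj : 2 ≤ j) {x y : L} (hx : x ∈ flag b i) (hy : y ∈ flag b j) :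
    bco b (i + j - 1) ⁅x, y⁆ =
      bco b i x * bco b j y * bco b (i + j - 1) ⁅bvec b i, bvec b j⁆ := by
  have h1 := lie_flag_mem_flag hc hb (by omega) hj (sub_mem_flag b hx) hy (i + j - 1) (by omega)
  have h2 := lie_flag_mem_flag hc hb hi (by omega) (bvec_mem_flag b (le_refl i))
    (sub_mem_flag b hy) (i + j - 1) (by omega)
  simp only [sub_lie, lie_sub, smul_lie, lie_smul, map_sub, map_smul, smul_eq_mul] at h1 h2
  linear_combination h1 + bco b i x * h2

theorem bco_lie_one_of_mem_flag (hc : IsChainBasis b) (hb : IsCentralFlag b) {i : ℕ} (hi : 2 ≤ i)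
    (hin : i < n) {x : L} (hx : x ∈ flag b i) : bco b (i + 1) ⁅bvec b 1, x⁆ = bco b i x := by
  have h1 := hb.lie_mem_flag_succ (bvec b 1) (by omega) (sub_mem_flag b hx) (i + 1) (by omega)
  rw [lie_sub, lie_smul, hc i hi hin.le, map_sub, map_smul, bco_bvec_self b (by omega) hin,
    smul_eq_mul, mul_one, sub_eq_zero] at h1
  exact h1

/-- Vergne's theorem: for a suitably normalised chain basis, `[Y_i, Y_j]` lies in the span of the
`Y_l` with `l ≥ i + j`, for `i, j ≥ 2` and `i + j ≤ n`. -/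
theorem lie_mem_flag_add (hc : IsChainBasis b) (hb : IsCentralFlag b)
    (h23 : ⁅bvec b 2, bvec b 3⁆ ∈ flag b 5) (i j : ℕ) (hi : 2 ≤ i) (hj : 2 ≤ j) (hij : i + j ≤ n) :
    ⁅bvec b i, bvec b j⁆ ∈ flag b (i + j) := by
  have hmem := fun i j hi hi' hj hj' => lie_mem_flag_add_sub_one hc hb i j hi hi' hj hj'
  -- The two quadratic relations are the leading coefficients of the Jacobi identities with Y_1 and
  -- with Y_2.
  have key := graded_constants_eq_zero n (fun i j => bco b (i + j - 1) ⁅bvec b i, bvec b j⁆)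
    (fun i j => ?_) (fun i j hi hj hij => ?_) (fun i j hi hj hij => ?_) (h23 _ (by omega)) i j hi hj hij
  · have := mem_flag_succ b (hmem i j hi (by omega) hj (by omega)) key
    rwa [show i + j - 1 + 1 = i + j by omega] at this
  · rw [← lie_skew, map_neg, add_comm j i]
  · have e := bco_lie_one_of_mem_flag hc hb (i := i + j - 1) (by omega) (by omega)
      (hmem i j hi (by omega) hj (by omega))
    rw [leibniz_lie, hc i hi (by omega), hc j hj (by omega), map_add,
      show i + j - 1 + 1 = i + j by omega] at e
    rw [show i + 1 + j - 1 = i + j by omega, show i + (j + 1) - 1 = i + j by omega, e]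
  · have e := bco_lie_of_mem_flag hc hb (le_refl 2) (j := i + j - 1) (by omega)
      (bvec_mem_flag b (le_refl 2)) (hmem i j hi (by omega) hj (by omega))
    have e1 := bco_lie_of_mem_flag hc hb (i := i + 1) (by omega) hj
      (flag_anti b (by omega) (hmem 2 i le_rfl (by omega) hi (by omega)))
      (bvec_mem_flag b (le_refl j))
    have e2 := bco_lie_of_mem_flag hc hb hi (j := j + 1) (by omega) (bvec_mem_flag b (le_refl i))
      (flag_anti b (by omega) (hmem 2 j le_rfl (by omega) hj (by omega)))
    rw [leibniz_lie, map_add] at e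
    rw [bco_bvec_self b (by omega) (by omega)] at e e1 e2
    simp only [show 2 + (i + j - 1) - 1 = i + j by omega, show i + 1 + j - 1 = i + j by omega,
      show i + (j + 1) - 1 = i + j by omega, show 2 + i - 1 = i + 1 by omega,
      show 2 + j - 1 = j + 1 by omega] at e e1 e2 ⊢
    linear_combination -e + e1 + e2

/-- A chain basis can be normalised so that `[Y₂, Y₃]` has no component along `Y₄`. -/
theorem IsChainBasis.exists_normalised (hc : IsChainBasis b) (hb : IsCentralFlag b) (hn : 4 ≤ n) :
    ∃ b' : Basis (Fin n) ℂ L, IsChainBasis b' ∧ ⁅bvec b' 2, bvec b' 3⁆ ∈ flag b' 5 := by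
  set c := bco b 4 ⁅bvec b 2, bvec b 3⁆
  -- As [Y_1, Y_3] = Y_4, subtracting cY_1 from Y_2 removes cY_4 from [Y_2, Y_3], and [Y_1, Y_2]
  -- does not change.
  obtain ⟨b', hb'⟩ := exists_basis_of_span b
    (fun j => if j = 2 then bvec b 2 - c • bvec b 1 else bvec b j) fun P hP => by
      have h1 : bvec b 1 ∈ P := by simpa using hP 1 le_rfl (by omega)
      have h2 : bvec b 2 - c • bvec b 1 ∈ P := by simpa using hP 2 (by omega) (by omega)
      intro j hj1 hj2
      rcases eq_or_ne j 2 with rfl | hj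
      · have := P.add_mem h2 (P.smul_mem c h1)
        rwa [sub_add_cancel] at this
      · simpa [hj] using hP j hj1 hj2
  have h2 : bvec b' 2 = bvec b 2 - c • bvec b 1 := by
    rw [hb' 2 (by omega) (by omega), if_pos rfl]
  have h0 : ∀ j, j ≠ 2 → 1 ≤ j → bvec b' j = bvec b j := by
    intro j hj hj1
    rcases le_or_gt j n with h | h
    · rw [hb' j hj1 h, if_neg hj]
    · rw [bvec_of_lt b h, bvec_of_lt b' h]
  refine ⟨b', fun j hj1 hj2 => ?_, ?_⟩
  · rw [h0 1 (by omega) le_rfl, h0 (j + 1) (by omega) (by omega)]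
    rcases eq_or_ne j 2 with rfl | hj
    · rw [h2, lie_sub, lie_smul, lie_self, smul_zero, sub_zero, hc 2 le_rfl hj2]
    · rw [h0 j hj (by omega), hc j hj1 hj2]
  · have hle : flag b 5 ≤ flag b' 5 := flag_le b fun j hj _ _ => by
      rw [← h0 j (by omega) (by omega)]
      exact bvec_mem_flag b' hj
    refine hle ?_
    rw [h2, h0 3 (by omega) (by omega), sub_lie, smul_lie, hc 3 (by omega) (by omega)]
    exact sub_mem_flag b (hb.lie_mem_succ 2 3 (by omega) (by omega) le_rfl (by omega))

/-- In dimension at most three, a chain basis can be chosen whose second vector is any given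
vector outside the derived algebra. -/
theorem IsChainBasis.exists_second_eq (hc : IsChainBasis b) (hb : IsCentralFlag b) (hn2 : 2 ≤ n)
    (hn : n ≤ 3) {x : L} (hx : x ∉ flag b 3) :
    ∃ b' : Basis (Fin n) ℂ L, IsChainBasis b' ∧ bvec b' 2 = x := by
  have h4 : ∀ z ∈ flag b 4, z = 0 := fun z => eq_zero_of_mem_flag b (by omega)
  have hcen : ∀ y, ∀ z ∈ flag b 3, ⁅y, z⁆ = 0 := fun y z hz =>
    h4 _ (hb.lie_mem_flag_succ y le_rfl hz)
  set p := bco b 1 x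
  set q := bco b 2 x
  obtain ⟨z, hz, hxz⟩ : ∃ z ∈ flag b 3, x = p • bvec b 1 + q • bvec b 2 + z := by
    have h2 := sub_mem_flag b (sub_mem_flag b (mem_flag_one b x))
    rw [map_sub, map_smul, bco_bvec_of_ne b (show 1 + 1 ≠ 1 by omega), smul_zero, sub_zero] at h2
    exact ⟨_, h2, by simp only [p, q]; abel⟩
  have h12 : ⁅bvec b 1, bvec b 2⁆ = bvec b 3 := hc 2 le_rfl hn2
  -- the first vector of the new basis
  obtain ⟨y, hy⟩ : ∃ y, ∃ c : ℂ, c ≠ 0 ∧ ⁅y, x⁆ = c • bvec b 3 ∧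
      ∀ P : Submodule ℂ L, y ∈ P → x - z ∈ P → bvec b 1 ∈ P ∧ bvec b 2 ∈ P := by
    -- Modulo the centre x is pY_1 + qY_2. If q = 0, take y = Y_2, with [y, x] = -pY_3; otherwise y
    -- = Y_1, with [y, x] = qY_3.
    by_cases hq : q = 0
    · have hp : p ≠ 0 := fun hp => hx (by rw [hxz, hp, hq]; simpa using hz)
      refine ⟨bvec b 2, -p, neg_ne_zero.mpr hp, ?_, fun P h1 h2 => ⟨?_, h1⟩⟩
      · rw [hxz, lie_add, lie_add, hcen _ _ hz, lie_smul, lie_smul, lie_self, ← lie_skew, h12]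
        simp
      · rw [hxz, add_sub_cancel_right, hq, zero_smul, add_zero] at h2
        exact (P.smul_mem_iff hp).mp h2
    · refine ⟨bvec b 1, q, hq, ?_, fun P h1 h2 => ⟨h1, ?_⟩⟩
      · rw [hxz, lie_add, lie_add, hcen _ _ hz, lie_smul, lie_smul, lie_self, h12]
        simp
      · rw [hxz, add_sub_cancel_right] at h2
        exact (P.smul_mem_iff hq).mp ((P.add_mem_iff_right (P.smul_mem p h1)).mp h2)
  obtain ⟨c, hc0, hyx, hP⟩ := hy
  obtain ⟨b', hb'⟩ := exists_basis_of_span b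
    (fun j => if j = 1 then y else if j = 2 then x else c • bvec b 3) fun P hX => by
      have h1 : y ∈ P := by simpa using hX 1 le_rfl (by omega)
      have h2 : x ∈ P := by simpa using hX 2 (by omega) (by omega)
      have h3 : flag b 3 ≤ P := flag_le b fun j h1 _ h2 => by
        obtain rfl : j = 3 := by omega
        have := hX 3 (by omega) h2
        simp only [OfNat.ofNat_ne_one, if_false] at this
        exact (P.smul_mem_iff hc0).mp (by simpa using this)
      obtain ⟨h4, h5⟩ := hP P h1 (P.sub_mem h2 (h3 hz))
      intro j hj1 hj2
      obtain rfl | rfl | rfl : j = 1 ∨ j = 2 ∨ j = 3 := by omega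
      · exact h4
      · exact h5
      · exact h3 (bvec_mem_flag b le_rfl)
  have e1 : bvec b' 1 = y := by rw [hb' 1 le_rfl (by omega), if_pos rfl]
  have e2 : bvec b' 2 = x := by rw [hb' 2 (by omega) hn2, if_neg (by omega), if_pos rfl]
  have e3 : bvec b' 3 = c • bvec b 3 := by
    rcases hn.eq_or_lt with rfl | hn
    · rw [hb' 3 (by omega) le_rfl, if_neg (by omega), if_neg (by omega)]
    · rw [bvec_of_lt b' hn, bvec_of_lt b hn, smul_zero]
  refine ⟨b', fun j hj1 hj2 => ?_, e2⟩
  obtain rfl | rfl : j = 2 ∨ j = 3 := by omega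
  · rw [e1, e2, hyx, e3]
  · rw [e1, e3, lie_smul, hcen _ _ (bvec_mem_flag b le_rfl), smul_zero, bvec_of_lt b' (by omega)]

/-- A semisimple derivation of a filiform algebra preserves the flag of a suitable normalised chain
basis. -/
theorem IsFiliform.exists_adapted_basis (h : IsFiliform L) {D : LieDerivation ℂ L L}
    (hD : Module.End.IsSemisimple (D : L →ₗ[ℂ] L)) :
    ∃ (n : ℕ) (b : Basis (Fin n) ℂ L), 2 ≤ n ∧ IsChainBasis b ∧ IsCentralFlag b ∧
      ⁅bvec b 2, bvec b 3⁆ ∈ flag b 5 ∧ ∀ i, ∀ x ∈ flag b i, D x ∈ flag b i := by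
  obtain ⟨n, b, hn, hc⟩ := h.exists_isChainBasis
  have hb := hc.isCentralFlag h.2.1
  have : FiniteDimensional ℂ L := h.1
  rcases le_or_gt 4 n with hn4 | hn3
  · obtain ⟨b', hc', h23⟩ := hc.exists_normalised hb hn4
    have hb' := hc'.isCentralFlag h.2.1
    exact ⟨n, b', hn, hc', hb', h23, fun i x hx => hb'.derivation_mem
      (hb'.derivation_mem_two hn4 (hc' 3 (by omega) (by omega)) h23 D) hx⟩
  -- In dimension at most 3, `derivation_mem_two` is unavailable. A `D`-stable complement of the
  -- third term supplies an eigenvector to use as Y_2.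
  · obtain ⟨q, hq, hcompl⟩ := Module.End.isSemisimple_iff.mp hD (flag b 3)
      ((Module.End.mem_invtSubmodule _).mpr
        fun x hx => hb.derivation_mem_of_three_le D le_rfl hx)
    have hq' : ∀ x ∈ q, (D : L →ₗ[ℂ] L) x ∈ q := (Module.End.mem_invtSubmodule _).mp hq
    have hnt : Nontrivial q := by
      rw [Submodule.nontrivial_iff_ne_bot]
      rintro rfl
      have htop := hcompl.sup_eq_top
      rw [sup_bot_eq] at htop
      exact bvec_notMem_flag b (le_refl 1) (by omega) (by omega : 1 < 3)
        (htop ▸ Submodule.mem_top)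
    obtain ⟨μ, hμ⟩ := Module.End.exists_eigenvalue ((D : L →ₗ[ℂ] L).restrict hq')
    obtain ⟨x, hx, hx0⟩ := hμ.exists_hasEigenvector
    have hx1 : D (x : L) = μ • (x : L) :=
      congrArg Subtype.val (Module.End.mem_eigenspace_iff.mp hx)
    have hx3 : (x : L) ∉ flag b 3 := fun h3 => hx0 (Subtype.ext
      (Submodule.disjoint_def.mp hcompl.disjoint x h3 x.2))
    obtain ⟨b', hc', h2⟩ := hc.exists_second_eq hb hn (by omega) hx3
    have hb' := hc'.isCentralFlag h.2.1
    refine ⟨n, b', hn, hc', hb', ?_, fun i x hx => hb'.derivation_mem ?_ hx⟩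
    · have : ⁅bvec b' 2, bvec b' 3⁆ = 0 := by
        refine eq_zero_of_mem_flag b' (show n < 4 by omega) ?_
        exact hb'.lie_mem_flag_succ _ le_rfl (bvec_mem_flag b' le_rfl)
      rw [this]; exact Submodule.zero_mem _
    · rw [h2, hx1, ← h2]
      exact Submodule.smul_mem _ _ (bvec_mem_flag b' le_rfl)

end Normal

/-! ### Bases of eigenvectors adapted to a semisimple derivation -/

section Eigen

variable {L : Type*} [LieRing L] [LieAlgebra ℂ L] {n : ℕ}

/-- The weights of a torus element on `Y₁, …, Y_N` and, if `N < n`, on `Y_n`. -/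
def chainWeight (N : ℕ) (α β : ℂ) (i : ℕ) : ℂ :=
  if i = 1 then α else if i ≤ N then β + (i - 2) * α else 2 * β + (N - 2) * α

theorem chainWeight_one (N : ℕ) (α β : ℂ) : chainWeight N α β 1 = α := if_pos rfl

theorem chainWeight_of_le {N i : ℕ} (α β : ℂ) (h1 : 2 ≤ i) (h2 : i ≤ N) :
    chainWeight N α β i = β + (i - 2) * α := by
  rw [chainWeight, if_neg (by omega), if_pos h2]

theorem chainWeight_of_lt {N i : ℕ} (α β : ℂ) (h1 : 2 ≤ i) (h2 : N < i) :
    chainWeight N α β i = 2 * β + (N - 2) * α := by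
  rw [chainWeight, if_neg (by omega), if_neg (by omega)]

/-- A basis of eigenvectors of `D` in which `Y₂, …, Y_N` is a chain for `Y₁`, where `N = n`, or
`N = n - 1` and `[Y₂, Y_{n-1}] = -Y_n`. -/
structure IsEigenFiliform (b : Basis (Fin n) ℂ L) (D : LieDerivation ℂ L L) (N : ℕ) (α β : ℂ) :
    Prop where
  le : N ≤ n
  le_succ : n ≤ N + 1
  two_le : 2 ≤ N
  even_of_lt : N < n → Even n ∧ 6 ≤ n
  map : ∀ i, 1 ≤ i → i ≤ n → D (bvec b i) = chainWeight N α β i • bvec b i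
  lie_one : ∀ j, 2 ≤ j → j < N → ⁅bvec b 1, bvec b j⁆ = bvec b (j + 1)
  lie_one_last : ∀ j, N ≤ j → j ≤ n → ⁅bvec b 1, bvec b j⁆ = 0
  support : ∀ i j l, 2 ≤ i → i ≤ n → 2 ≤ j → j ≤ n → bco b l ⁅bvec b i, bvec b j⁆ ≠ 0 →
    i + j ≤ l ∨ (l = n ∧ N < n ∧ i + j = n + 1)
  lie_two : N < n → ⁅bvec b 2, bvec b N⁆ = -bvec b n

/-- Project x along `A` to a stable complement. The image y satisfies f y ≡ μy modulo `A`, and the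
difference also lies in the complement, hence is zero. -/
theorem exists_eigenvector_sub_mem {V : Type*} [AddCommGroup V] [Module ℂ V] {f : Module.End ℂ V}
    (hf : f.IsSemisimple) {A B : Submodule ℂ V} (hA : ∀ x ∈ A, f x ∈ A) (hB : ∀ x ∈ B, f x ∈ B)
    (hAB : A ≤ B) {x : V} (hx : x ∈ B) (hgen : ∀ y ∈ B, ∃ c : ℂ, y - c • x ∈ A) :
    ∃ y ∈ B, y - x ∈ A ∧ ∃ μ : ℂ, f y = μ • y := by
  obtain ⟨q, hq, hcompl⟩ := Module.End.isSemisimple_iff.mp hf A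
    ((Module.End.mem_invtSubmodule _).mpr hA)
  have hq' : ∀ x ∈ q, f x ∈ q := (Module.End.mem_invtSubmodule _).mp hq
  obtain ⟨a, ha, y, hy, hay⟩ := Submodule.mem_sup.mp (hcompl.sup_eq_top ▸ Submodule.mem_top (x := x))
  have hyx : y - x ∈ A := by
    rw [← hay, sub_add_cancel_right]
    exact A.neg_mem ha
  have hyB : y ∈ B := by
    have := B.add_mem (hAB hyx) hx
    rwa [sub_add_cancel] at this
  obtain ⟨μ, hμ⟩ := hgen (f y) (hB y hyB)
  refine ⟨y, hyB, hyx, μ, ?_⟩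
  rw [← sub_eq_zero]
  refine Submodule.disjoint_def.mp hcompl.disjoint _ ?_ (q.sub_mem (hq' y hy) (q.smul_mem μ hy))
  have := A.sub_mem hμ (A.smul_mem μ hyx)
  rwa [smul_sub, sub_sub_sub_cancel_right] at this

variable {b : Basis (Fin n) ℂ L}

/-- Iterating ad x₁ on x₂ gives eigenvectors by the Leibniz rule, and replacing Y_1 by x₁ only adds
higher terms. The hypothesis on brackets is asked below `N` only, so that N = n - 1 remains possible
when [Y_2, Y_{n-1}] ≠ 0. -/
theorem exists_chain_of_eigenvectors (hc : IsChainBasis b) (hb : IsCentralFlag b)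
    {D : LieDerivation ℂ L L} {N : ℕ} (hN : N ≤ n)
    (hlie : ∀ i, 2 ≤ i → i < N → ∀ x ∈ flag b 2, ∀ y ∈ flag b i, ⁅x, y⁆ ∈ flag b (i + 2))
    {x₁ x₂ : L} {α β : ℂ} (h₁ : x₁ - bvec b 1 ∈ flag b 2) (h₂ : x₂ - bvec b 2 ∈ flag b 3)
    (hα : D x₁ = α • x₁) (hβ : D x₂ = β • x₂) :
    ∃ X : ℕ → L, X 1 = x₁ ∧ X 2 = x₂ ∧ (∀ i, 2 ≤ i → X (i + 1) = ⁅x₁, X i⁆) ∧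
      (∀ i, 1 ≤ i → i ≤ N → X i - bvec b i ∈ flag b (i + 1)) ∧
      ∀ i, 2 ≤ i → D (X i) = (β + (i - 2) * α) • X i := by
  let Z : ℕ → L := Nat.rec x₂ fun _ z => ⁅x₁, z⁆
  let X : ℕ → L := fun i => if i = 1 then x₁ else Z (i - 2)
  have hX2 : X 2 = x₂ := by simp [X, Z]
  have hXs : ∀ i, 2 ≤ i → X (i + 1) = ⁅x₁, X i⁆ := by
    intro i hi
    obtain ⟨i, rfl⟩ := Nat.exists_eq_add_of_le' hi
    simp [X, Z]
  refine ⟨X, by simp [X], hX2, hXs, fun i h1 hiN => ?_, fun i hi => ?_⟩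
  · rcases h1.eq_or_lt with rfl | h1
    · simpa [X] using h₁
    · induction i, h1 using Nat.le_induction with
      | base => rw [hX2]; exact h₂
      | succ i hi ih =>
        have hi' : 2 ≤ i := hi
        have h3 := ih (by omega) (by omega)
        have h4 : X i ∈ flag b i := by
          have := Submodule.add_mem _ (flag_anti b (Nat.le_succ i) h3) (bvec_mem_flag b (le_refl i))
          rwa [sub_add_cancel] at this
        have e : X (i + 1) - bvec b (i + 1) =
            ⁅bvec b 1, X i - bvec b i⁆ + ⁅x₁ - bvec b 1, X i⁆ := by
          rw [hXs i hi, ← hc i hi (by omega), lie_sub, sub_lie]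
          abel
        rw [e]
        exact Submodule.add_mem _ (hb.lie_mem_flag_succ _ (by omega) h3)
          (hlie i hi (by omega) _ h₁ _ h4)
  · induction i, hi using Nat.le_induction with
    | base => rw [hX2, hβ]; simp
    | succ i hi ih =>
      rw [hXs i hi, D.apply_lie_eq_add, ih, hα, smul_lie, lie_smul, ← add_smul]
      congr 1
      push_cast
      ring

/-- The case where `[Y₂, Y_{n-1}]` vanishes: `Y₂, …, Y_n` can be taken to be a chain. -/
theorem exists_isEigenFiliform_of_lie_mem (hc : IsChainBasis b) (hb : IsCentralFlag b) (hn : 2 ≤ n)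
    {D : LieDerivation ℂ L L} (hss : Module.End.IsSemisimple (D : L →ₗ[ℂ] L))
    (hD : ∀ i, ∀ x ∈ flag b i, D x ∈ flag b i)
    (hlie : ∀ i j, 2 ≤ i → 2 ≤ j → ∀ x ∈ flag b i, ∀ y ∈ flag b j, ⁅x, y⁆ ∈ flag b (i + j)) :
    ∃ (b' : Basis (Fin n) ℂ L) (N : ℕ) (α β : ℂ), IsEigenFiliform b' D N α β := by
  obtain ⟨x₁, -, h₁, α, hα⟩ := exists_eigenvector_sub_mem hss (hD 2) (hD 1)
    (flag_anti b (by omega)) (bvec_mem_flag b (le_refl 1)) fun y hy => ⟨_, sub_mem_flag b hy⟩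
  obtain ⟨x₂, -, h₂, β, hβ⟩ := exists_eigenvector_sub_mem hss (hD 3) (hD 2)
    (flag_anti b (by omega)) (bvec_mem_flag b (le_refl 2)) fun y hy => ⟨_, sub_mem_flag b hy⟩
  obtain ⟨X, hX1, hX2, hXs, hXf, hXD⟩ := exists_chain_of_eigenvectors hc hb (D := D) (le_refl n)
    (fun i hi _ x hx y hy => by rw [add_comm i 2]; exact hlie 2 i le_rfl hi x hx y hy) h₁ h₂ hα hβ
  have hXmem : ∀ i, 1 ≤ i → i ≤ n → X i ∈ flag b i := fun i h1 h2 => by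
    have := Submodule.add_mem _ (flag_anti b (Nat.le_succ i) (hXf i h1 h2))
      (bvec_mem_flag b (le_refl i))
    rwa [sub_add_cancel] at this
  obtain ⟨b', hb', hflag⟩ := exists_basis_of_triangular b X hXmem fun i h1 h2 => by
    have := hXf i h1 h2 i (Nat.lt_succ_self i)
    rw [map_sub, bco_bvec_self b h1 h2, sub_eq_zero] at this
    rw [this]
    exact one_ne_zero
  refine ⟨b', n, α, β, le_rfl, Nat.le_succ n, hn, fun h => absurd h (lt_irrefl n),
    fun i h1 h2 => ?_, fun j h1 h2 => ?_, fun j h1 h2 => ?_, fun i j l h1 h2 h3 h4 h5 => ?_,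
    fun h => absurd h (lt_irrefl n)⟩
  · rw [hb' i h1 h2]
    rcases h1.eq_or_lt with rfl | h1
    · rw [chainWeight_one, hX1]; exact hα
    · rw [chainWeight_of_le α β h1 h2, hXD i h1]
  · rw [hb' 1 le_rfl (by omega), hb' j (by omega) (by omega), hb' (j + 1) (by omega) (by omega), hX1,
      hXs j h1]
  · obtain rfl : j = n := le_antisymm h2 h1
    rw [hb' 1 le_rfl (by omega), hb' j (by omega) (by omega)]
    rcases hn.eq_or_lt with rfl | hn
    · exact eq_zero_of_mem_flag b (Nat.lt_succ_self 2) (hb.lie_mem_three _ _)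
    · exact eq_zero_of_mem_flag b (Nat.lt_succ_self j)
        (hb.lie_mem_flag_succ _ hn (hXmem j (by omega) le_rfl))
  · left
    by_contra hl
    refine h5 ?_
    have := hlie i j h1 h3 _ (hXmem i (by omega) h2) _ (hXmem j (by omega) h4)
    rw [← hb' i (by omega) h2, ← hb' j (by omega) h4, ← hflag] at this
    exact this l (by omega)

/-- The case where `[Y₂, Y_{n-1}]` does not vanish. -/
theorem exists_isEigenFiliform_of_bco_ne_zero (hc : IsChainBasis b) (hb : IsCentralFlag b)
    (hn : 6 ≤ n) (hn2 : Even n) (h23 : ⁅bvec b 2, bvec b 3⁆ ∈ flag b 5)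
    {D : LieDerivation ℂ L L} (hss : Module.End.IsSemisimple (D : L →ₗ[ℂ] L))
    (hD : ∀ i, ∀ x ∈ flag b i, D x ∈ flag b i)
    (hγ : bco b n ⁅bvec b 2, bvec b (n - 1)⁆ ≠ 0) :
    ∃ (b' : Basis (Fin n) ℂ L) (N : ℕ) (α β : ℂ), IsEigenFiliform b' D N α β := by
  set γ := bco b n ⁅bvec b 2, bvec b (n - 1)⁆ with hγdef
  have hzero : ∀ i j, 2 ≤ i → 2 ≤ j → n + 2 ≤ i + j → ∀ x ∈ flag b i, ∀ y ∈ flag b j,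
      ⁅x, y⁆ = 0 := fun i j hi hj hij x hx y hy =>
    eq_zero_of_mem_flag b (by omega) (lie_flag_mem_flag hc hb hi hj hx hy)
  have hlie : ∀ i j, 2 ≤ i → 2 ≤ j → i + j ≤ n → ∀ x ∈ flag b i, ∀ y ∈ flag b j,
      ⁅x, y⁆ ∈ flag b (i + j) := by
    intro i j hi hj hij x hx y hy
    refine lie_mem_of_flag_flag b (fun p q h1 _ h2 h3 _ h4 => ?_) hx hy
    rcases le_or_gt (p + q) n with h | h
    · exact flag_anti b (by omega) (lie_mem_flag_add hc hb h23 p q (by omega) (by omega) h)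
    · exact flag_anti b (by omega) (lie_mem_flag_add_sub_one hc hb p q (by omega) h2 (by omega) h4)
  have hγlie : ⁅bvec b 2, bvec b (n - 1)⁆ = γ • bvec b n := by
    refine eq_smul_bvec_last b ?_
    have := lie_mem_flag_add_sub_one hc hb 2 (n - 1) le_rfl (by omega) (by omega) (by omega)
    rwa [show 2 + (n - 1) - 1 = n by omega] at this
  have h1n : ⁅bvec b 1, bvec b (n - 1)⁆ = bvec b n := by
    rw [hc (n - 1) (by omega) (by omega), Nat.sub_add_cancel (by omega)]
  have hcen : ∀ x, ∀ y ∈ flag b n, ⁅x, y⁆ = 0 := fun x y hy =>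
    eq_zero_of_mem_flag b (Nat.lt_succ_self n) (hb.lie_mem_flag_succ x (by omega) hy)
  -- the centralizer of `Y_{n-1}`
  let K : Submodule ℂ L := LinearMap.ker (LieAlgebra.ad ℂ L (bvec b (n - 1)) : L →ₗ[ℂ] L)
  have hK : ∀ x, x ∈ K ↔ ⁅x, bvec b (n - 1)⁆ = 0 := fun x => by
    rw [LinearMap.mem_ker, LieAlgebra.ad_apply, ← lie_skew, neg_eq_zero]
  have hK3 : flag b 3 ≤ K := fun x hx => (hK x).mpr
    (hzero 3 (n - 1) (by omega) (by omega) (by omega) x hx _ (bvec_mem_flag b le_rfl))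
  -- D Y_{n-1} is a multiple of Y_{n-1} up to the central Y_n, so `D` preserves the centralizer.
  have hKD : ∀ x ∈ K, D x ∈ K := by
    intro x hx
    rw [hK] at hx ⊢
    have h3 := D.apply_lie_eq_add x (bvec b (n - 1))
    have h4 := sub_mem_flag b (hD _ _ (bvec_mem_flag b (le_refl (n - 1))))
    rw [Nat.sub_add_cancel (by omega)] at h4
    have h5 := hcen x _ h4
    rw [lie_sub, lie_smul, hx, smul_zero, sub_zero] at h5
    rw [hx, map_zero, h5, zero_add] at h3
    exact h3.symm
  -- Choosing the new Y_1 inside the centralizer is what makes its chain stop at index n - 1.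
  have hxK : bvec b 1 - γ⁻¹ • bvec b 2 ∈ K := by
    rw [hK, sub_lie, smul_lie, h1n, hγlie, smul_smul, inv_mul_cancel₀ hγ, one_smul, sub_self]
  obtain ⟨x₁, hx₁K, h₁, α, hα⟩ := exists_eigenvector_sub_mem hss (hD 3) hKD hK3 hxK fun y hy => by
    have h3 := sub_mem_flag b (mem_flag_one b y)
    have h4 := sub_mem_flag b h3
    set p := bco b 1 y
    set q := bco b (1 + 1) (y - p • bvec b 1)
    have h5 := K.sub_mem hy (hK3 h4)
    rw [sub_sub, sub_sub_cancel, hK, add_lie, smul_lie, smul_lie, h1n, hγlie, smul_smul,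
      ← add_smul, smul_eq_zero] at h5
    have h6 := h5.resolve_right (bvec_ne_zero b (by omega) le_rfl)
    refine ⟨p, ?_⟩
    convert h4 using 1
    rw [smul_sub, smul_smul, sub_sub]
    have h7 : q = -(p * γ⁻¹) := by
      field_simp
      linear_combination h6
    rw [h7, neg_smul, one_add_one_eq_two]
    abel
  obtain ⟨x₂, -, h₂, β, hβ⟩ := exists_eigenvector_sub_mem hss (hD 3) (hD 2)
    (flag_anti b (by omega)) (bvec_mem_flag b (le_refl 2)) fun y hy => ⟨_, sub_mem_flag b hy⟩
  have hβ' : D x₂ = β • x₂ := hβ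
  have h₁' : x₁ - bvec b 1 ∈ flag b 2 := by
    have := Submodule.sub_mem _ (flag_anti b (show 2 ≤ 3 by omega) h₁)
      (Submodule.smul_mem _ γ⁻¹ (bvec_mem_flag b (le_refl 2)))
    convert this using 1
    abel
  obtain ⟨Z, hZ1, hZ2, hZs, hZf, hZD⟩ := exists_chain_of_eigenvectors hc hb (D := D)
    (N := n - 1) (by omega) (fun i hi hin x hx y hy => by
      rw [add_comm i 2]; exact hlie 2 i le_rfl hi (by omega) x hx y hy) h₁' h₂ hα hβ
  have hZmem : ∀ i, 1 ≤ i → i ≤ n - 1 → Z i ∈ flag b i := fun i h1 h2 => by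
    have := Submodule.add_mem _ (flag_anti b (Nat.le_succ i) (hZf i h1 h2))
      (bvec_mem_flag b (le_refl i))
    rwa [sub_add_cancel] at this
  have hZn1 : Z (n - 1) - bvec b (n - 1) ∈ flag b n := by
    have := hZf (n - 1) (by omega) le_rfl
    rwa [Nat.sub_add_cancel (by omega)] at this
  -- The chain yields nothing at index n, since [x₁, Z (n - 1)] = 0; the last vector comes from x₂,
  -- with the sign used in the family `B`.
  let X : ℕ → L := fun i => if i = n then -⁅x₂, Z (n - 1)⁆ else Z i
  have hXn : X n = -(γ • bvec b n) := by
    have e1 := hzero 3 (n - 1) (by omega) (by omega) (by omega) _ h₂ _ (hZmem _ (by omega) le_rfl)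
    have e2 := hcen (bvec b 2) _ hZn1
    rw [sub_lie, sub_eq_zero] at e1
    rw [lie_sub, sub_eq_zero] at e2
    simp only [X, if_true]
    rw [e1, e2, hγlie]
  have hXZ : ∀ i, i ≤ n - 1 → X i = Z i := fun i hi => if_neg (by omega)
  have hXmem : ∀ i, 1 ≤ i → i ≤ n → X i ∈ flag b i := by
    intro i h1 h2
    rcases h2.eq_or_lt with rfl | h2
    · rw [hXn]
      exact Submodule.neg_mem _ (Submodule.smul_mem _ _ (bvec_mem_flag b le_rfl))
    · rw [hXZ i (by omega)]
      exact hZmem i h1 (by omega)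
  obtain ⟨b', hb', hflag⟩ := exists_basis_of_triangular b X hXmem fun i h1 h2 => by
    rcases h2.eq_or_lt with rfl | h2
    · rw [hXn, map_neg, map_smul, bco_bvec_self b h1 le_rfl, smul_eq_mul, mul_one]
      exact neg_ne_zero.mpr hγ
    · rw [hXZ i (by omega)]
      have := hZf i h1 (by omega) i (Nat.lt_succ_self i)
      rw [map_sub, bco_bvec_self b h1 h2.le, sub_eq_zero] at this
      rw [this]
      exact one_ne_zero
  have hbZ : ∀ i, 1 ≤ i → i ≤ n - 1 → bvec b' i = Z i := fun i h1 h2 => by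
    rw [hb' i h1 (by omega), hXZ i h2]
  have hbn : bvec b' n = -⁅x₂, Z (n - 1)⁆ := by
    rw [hb' n (by omega) le_rfl]
    exact if_pos rfl
  refine ⟨b', n - 1, α, β, by omega, by omega, by omega, fun _ => ⟨hn2, hn⟩,
    fun i h1 h2 => ?_, fun j h1 h2 => ?_, fun j h1 h2 => ?_, fun i j l h1 h2 h3 h4 h5 => ?_,
    fun h => ?_⟩
  · rcases h2.eq_or_lt with rfl | h2
    · rw [chainWeight_of_lt α β (by omega) (by omega), hbn, map_neg, D.apply_lie_eq_add, hβ',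
        hZD _ (by omega), smul_lie, lie_smul, ← add_smul, smul_neg]
      congr 2
      ring
    · rw [hbZ i h1 (by omega)]
      rcases h1.eq_or_lt with rfl | h1
      · rw [chainWeight_one, hZ1]; exact hα
      · rw [chainWeight_of_le α β h1 (by omega), hZD i h1]
  · rw [hbZ 1 le_rfl (by omega), hbZ j (by omega) (by omega), hbZ (j + 1) (by omega) (by omega),
      hZ1, hZs j h1]
  · rw [hbZ 1 le_rfl (by omega), hZ1]
    rcases h2.eq_or_lt with rfl | h2
    · exact hcen _ _ (hb' j (by omega) le_rfl ▸ hXmem j (by omega) le_rfl)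
    · obtain rfl : j = n - 1 := by omega
      rw [hbZ _ (by omega) le_rfl]
      have := hcen x₁ _ hZn1
      rwa [lie_sub, (hK x₁).mp hx₁K, sub_zero] at this
  · have hi := hXmem i (by omega) h2
    have hj := hXmem j (by omega) h4
    rw [← hb' i (by omega) h2] at hi
    rw [← hb' j (by omega) h4] at hj
    by_contra! hl
    rcases le_or_gt (i + j) n with hij | hij
    · have := hlie i j h1 h3 hij _ hi _ hj
      rw [← hflag] at this
      exact h5 (this l hl.1)
    · have := lie_flag_mem_flag hc hb h1 h3 hi hj
      rw [← hflag] at this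
      rcases lt_or_ge l (i + j - 1) with hl2 | hl2
      · exact h5 (this l hl2)
      · have hln : n < l := by
          by_contra hln
          have := hl.2 (by omega) (by omega)
          omega
        rw [bco_of_lt b' hln] at h5
        exact h5 rfl
  · rw [hbn, hbZ 2 (by omega) (by omega), hbZ _ (by omega) le_rfl, hZ2, neg_neg]

/-- Every semisimple derivation of a filiform algebra is diagonal in a basis with
essentially graded brackets. -/
theorem IsFiliform.exists_isEigenFiliform (h : IsFiliform L) {D : LieDerivation ℂ L L}
    (hss : Module.End.IsSemisimple (D : L →ₗ[ℂ] L)) :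
    ∃ (n : ℕ) (b : Basis (Fin n) ℂ L) (N : ℕ) (α β : ℂ), IsEigenFiliform b D N α β := by
  obtain ⟨n, b, hn, hc, hb, h23, hD⟩ := h.exists_adapted_basis hss
  set γ := bco b n ⁅bvec b 2, bvec b (n - 1)⁆ with hγdef
  have hmem := fun i j hi hi' hj hj' => lie_mem_flag_add_sub_one hc hb i j hi hi' hj hj'
  have hV := fun i j hi hj hij => lie_mem_flag_add hc hb h23 i j hi hj hij
  -- the structure constants in the last degree
  have hlast : ∀ a, a + 3 ≤ n →
      bco b n ⁅bvec b (2 + a), bvec b (n - 1 - a)⁆ = (-1) ^ a * γ := by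
    intro a
    induction a with
    | zero => intro _; simp [hγdef]
    | succ a ih =>
      intro ha
      have e := leibniz_lie (bvec b 1) (bvec b (2 + a)) (bvec b (n - 2 - a))
      rw [hc (2 + a) (by omega) (by omega), hc (n - 2 - a) (by omega) (by omega),
        show n - 2 - a + 1 = n - 1 - a by omega] at e
      have h0 : ⁅bvec b 1, ⁅bvec b (2 + a), bvec b (n - 2 - a)⁆⁆ = 0 := by
        refine eq_zero_of_mem_flag b (Nat.lt_succ_self n) (hb.lie_mem_flag_succ _ (by omega) ?_)
        have := hV (2 + a) (n - 2 - a) (by omega) (by omega) (by omega)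
        rwa [show 2 + a + (n - 2 - a) = n by omega] at this
      have e2 := congrArg (bco b n) e
      rw [h0, map_zero, map_add, ih (by omega)] at e2
      rw [show 2 + (a + 1) = 2 + a + 1 by ring, show n - 1 - (a + 1) = n - 2 - a by omega, pow_succ]
      linear_combination -e2
  by_cases hγ : 4 ≤ n ∧ γ ≠ 0
  · obtain ⟨hn4, hγ0⟩ := hγ
    -- For n = 2r + 1 the alternating constants pass through the coefficient of [Y_{r+1}, Y_{r+1}] =
    -- 0.
    have heven : Even n := by
      by_contra hodd
      rw [Nat.not_even_iff_odd] at hodd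
      obtain ⟨r, hr⟩ := hodd
      have := hlast (r - 1) (by omega)
      rw [show 2 + (r - 1) = r + 1 by omega, show n - 1 - (r - 1) = r + 1 by omega, lie_self,
        map_zero] at this
      exact mul_ne_zero (pow_ne_zero _ (by norm_num)) hγ0 this.symm
    -- For n = 4, γ is the Y_4 coefficient of [Y_2, Y_3], which was normalised to zero.
    have hn6 : 6 ≤ n := by
      by_contra hlt
      obtain ⟨r, hr⟩ := heven
      obtain rfl : n = 4 := by omega
      exact hγ0 (h23 4 (by omega))
    obtain ⟨b', N, α, β, h'⟩ := exists_isEigenFiliform_of_bco_ne_zero hc hb hn6 heven h23 hss hD hγ0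
    exact ⟨n, b', N, α, β, h'⟩
  · obtain ⟨b', N, α, β, h'⟩ := exists_isEigenFiliform_of_lie_mem hc hb hn hss hD
      fun i j hi hj x hx y hy => by
        refine lie_mem_of_flag_flag b (fun p q h1 _ h2 h3 _ h4 => ?_) hx hy
        refine flag_anti b (show i + j ≤ p + q by omega) ?_
        rcases le_or_gt (p + q) n with hpq | hpq
        · exact hV p q (by omega) (by omega) hpq
        have h5 := hmem p q (by omega) h2 (by omega) h4
        have h6 := mem_flag_succ b h5
        rw [Nat.sub_add_cancel (by omega)] at h6
        refine h6 ?_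
        rcases Nat.lt_or_ge (n + 1) (p + q) with hpq2 | hpq2
        · rw [bco_of_lt b (by omega)]; rfl
        obtain rfl : q = n + 1 - p := by omega
        rw [show p + (n + 1 - p) - 1 = n by omega]
        rcases le_or_gt n 3 with hn3 | hn3
        · obtain rfl : p = 2 := by omega
          obtain rfl : n = 3 := by omega
          rw [show 3 + 1 - 2 = 2 by rfl, lie_self, map_zero]
        · have h7 := hlast (p - 2) (by omega)
          have hγ0 : γ = 0 := by
            by_contra h8
            exact hγ ⟨hn3, h8⟩
          rwa [hγ0, mul_zero, show 2 + (p - 2) = p by omega,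
            show n - 1 - (p - 2) = n + 1 - p by omega] at h7
    exact ⟨n, b', N, α, β, h'⟩

end Eigen

/-! ### Identification of the tables -/

section Tables

variable {L : Type*} [LieRing L] [LieAlgebra ℂ L] {n : ℕ} {b : Basis (Fin n) ℂ L} {N k : ℕ}

theorem IsGradedFiliform.bco_lie_one (hb : IsGradedFiliform b N k) {l : ℕ} (hl : 2 ≤ l) (hl' : l < N)
    {x : L} (hx : x ∈ flag b 2) : bco b (l + 1) ⁅bvec b 1, x⁆ = bco b l x := by
  have hN := hb.le
  have : flag b 2 ≤ LinearMap.ker (bco b (l + 1) ∘ₗ (LieAlgebra.ad ℂ L (bvec b 1) : L →ₗ[ℂ] L) -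
      bco b l) := by
    refine flag_le b fun j h1 h2 h3 => ?_
    rw [LinearMap.mem_ker, LinearMap.sub_apply, LinearMap.comp_apply, LieAlgebra.ad_apply,
      sub_eq_zero]
    rcases lt_or_ge j N with hj | hj
    · rw [hb.lie_one j h1 hj]
      rcases eq_or_ne l j with rfl | hlj
      · rw [bco_bvec_self b (by omega) (by omega), bco_bvec_self b (by omega) (by omega)]
      · rw [bco_bvec_of_ne b hlj, bco_bvec_of_ne b (by omega)]
    · rw [hb.lie_one_last j hj h3, map_zero, bco_bvec_of_ne b (by omega)]
  exact sub_eq_zero.mp (this hx)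

/-- The parameters of a graded filiform algebra. -/
def gradedParameter (b : Basis (Fin n) ℂ L) (k s : ℕ) : ℂ :=
  bco b (2 * s + k + 1) ⁅bvec b (s + 1), bvec b (s + 2)⁆

/-- The recursion a_{i,j} = a_{i,j+1} + a_{i+1,j} is the Jacobi identity for Y_1, Y_i, Y_j, read on
the single chain component allowed by the grading. -/
theorem IsGradedFiliform.bco_lie (hb : IsGradedFiliform b N k) (d i : ℕ) (hi : 2 ≤ i)
    (hd : 2 * i + d + k ≤ N + 2) :
    bco b (2 * i + d + k - 2) ⁅bvec b i, bvec b (i + d)⁆ =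
      coeffAux (gradedParameter b k) d i := by
  have hN := hb.le
  have hk := hb.two_le
  induction d using Nat.twoStepInduction generalizing i with
  | zero => rw [show i + 0 = i from rfl, lie_self, map_zero, coeffAux]
  | one =>
    obtain ⟨i, rfl⟩ := Nat.exists_eq_add_of_le' (show 1 ≤ i by omega)
    rw [coeffAux, gradedParameter, Nat.add_sub_cancel]
    congr 2
    omega
  | more d ih1 ih2 =>
    have e := leibniz_lie (bvec b 1) (bvec b i) (bvec b (i + d + 1))
    rw [hb.lie_one i hi (by omega), hb.lie_one (i + d + 1) (by omega) (by omega)] at e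
    have hmem : ⁅bvec b i, bvec b (i + d + 1)⁆ ∈ flag b 2 :=
      hb.lie_mem_flag hi (by omega) (by omega) (by omega) (by omega)
    have e1 := hb.bco_lie_one (l := 2 * i + (d + 1) + k - 2) (by omega) (by omega) hmem
    rw [e, map_add, show 2 * i + (d + 1) + k - 2 + 1 = 2 * (i + 1) + d + k - 2 by omega] at e1
    have e2 := ih1 (i + 1) (by omega) (by omega)
    have e3 := ih2 i hi (by omega)
    rw [show i + 1 + d = i + d + 1 by ring] at e2
    rw [coeffAux, ← e2, ← e3, show i + (d + 2) = i + d + 1 + 1 by ring,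
      show 2 * i + (d + 2) + k - 2 = 2 * (i + 1) + d + k - 2 by omega,
      show i + (d + 1) = i + d + 1 by ring, ← e1]
    ring

theorem coeffAux_eq_zero (lam : ℕ → ℂ) (h : ∀ s, 1 ≤ s → 2 * s + k + 1 ≤ N → lam s = 0) (d i : ℕ)
    (hi : 2 ≤ i) (hd : 2 * i + d + k ≤ N + 2) : coeffAux lam d i = 0 := by
  induction d using Nat.twoStepInduction generalizing i with
  | zero => rfl
  | one => exact h (i - 1) (by omega) (by omega)
  | more d ih1 ih2 =>
    rw [coeffAux, ih1 (i + 1) (by omega) (by omega), ih2 i hi (by omega), sub_zero]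

/-- All chain components are generated by those of the brackets [Y_{s+1}, Y_{s+2}], so these cannot
all vanish if one component does not. -/
theorem IsGradedFiliform.exists_gradedParameter_ne_zero (hb : IsGradedFiliform b N k)
    (h : ∃ i j l, 2 ≤ i ∧ i < j ∧ j ≤ n ∧ l ≤ N ∧ bco b l ⁅bvec b i, bvec b j⁆ ≠ 0) :
    ∃ s, 1 ≤ s ∧ 2 * s + k + 1 ≤ N ∧ gradedParameter b k s ≠ 0 := by
  obtain ⟨i, j, l, h1, h2, h3, h4, h5⟩ := h
  by_contra! h0
  have h6 := hb.support i j l h1 (by omega) (by omega) h3 h5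
  obtain ⟨d, rfl⟩ := Nat.exists_eq_add_of_le h2.le
  refine h5 ?_
  have h7 := hb.bco_lie d i h1 (by omega)
  rw [coeffAux_eq_zero _ h0 d i h1 (by omega), show 2 * i + d + k - 2 = l by omega] at h7
  exact h7

theorem IsGradedFiliform.bco_lie_eq_coeff (hb : IsGradedFiliform b N k) {i j l : ℕ} (hi : 2 ≤ i)
    (hij : i < j) (hl : l + 2 = i + j + k) (hlN : l ≤ N) :
    bco b l ⁅bvec b i, bvec b j⁆ = coeff (gradedParameter b k) i j := by
  obtain ⟨d, rfl⟩ := Nat.exists_eq_add_of_le hij.le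
  rw [coeff, Nat.add_sub_cancel_left, ← hb.bco_lie d i hi (by omega)]
  congr 2
  omega

theorem IsGradedFiliform.isIsoToA (hb : IsGradedFiliform b N k) (hN : N = n)
    (h : ∃ i j l, 2 ≤ i ∧ i < j ∧ j ≤ n ∧ l ≤ N ∧ bco b l ⁅bvec b i, bvec b j⁆ ≠ 0) :
    IsIsoToA L := by
  obtain ⟨s, hs1, hs2, hs⟩ := hb.exists_gradedParameter_ne_zero h
  subst hN
  obtain ⟨hc, e⟩ := exists_equiv_skewTable b (fun i j l =>
    if i = 1 then (if l = j + 1 then 1 else 0)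
    else if l + 2 = i + j + k then coeff (gradedParameter b k) i j else 0)
    fun i j l h1 h2 h3 h4 h5 => by
      split_ifs with h6 h7 h7
      · subst h6
        rw [hb.lie_one j h2 (by omega), h7, bco_bvec_self b (by omega) (by omega)]
      · subst h6
        rcases h3.lt_or_eq with h3 | rfl
        · rw [hb.lie_one j h2 h3, bco_bvec_of_ne b h7]
        · rw [hb.lie_one_last j le_rfl le_rfl, map_zero]
      · exact hb.bco_lie_eq_coeff (by omega) h2 h7 h5
      · by_contra h0
        have := hb.support i j l (by omega) (by omega) (by omega) h3 h0
        omega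
  exact ⟨N, k, gradedParameter b k, hc, hb.two_le, by omega, ⟨s, hs1, by omega, hs⟩, e⟩

/-- No bracket with Y_1 has a Y_n component when N + 1 = n. Jacobi with Y_1 therefore makes these
coefficients alternate, starting from [Y_2, Y_N] = -Y_n. -/
theorem IsGradedFiliform.bco_lie_last (hb : IsGradedFiliform b N k) (hN : N + 1 = n) (i : ℕ)
    (hi : i + 2 ≤ N) :
    bco b n ⁅bvec b (i + 2), bvec b (N - i)⁆ = (-1) ^ (i + 2 + 1) := by
  induction i with
  | zero =>
    rw [Nat.sub_zero, zero_add, hb.lie_two (by omega), map_neg,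
      bco_bvec_self b (by omega) le_rfl]
    norm_num
  | succ i ih =>
    have e := leibniz_lie (bvec b 1) (bvec b (i + 2)) (bvec b (N - (i + 1)))
    rw [hb.lie_one (i + 2) (by omega) (by omega), hb.lie_one _ (by omega) (by omega),
      show N - (i + 1) + 1 = N - i by omega] at e
    have h0 : ∀ x ∈ flag b 2, bco b n ⁅bvec b 1, x⁆ = 0 := by
      intro x hx
      refine lie_mem_of_flag b (P := LinearMap.ker (bco b n)) (fun j h1 h2 h3 => ?_) hx
      rw [LinearMap.mem_ker]
      rcases lt_or_ge j N with hj | hj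
      · rw [hb.lie_one j h1 hj, bco_bvec_of_ne b (by omega)]
      · rw [hb.lie_one_last j hj h3, map_zero]
    have h1 := h0 _ (hb.lie_mem_flag (i := i + 2) (j := N - (i + 1)) (r := 2) (by omega) (by omega)
      (by omega) (by omega) (by omega))
    rw [e, map_add, ih (by omega)] at h1
    rw [show i + 1 + 2 = i + 2 + 1 by ring, pow_succ]
    linear_combination h1

theorem IsGradedFiliform.isIsoToB (hb : IsGradedFiliform b N k) (hN : N + 1 = n) (hn : Even n)
    (h : ∃ i j l, 2 ≤ i ∧ i < j ∧ j ≤ n ∧ l ≤ N ∧ bco b l ⁅bvec b i, bvec b j⁆ ≠ 0) :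
    IsIsoToB L := by
  obtain ⟨s, hs1, hs2, hs⟩ := hb.exists_gradedParameter_ne_zero h
  obtain ⟨hc, e⟩ := exists_equiv_skewTable b (fun i j l =>
    if i = 1 then (if l = j + 1 ∧ l < n then 1 else 0)
    else if i + j = n + 1 ∧ l = n then (-1) ^ (i + 1)
    else if l + 2 = i + j + k ∧ l < n then coeff (gradedParameter b k) i j else 0)
    fun i j l h1 h2 h3 h4 h5 => by
      split_ifs with h6 h7 h7 h8
      · subst h6
        rw [hb.lie_one j h2 (by omega), h7.1, bco_bvec_self b (by omega) (by omega)]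
      · subst h6
        rcases lt_or_ge j N with h3 | h8
        · rw [hb.lie_one j h2 h3, bco_bvec_of_ne b (by omega)]
        · rw [hb.lie_one_last j h8 h3, map_zero]
      · obtain ⟨i, rfl⟩ := Nat.exists_eq_add_of_le' (show 2 ≤ i by omega)
        rw [← hb.bco_lie_last hN i (by omega), h7.2, show N - i = j by omega]
      · exact hb.bco_lie_eq_coeff (by omega) h2 h8.1 (by omega)
      · by_contra h0
        have := hb.support i j l (by omega) (by omega) (by omega) h3 h0
        omega
  exact ⟨n, k, gradedParameter b k, hc, hn, hb.two_le, by omega, ⟨s, hs1, by omega, hs⟩, e⟩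

end Tables

/-! ### Weights of the torus and the three possible shapes of the algebra -/

section Conclusion

variable {L : Type*} [LieRing L] [LieAlgebra ℂ L] {n : ℕ} {b : Basis (Fin n) ℂ L} {N : ℕ} {α β : ℂ}
  {D : LieDerivation ℂ L L}

theorem IsEigenFiliform.weight_add (h : IsEigenFiliform b D N α β) {i j l : ℕ} (hi : 1 ≤ i)
    (hi' : i ≤ n) (hj : 1 ≤ j) (hj' : j ≤ n) (h0 : bco b l ⁅bvec b i, bvec b j⁆ ≠ 0) :
    chainWeight N α β l = chainWeight N α β i + chainWeight N α β j := by
  have hl : 1 ≤ l ∧ l ≤ n := by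
    by_contra hl
    rw [bco, dif_neg hl] at h0
    exact h0 rfl
  have hco : bco b l ∘ₗ (D : L →ₗ[ℂ] L) = chainWeight N α β l • bco b l := by
    refine linearMap_ext_bvec b fun p h1 h2 => ?_
    rw [LinearMap.comp_apply, LieDerivation.coeFn_coe, h.map p h1 h2, map_smul,
      LinearMap.smul_apply]
    rcases eq_or_ne l p with rfl | hlp
    · rfl
    · rw [bco_bvec_of_ne b hlp, smul_zero, smul_zero]
  have e := LinearMap.congr_fun hco ⁅bvec b i, bvec b j⁆
  rw [LinearMap.comp_apply, LieDerivation.coeFn_coe, D.apply_lie_eq_add, h.map i hi hi',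
    h.map j hj hj', smul_lie, lie_smul, ← add_smul, map_smul, LinearMap.smul_apply, smul_eq_mul,
    smul_eq_mul] at e
  rw [← mul_right_cancel₀ h0 e, add_comm]

/-- Additivity of weights on the given component says β = (l - i - j + 2)α, a multiple of at least
2. Hence α ≠ 0 for D ≠ 0, and comparing coefficients of α fixes the index of every other component.
-/
theorem IsEigenFiliform.exists_isGradedFiliform (h : IsEigenFiliform b D N α β) (hD : D ≠ 0)
    {i j l : ℕ} (hi : 2 ≤ i) (hij : i < j) (hj : j ≤ n) (hl : l ≤ N)
    (h0 : bco b l ⁅bvec b i, bvec b j⁆ ≠ 0) : ∃ k, IsGradedFiliform b N k := by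
  have hN := h.le
  have hN' := h.le_succ
  have hijl : i + j ≤ l := by
    have := h.support i j l hi (by omega) (by omega) hj h0
    omega
  obtain ⟨k, rfl⟩ := Nat.exists_eq_add_of_le hijl
  have hw := h.weight_add (by omega) (by omega) (by omega) hj h0
  rw [chainWeight_of_le α β (by omega) hl, chainWeight_of_le α β hi (by omega),
    chainWeight_of_le α β (by omega) (by omega)] at hw
  have hβ : β = (k + 2) * α := by
    push_cast at hw
    linear_combination -hw
  have hα : α ≠ 0 := by
    rintro rfl
    rw [mul_zero] at hβ
    refine hD (LieDerivation.ext fun x => ?_)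
    have : (D : L →ₗ[ℂ] L) = 0 := linearMap_ext_bvec b fun p h1 h2 => by
      rw [LieDerivation.coeFn_coe, h.map p h1 h2, chainWeight, hβ]
      simp
    exact LinearMap.congr_fun this x
  refine ⟨k + 2, h.le, h.le_succ, by omega, by omega, h.lie_one, h.lie_one_last,
    fun p q r h1 h2 h3 h4 h5 => ?_, h.lie_two⟩
  have h6 := h.support p q r h1 h2 h3 h4 h5
  by_cases h7 : r = n ∧ N < n ∧ p + q = n + 1
  · exact Or.inr h7
  have hr : r ≤ n := by
    by_contra hr
    rw [bco_of_lt b (by omega)] at h5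
    exact h5 rfl
  have h8 := h.weight_add (by omega) h2 (by omega) h4 h5
  rw [chainWeight_of_le α β h1 (by omega), chainWeight_of_le α β h3 (by omega)] at h8
  rcases le_or_gt r N with h9 | h9
  · left
    refine ⟨?_, h9⟩
    rw [chainWeight_of_le α β (by omega) h9, hβ] at h8
    have h10 : ((r + 2 : ℕ) : ℂ) * α = ((p + q + (k + 2) : ℕ) : ℂ) * α := by
      push_cast
      linear_combination h8
    exact_mod_cast mul_right_cancel₀ hα h10
  · exfalso
    rw [chainWeight_of_lt α β (by omega) h9] at h8
    have h10 : ((N + 2 : ℕ) : ℂ) * α = ((p + q : ℕ) : ℂ) * α := by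
      push_cast
      linear_combination h8
    have h11 : N + 2 = p + q := by exact_mod_cast mul_right_cancel₀ hα h10
    omega

/-- Without chain components only the chain and the Y_n components constrain the weights. If α ≠ 0,
the latter occur only for i + j = N + 2, where the weight formula is additive for every pair (α',
β'). -/
theorem IsEigenFiliform.exists_derivation (h : IsEigenFiliform b D N α β)
    (h0 : ∀ i j l, 2 ≤ i → i < j → j ≤ n → l ≤ N → bco b l ⁅bvec b i, bvec b j⁆ = 0)
    (hα : N < n → α ≠ 0) (α' β' : ℂ) :
    ∃ E : LieDerivation ℂ L L, ∀ i, 1 ≤ i → i ≤ n →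
      E (bvec b i) = chainWeight N α' β' i • bvec b i := by
  have hN := h.le
  have hN' := h.le_succ
  have hN2 := h.two_le
  refine exists_diagonal_derivation b _ fun i j l h1 h2 h3 h4 h5 h6 => ?_
  rcases h1.eq_or_lt with rfl | h1
  · rcases lt_or_ge j N with hj | hj
    · rw [h.lie_one j h2 hj] at h6
      obtain rfl : l = j + 1 := by
        by_contra hl
        exact h6 (bco_bvec_of_ne b hl)
      rw [chainWeight_one, chainWeight_of_le α' β' (by omega) hj,
        chainWeight_of_le α' β' h2 (by omega)]
      push_cast
      ring
    · rw [h.lie_one_last j hj h3, map_zero] at h6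
      exact absurd rfl h6
  · have hl : N < l := by
      by_contra hl
      exact h6 (h0 i j l h1 h2 h3 (by omega))
    have h7 := h.support i j l h1 (by omega) (by omega) h3 h6
    have h8 := h.weight_add (by omega) (by omega) (by omega) h3 h6
    rw [chainWeight_of_lt α β (by omega) hl, chainWeight_of_le α β h1 (by omega),
      chainWeight_of_le α β (by omega) (by omega)] at h8
    have h9 : ((N + 2 : ℕ) : ℂ) * α = ((i + j : ℕ) : ℂ) * α := by
      push_cast
      linear_combination h8
    have h10 := mul_right_cancel₀ (hα (by omega)) h9
    rw [chainWeight_of_lt α' β' (by omega) hl, chainWeight_of_le α' β' h1 (by omega),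
      chainWeight_of_le α' β' (by omega) (by omega)]
    push_cast at h10
    linear_combination α' * h10

theorem IsEigenFiliform.isHeisenbergExtension (h : IsEigenFiliform b D N α β)
    (h0 : ∀ i j l, 2 ≤ i → i < j → j ≤ n → l ≤ N → bco b l ⁅bvec b i, bvec b j⁆ = 0)
    (hN : N < n) : IsHeisenbergExtension b := by
  have hN' := h.le_succ
  have h0' : ∀ i j l, 2 ≤ i → i ≤ n → 2 ≤ j → j ≤ n → bco b l ⁅bvec b i, bvec b j⁆ ≠ 0 → N < l :=
    bco_lie_ne_zero_of_lt (P := fun _ _ l => N < l) (fun _ _ _ h => h)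
      fun i j l h1 h2 h3 _ _ h4 => by
        by_contra hl
        exact h4 (h0 i j l h1 h2 h3 (by omega))
  refine ⟨(h.even_of_lt hN).2, fun j h1 h2 => h.lie_one j h1 (by omega),
    fun j h1 h2 => h.lie_one_last j (by omega) h2, fun i j h1 h2 h3 h4 l hl => ?_,
    fun i j h1 h2 h3 h4 h5 => ?_⟩
  · by_contra h6
    have := h0' i j l h1 h2 h3 h4 h6
    omega
  · refine bco_ext b fun l h6 h7 => ?_
    rw [map_zero]
    by_contra h8
    have := h.support i j l h1 h2 h3 h4 h8
    omega

/-- A filiform algebra of rank one that is completable belongs to the family `A` or `B`. -/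
theorem IsFiliform.isIsoToA_or_isIsoToB (hL : IsFiliform L) (hr : HasRank L 1)
    (hcompl : IsCompletable L) : IsIsoToA L ∨ IsIsoToB L := by
  obtain ⟨t, ht, hrank⟩ := hr
  have hnt : Nontrivial t := Module.nontrivial_of_finrank_pos (R := ℂ) (by omega)
  obtain ⟨⟨D, hDt⟩, hD⟩ := exists_ne (0 : t)
  have hspan : ∀ s ∈ t, ∃ c : ℂ, c • D = s := by
    intro s hs
    obtain ⟨c, hc⟩ := exists_smul_eq_of_finrank_eq_one hrank hD ⟨s, hs⟩
    exact ⟨c, congrArg Subtype.val hc⟩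
  have hD0 : D ≠ 0 := fun h => hD (Subtype.ext h)
  obtain ⟨n, b, N, α, β, h⟩ := hL.exists_isEigenFiliform (ht.1.2 D hDt)
  have hN := h.le
  have hN' := h.le_succ
  have hN2 := h.two_le
  by_cases h0 : ∃ i j l, 2 ≤ i ∧ i < j ∧ j ≤ n ∧ l ≤ N ∧ bco b l ⁅bvec b i, bvec b j⁆ ≠ 0
  · obtain ⟨i, j, l, h1, h2, h3, h4, h5⟩ := id h0
    obtain ⟨k, hk⟩ := h.exists_isGradedFiliform hD0 h1 h2 h3 h4 h5
    rcases hN.eq_or_lt with hNn | hNn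
    · exact Or.inl (hk.isIsoToA hNn h0)
    · exact Or.inr (hk.isIsoToB (by omega) (h.even_of_lt hNn).1 h0)
  exfalso
  have h0' : ∀ i j l, 2 ≤ i → i < j → j ≤ n → l ≤ N → bco b l ⁅bvec b i, bvec b j⁆ = 0 := by
    intro i j l h1 h2 h3 h4
    by_contra h5
    exact h0 ⟨i, j, l, h1, h2, h3, h4, h5⟩
  -- When α = 0 all of Y_2, …, Y_{n-1} have weight β, which is the situation of the family `C`.
  by_cases hα : N < n ∧ α = 0
  · have hH := h.isHeisenbergExtension h0' hα.1
    refine hH.not_isCompleteLie ht.1 (fun s hs => ?_) (hcompl t ht)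
    obtain ⟨c, rfl⟩ := hspan s hs
    refine ⟨fun i => c * chainWeight N α β i, ?_, fun j h1 h2 => ?_⟩
    · have := hH.six_le
      simp only
      rw [hα.2, chainWeight_of_le 0 β le_rfl hN2, chainWeight_of_le 0 β (by omega) (by omega)]
      ring
    · rw [LieDerivation.smul_apply, h.map j h1 h2, smul_smul]
  · have hα' : N < n → α ≠ 0 := fun h1 h2 => hα ⟨h1, h2⟩
    -- Derivations with arbitrary weights (α', β') lie in `t` by maximality, yet `t` is the line
    -- through `D`. The pairs (0, 1) and (1, 0) cannot both be multiples of (α, β).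
    have hmem : ∀ α' β' : ℂ, ∃ c : ℂ, c * α = α' ∧ c * β = β' := by
      intro α' β'
      obtain ⟨E, hE⟩ := h.exists_derivation h0' hα' α' β'
      have hfin : ∀ (F : LieDerivation ℂ L L) (w : ℕ → ℂ),
          (∀ i, 1 ≤ i → i ≤ n → F (bvec b i) = w i • bvec b i) →
          ∀ i : Fin n, ∃ μ : ℂ, F (b i) = μ • b i := fun F w hF i => by
        have := i.isLt
        exact ⟨_, bvec_fin b i ▸ hF (i + 1) (by omega) (by omega)⟩
      have hEt : E ∈ t := ht.mem_of_diagonal b (fun s hs => by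
        obtain ⟨c, rfl⟩ := hspan s hs
        exact hfin _ (fun i => c * chainWeight N α β i) fun i h1 h2 => by
          rw [LieDerivation.smul_apply, h.map i h1 h2, smul_smul]) (hfin E _ hE)
      obtain ⟨c, hc⟩ := hspan E hEt
      have key : ∀ i, 1 ≤ i → i ≤ n → c * chainWeight N α β i = chainWeight N α' β' i := by
        intro i h1 h2
        have e := hE i h1 h2
        rw [← hc, LieDerivation.smul_apply, h.map i h1 h2, smul_smul] at e
        exact smul_left_injective ℂ (bvec_ne_zero b h1 h2) e
      have k1 := key 1 le_rfl (by omega)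
      have k2 := key 2 (by omega) (by omega)
      rw [chainWeight_one, chainWeight_one] at k1
      rw [chainWeight_of_le α β le_rfl hN2, chainWeight_of_le α' β' le_rfl hN2] at k2
      norm_num at k2
      exact ⟨c, k1, k2⟩
    obtain ⟨c, h1, h2⟩ := hmem 0 1
    obtain ⟨c', h3, h4⟩ := hmem 1 0
    have hβ : β ≠ 0 := by
      rintro rfl
      rw [mul_zero] at h2
      exact zero_ne_one h2
    rw [(mul_eq_zero.mp h4).resolve_right hβ, zero_mul] at h3
    exact zero_ne_one h3

end Conclusion

end FiliformLie

end

theorem mainTheorem2 :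
    (∀ (L : Type*) [LieRing L] [LieAlgebra ℂ L],
      FiliformLie.IsFiliform L → FiliformLie.HasRank L 1 →
        (FiliformLie.IsCompletable L ↔ FiliformLie.IsIsoToA L ∨ FiliformLie.IsIsoToB L)) ∧
    (∀ (m : ℕ) (lam : ℕ → ℂ), 2 ≤ m →
      (∃ (f : LieDerivation ℂ (FiliformLie.AlgebraC m lam) (FiliformLie.AlgebraC m lam))
        (t : LieSubalgebra ℂ
          (LieDerivation ℂ (FiliformLie.AlgebraC m lam) (FiliformLie.AlgebraC m lam))),
        f (FiliformLie.vecC m lam 1) = 0 ∧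
        (∀ j, 2 ≤ j → j ≤ 2 * m + 1 → f (FiliformLie.vecC m lam j) = FiliformLie.vecC m lam j) ∧
        f (FiliformLie.vecC m lam (2 * m + 2)) = (2 : ℂ) • FiliformLie.vecC m lam (2 * m + 2) ∧
        t.toSubmodule = Submodule.span ℂ {f} ∧
        FiliformLie.IsTorus t ∧
        FiliformLie.weightSpace t 0 ≠ ⊥ ∧
        ¬ FiliformLie.IsCompleteLie (FiliformLie.TorusExtension t)) ∧
      (∃ h : LieDerivation ℂ (FiliformLie.AlgebraC m lam) (FiliformLie.AlgebraC m lam),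
        h (FiliformLie.vecC m lam 2) = FiliformLie.vecC m lam (2 * m + 1) ∧
        (∀ j, 1 ≤ j → j ≤ 2 * m + 2 → j ≠ 2 → h (FiliformLie.vecC m lam j) = 0) ∧
        ¬ ∃ x : FiliformLie.AlgebraC m lam, ∀ y : FiliformLie.AlgebraC m lam, h y = ⁅x, y⁆)) := by
  refine ⟨fun L _ _ hL hr => ⟨hL.isIsoToA_or_isIsoToB hr, fun h => ?_⟩, fun m lam hm =>
    ⟨FiliformLie.familyC_weight_derivation m lam hm,
      FiliformLie.familyC_outer_derivation m lam hm⟩⟩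
  rcases h with h | h
  · exact h.isCompletable hr
  · exact h.isCompletable hr
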